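/- For positive integers $m,n$, let the $m\times n$ grid be the graph whose vertices are the integer points $(x,y)$ with $1\le x\le m$ and $1\le y\le n$ and whose edges are the unit segments joining these points; its cells are the $(m-1)(n-1)$ unit squares bounded by four of its edges. The signature of a cycle $C$ in the grid is the function that assigns to each cell the number of edges of that cell which belong to $C$. The difference of two cycles is the set of all edges which belong to exactly one of them. Let $m \ge 2$ and $n\ge 2$ be integers with $d=\gcd(m,n)$, $m=dm'$, and $n=dn'$. Define $$\delta_{m,n}=\begin{cases}1 & \text{if } d \text{ is odd},\\ 0 & \text{if } d\equiv 0 \pmod 4,\\ 0 & \text{if } d\equiv 2 \pmod 4,\ m\ge 4,\ n\ge 4,\text{ and } mn/d^2 \text{ is even},\\ 4 & \text{otherwise.}\end{cases}$$ Then the greatest possible size of the difference between two (not necessarily distinct) cycles on the $m\times n$ grid with the same signature is exactly $mn-\delta_{m,n}m'n'$. -/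

import Mathlib

namespace Slitherlink

/-- The grid of size `m × n`, counted in vertices: the vertices are the points `(x, y)` with
`0 ≤ x < m` and `0 ≤ y < n`, and two of them are joined when they are at distance one. -/
abbrev grid (m n : ℕ) : SimpleGraph (Fin m × Fin n) :=
  SimpleGraph.boxProd (SimpleGraph.pathGraph m) (SimpleGraph.pathGraph n)

/-- `C` is the edge set of a cycle (simple closed walk) of the `m × n` grid. -/
def IsCycle {m n : ℕ} (C : Finset (Sym2 (Fin m × Fin n))) : Prop :=
  ∃ (u : Fin m × Fin n) (p : (grid m n).Walk u u), p.IsCycle ∧ p.edges.toFinset = C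

/-- The unit square cells, that is, the finite faces, of the `m × n` grid, each one labelled by
the coordinates of its lower left vertex. -/
abbrev Cell (m n : ℕ) : Type := Fin (m - 1) × Fin (n - 1)

/-- The vertex `(x + a, y + b)` of the cell with lower left vertex `(x, y)`, for `a, b` in
`{0, 1}`. -/
def Cell.vertex {m n : ℕ} (c : Cell m n) (a b : Fin 2) : Fin m × Fin n :=
  (⟨c.1.val + a.val, by omega⟩, ⟨c.2.val + b.val, by omega⟩)

/-- The lower, upper, left, and right edges of a cell. -/
def Cell.edges {m n : ℕ} (c : Cell m n) : Finset (Sym2 (Fin m × Fin n)) :=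
  {s(Cell.vertex c 0 0, Cell.vertex c 1 0), s(Cell.vertex c 0 1, Cell.vertex c 1 1),
    s(Cell.vertex c 0 0, Cell.vertex c 0 1), s(Cell.vertex c 1 0, Cell.vertex c 1 1)}

/-- The signature of a set of edges: it assigns to every cell the number of edges of that cell
that belong to the set. -/
def signature {m n : ℕ} (C : Finset (Sym2 (Fin m × Fin n))) : Cell m n → ℕ :=
  fun c => (Cell.edges c ∩ C).card

/-- The correction term `δ_{m, n}`. -/
def delta (m n : ℕ) : ℕ :=
  if Odd (Nat.gcd m n) then 1
  else if Nat.gcd m n % 4 = 0 then 0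
  else if Nat.gcd m n % 4 = 2 ∧ 4 ≤ m ∧ 4 ≤ n ∧ Even (m * n / Nat.gcd m n ^ 2) then 0
  else 4

end Slitherlink

namespace Slitherlink

/-! Record each edge by its midpoint in doubled coordinates: vertices are the (odd, odd) points and
cells the (even, even) points. The difference `f` of two cycles with equal signatures is even around
every vertex and zero around every cell, so modulo 2 it solves the discrete wave equation.
Reflection in the sides of the grid extends it to the plane, and d'Alembert's formula
(`Wave.eq_add`, `IsDif.exists_profile`) yields a 0-1 sequence `A` such that the edge at `(i + j + 1,
i - j)` lies in the difference exactly when `A i ≠ A j`. The walls make `A` symmetric, so it is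
determined by its values on `0, ..., d - 1` (`Profile.refl_gcd`). If `k` of these are 1, counting on
a torus (`dcard_eq`) gives the size `4k(d - k)m'n' = mn - (d - 2k)²m'n'`.

For the upper bound only the case `d = 2k` with correction term 4 must be excluded. If a side has
two vertices, a corner cell does this. Otherwise `m'`, `n'` and `k` are odd. Each cycle bounds a set
of cells, encoded by spins 1 and -1. The sum of the two spins lives on the cells where they agree;
an explicit weight of values 1 and -1, built from a primitive of `A`, is used on the cells where
they disagree. Each of the two functions has neighbour sum zero on the cells of the other
(`Profile.plus_minus`), so by Green's identity the flux through the boundary vanishes. But this flux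
telescopes along each side, and the remaining corner terms add up to at least 1
(`Profile.false_of_odd`).

For the lower bound, pairs of loops in adjacent boxes are glued across a cell by trading two facing
common edges for the other two sides of that cell (`Pair.join`). Every second copy is mirrored with
its loops exchanged, which makes the differences cancel in the new cells. The same counting formula
then gives the size of an array. The building blocks are a `4 × 4` pair, a `6 × 4` pair, and a pair
on each odd square grid of side `q = 2N + 1`. The last consists of `N(N + 1)` blocks of `2 × 2`
vertices: in each block the parameter `c` selects one of the two complementary two-edge paths
between the same opposite corners, and all edges between blocks are common. Its difference has size
`4N(N + 1) = q² - 1`. When the correction term is 4, odd squares of side `d/2` are used. -/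

open Classical in
/-- The indicator of a proposition. -/
noncomputable def ind (p : Prop) : ℤ := if p then 1 else 0

lemma ind_true {p : Prop} (h : p) : ind p = 1 := by simp [ind, h]

lemma ind_false {p : Prop} (h : ¬p) : ind p = 0 := by simp [ind, h]

lemma ind_eq (p : Prop) : p ∧ ind p = 1 ∨ ¬p ∧ ind p = 0 := by
  by_cases h : p <;> simp [ind, h]

lemma ind_congr {p q : Prop} (h : p ↔ q) : ind p = ind q := by rw [propext h]

/-- The sum of a function over the four neighbours of a point. -/
def around (f : ℤ → ℤ → ℤ) (a b : ℤ) : ℤ := f (a + 1) b + f (a - 1) b + f a (b + 1) + f a (b - 1)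

/-- In doubled coordinates the vertex `(x, y)` is the point `(2x + 1, 2y + 1)`, the cells are the
points with two even coordinates, and an edge is represented by its midpoint. A set of edges is
then a predicate on `ℤ × ℤ`; `Supp m n e` says that it is contained in the `m × n` grid. -/
def Supp (m n : ℤ) (e : ℤ → ℤ → Prop) : Prop :=
  ∀ a b, e a b → 0 < a ∧ a < 2 * m ∧ 0 < b ∧ b < 2 * n ∧ (a + b) % 2 = 1

/-- The number of edges of `e` around a point. -/
noncomputable def deg (e : ℤ → ℤ → Prop) (a b : ℤ) : ℤ := around (fun a b => ind (e a b)) a b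

/-- Two vertices at distance one. -/
def Nbr (u v : ℤ × ℤ) : Prop :=
  (u.1 = v.1 ∧ (u.2 = v.2 + 1 ∨ v.2 = u.2 + 1)) ∨ (u.2 = v.2 ∧ (u.1 = v.1 + 1 ∨ v.1 = u.1 + 1))

/-- The graph on `ℤ × ℤ` formed by a set of edges. -/
def gr (e : ℤ → ℤ → Prop) : SimpleGraph (ℤ × ℤ) where
  Adj u v := Nbr u v ∧ e (u.1 + v.1 + 1) (u.2 + v.2 + 1)
  symm := ⟨fun u v h => by
    obtain ⟨h1, h2⟩ := h
    refine ⟨?_, by rwa [add_comm v.1, add_comm v.2]⟩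
    unfold Nbr at *; omega⟩
  loopless := ⟨fun u h => by
    obtain ⟨h1, -⟩ := h
    unfold Nbr at h1; omega⟩

lemma gr_adj {e : ℤ → ℤ → Prop} {u v : ℤ × ℤ} :
    (gr e).Adj u v ↔ Nbr u v ∧ e (u.1 + v.1 + 1) (u.2 + v.2 + 1) := Iff.rfl

lemma gr_right {e : ℤ → ℤ → Prop} {x y : ℤ} :
    (gr e).Adj (x, y) (x + 1, y) ↔ e (2 * x + 2) (2 * y + 1) := by
  rw [gr_adj, show x + (x + 1) + 1 = 2 * x + 2 by ring, show y + y + 1 = 2 * y + 1 by ring]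
  simp [Nbr]

lemma gr_up {e : ℤ → ℤ → Prop} {x y : ℤ} :
    (gr e).Adj (x, y) (x, y + 1) ↔ e (2 * x + 1) (2 * y + 2) := by
  rw [gr_adj, show y + (y + 1) + 1 = 2 * y + 2 by ring, show x + x + 1 = 2 * x + 1 by ring]
  simp [Nbr]

lemma nbr_cases {x y : ℤ} {v : ℤ × ℤ} (h : Nbr (x, y) v) :
    v = (x + 1, y) ∨ v = (x - 1, y) ∨ v = (x, y + 1) ∨ v = (x, y - 1) := by
  obtain ⟨a, b⟩ := v
  simp only [Nbr, Prod.mk.injEq] at *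
  omega

lemma gr_left {e : ℤ → ℤ → Prop} {x y : ℤ} :
    (gr e).Adj (x, y) (x - 1, y) ↔ e (2 * x) (2 * y + 1) := by
  rw [gr_adj, show x + (x - 1) + 1 = 2 * x by ring, show y + y + 1 = 2 * y + 1 by ring]
  simp [Nbr]

lemma gr_down {e : ℤ → ℤ → Prop} {x y : ℤ} :
    (gr e).Adj (x, y) (x, y - 1) ↔ e (2 * x + 1) (2 * y) := by
  rw [gr_adj, show y + (y - 1) + 1 = 2 * y by ring, show x + x + 1 = 2 * x + 1 by ring]
  simp [Nbr]

/-! ### Loops in the plane versus cycles of the grid. -/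

/-- A set of edges of the `m × n` grid which form one simple closed curve. -/
structure IsLoop (m n : ℤ) (e : ℤ → ℤ → Prop) : Prop where
  supp : Supp m n e
  deg : ∀ x y, deg e (2 * x + 1) (2 * y + 1) = 0 ∨ deg e (2 * x + 1) (2 * y + 1) = 2
  conn : ∀ u v, (∃ w, (gr e).Adj u w) → (∃ w, (gr e).Adj v w) → (gr e).Reachable u v
  nonempty : ∃ u w, (gr e).Adj u w

/-- The embedding of the vertices of the grid into the plane. -/
def emb {m n : ℕ} (u : Fin m × Fin n) : ℤ × ℤ := ((u.1 : ℕ), (u.2 : ℕ))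

lemma emb_injective {m n : ℕ} : Function.Injective (emb (m := m) (n := n)) := by
  rintro ⟨⟨a, ha⟩, ⟨b, hb⟩⟩ ⟨⟨c, hc⟩, ⟨d, hd⟩⟩ h
  simp only [emb, Prod.mk.injEq, Nat.cast_inj] at h
  simp [h.1, h.2]

lemma exists_emb {m n : ℕ} {u : ℤ × ℤ} (h1 : 0 ≤ u.1) (h2 : u.1 < m) (h3 : 0 ≤ u.2)
    (h4 : u.2 < n) : ∃ v : Fin m × Fin n, emb v = u :=
  ⟨(⟨u.1.toNat, by omega⟩, ⟨u.2.toNat, by omega⟩), by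
    ext <;> simp [emb, h1, h3]⟩

lemma grid_adj_iff {m n : ℕ} (u v : Fin m × Fin n) : (grid m n).Adj u v ↔ Nbr (emb u) (emb v) := by
  simp only [SimpleGraph.boxProd_adj, SimpleGraph.pathGraph_adj, Nbr, emb, Fin.ext_iff]
  omega

lemma Supp.mem_of_adj {m n : ℕ} {e : ℤ → ℤ → Prop} (h : Supp m n e) {u v : ℤ × ℤ}
    (huv : (gr e).Adj u v) : ∃ w : Fin m × Fin n, emb w = u := by
  have h1 := huv.1
  have h2 := h _ _ huv.2
  unfold Nbr at h1
  apply exists_emb <;> omega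

/-- The degree counts the neighbours. -/
lemma ncard_neighborSet_gr (e : ℤ → ℤ → Prop) (x y : ℤ) :
    (((gr e).neighborSet (x, y)).ncard : ℤ) = deg e (2 * x + 1) (2 * y + 1) := by
  classical
  have : (gr e).neighborSet (x, y) =
      ↑(({(x + 1, y), (x - 1, y), (x, y + 1), (x, y - 1)} : Finset (ℤ × ℤ)).filter
        (fun v => (gr e).Adj (x, y) v)) := by
    ext v
    simp only [SimpleGraph.mem_neighborSet, Finset.coe_filter, Finset.mem_insert,
      Finset.mem_singleton, Set.mem_ofPred_eq]
    exact ⟨fun h => ⟨nbr_cases h.1, h⟩, fun h => h.2⟩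
  rw [this, Set.ncard_coe_finset, Finset.card_filter]
  rw [Finset.sum_insert, Finset.sum_insert, Finset.sum_insert, Finset.sum_singleton]
  · simp only [gr_right, gr_left, gr_up, gr_down, deg, around, ind]
    push_cast
    rw [show 2 * x + 1 + 1 = 2 * x + 2 by ring, show 2 * y + 1 + 1 = 2 * y + 2 by ring,
      show 2 * x + 1 - 1 = 2 * x by ring, show 2 * y + 1 - 1 = 2 * y by ring]
    ring
  · simp; omega
  · simp
  · simp; omega

lemma IsLoop.ncard {m n : ℤ} {e : ℤ → ℤ → Prop} (h : IsLoop m n e) {u : ℤ × ℤ}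
    (hu : ((gr e).neighborSet u).Nonempty) : ((gr e).neighborSet u).ncard = 2 := by
  obtain ⟨x, y⟩ := u
  have h1 := ncard_neighborSet_gr e x y
  rcases h.deg x y with h2 | h2
  · rw [h2] at h1
    have hfin : ((gr e).neighborSet (x, y)).Finite :=
      Set.Finite.subset (Set.toFinite {(x + 1, y), (x - 1, y), (x, y + 1), (x, y - 1)})
        fun v hv => by simpa using nbr_cases hv.1
    have := (Set.ncard_pos hfin).2 hu
    omega
  · omega

/-- The part of the graph of `e` inside the grid. -/
def ggr (m n : ℕ) (e : ℤ → ℤ → Prop) : SimpleGraph (Fin m × Fin n) := (gr e).comap emb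

lemma image_neighborSet {m n : ℕ} {e : ℤ → ℤ → Prop} (h : Supp m n e) (u : Fin m × Fin n) :
    emb '' ((ggr m n e).neighborSet u) = (gr e).neighborSet (emb u) := by
  ext v
  constructor
  · rintro ⟨w, hw, rfl⟩
    exact hw
  · intro hv
    obtain ⟨w, rfl⟩ := h.mem_of_adj (SimpleGraph.Adj.symm hv)
    exact ⟨w, hv, rfl⟩

lemma IsLoop.isCycles {m n : ℕ} {e : ℤ → ℤ → Prop} (h : IsLoop m n e) : (ggr m n e).IsCycles := by
  intro u hu
  rw [← Set.ncard_image_of_injective _ emb_injective, image_neighborSet h.supp]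
  apply h.ncard
  rw [← image_neighborSet h.supp]
  exact hu.image _

/-- A walk along edges of `e` cannot leave the grid, since both ends of every edge lie in it. -/
lemma reachable_ggr {m n : ℕ} {e : ℤ → ℤ → Prop} (h : Supp m n e) {u : Fin m × Fin n} {v : ℤ × ℤ}
    (hr : (gr e).Reachable (emb u) v) : ∃ w, emb w = v ∧ (ggr m n e).Reachable u w := by
  obtain ⟨p⟩ := hr
  generalize hx : emb u = x at p
  induction p generalizing u with
  | nil => exact ⟨u, hx, SimpleGraph.Reachable.refl _⟩
  | cons hadj p ih =>
    subst hx
    obtain ⟨w, hw⟩ := h.mem_of_adj hadj.symm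
    obtain ⟨w', h1, h2⟩ := ih hw
    refine ⟨w', h1, SimpleGraph.Reachable.trans (SimpleGraph.Adj.reachable ?_) h2⟩
    change (gr e).Adj _ _
    rwa [hw]

lemma ggr_le {m n : ℕ} (e : ℤ → ℤ → Prop) : ggr m n e ≤ grid m n := fun u v h => by
  rw [grid_adj_iff]; exact h.1

/-- A loop is the edge set of a cycle of the grid. -/
lemma IsLoop.exists_isCycle {m n : ℕ} {e : ℤ → ℤ → Prop} (h : IsLoop m n e) :
    ∃ C : Finset (Sym2 (Fin m × Fin n)), IsCycle C ∧
      ∀ u v, s(u, v) ∈ C ↔ (gr e).Adj (emb u) (emb v) := by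
  classical
  obtain ⟨u, w, huw⟩ := h.nonempty
  obtain ⟨u, rfl⟩ := h.supp.mem_of_adj huw
  obtain ⟨w, rfl⟩ := h.supp.mem_of_adj huw.symm
  have hcyc := h.isCycles
  have huw' : (ggr m n e).Adj u w := huw
  -- All degrees are 0 or 2, so the component of `u` is the vertex set of one cycle `p`;
  -- connectedness of the loop puts every edge of `e` in that component.
  obtain ⟨p, hp, hv⟩ := hcyc.exists_cycle_toSubgraph_verts_eq_connectedComponentSupp
    (c := (ggr m n e).connectedComponentMk u) rfl ⟨w, huw'⟩
  refine ⟨(p.mapLe (ggr_le e)).edges.toFinset, ⟨u, p.mapLe (ggr_le e), ?_, rfl⟩, ?_⟩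
  · exact hp.mapLe _
  · intro a b
    rw [List.mem_toFinset, SimpleGraph.Walk.edges_mapLe_eq_edges]
    constructor
    · intro hab
      exact p.adj_of_mem_edges hab
    · intro hab
      have ha : a ∈ p.toSubgraph.verts := by
        rw [hv]
        have := h.conn _ _ ⟨_, huw⟩ ⟨_, hab⟩
        obtain ⟨a', h1, h2⟩ := reachable_ggr h.supp this
        rw [emb_injective h1] at h2
        exact SimpleGraph.ConnectedComponent.sound h2.symm
      rw [← SimpleGraph.Walk.mem_edges_toSubgraph, SimpleGraph.Subgraph.mem_edgeSet]
      have : (ggr m n e).LocallyFinite := fun v => Fintype.ofFinite _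
      exact (hp.adj_toSubgraph_iff_of_isCycles hcyc ha b).2 hab

/-- A loop remains connected when an edge is removed. -/
lemma IsLoop.reachable_delete {m n : ℕ} {e : ℤ → ℤ → Prop} (h : IsLoop m n e) {u v : ℤ × ℤ}
    (huv : (gr e).Adj u v) : ((gr e).deleteEdges {s(u, v)}).Reachable u v := by
  obtain ⟨u, rfl⟩ := h.supp.mem_of_adj huv
  obtain ⟨v, rfl⟩ := h.supp.mem_of_adj huv.symm
  have huv' : (ggr m n e).Adj u v := huv
  have := SimpleGraph.IsCycles.reachable_deleteEdges huv' h.isCycles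
  refine this.map (G' := (gr e).deleteEdges {s(emb u, emb v)}) ⟨emb, ?_⟩
  intro a b hab
  rw [SimpleGraph.deleteEdges_adj] at hab ⊢
  refine ⟨hab.1, fun hn => hab.2 ?_⟩
  simp only [Set.mem_singleton_iff, Sym2.eq_iff] at hn ⊢
  rcases hn with hn | hn
  · exact Or.inl ⟨emb_injective hn.1, emb_injective hn.2⟩
  · exact Or.inr ⟨emb_injective hn.1, emb_injective hn.2⟩

/-- The edges of a finite set of pairs of vertices, represented by their midpoints. -/
def edg {m n : ℕ} (C : Finset (Sym2 (Fin m × Fin n))) (a b : ℤ) : Prop :=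
  ∃ u v, s(u, v) ∈ C ∧ (emb u).1 + (emb v).1 + 1 = a ∧ (emb u).2 + (emb v).2 + 1 = b

/-- A unit segment is determined by its midpoint, so nothing is lost in passing from edges to
midpoints. -/
lemma nbr_mid {u v u' v' : ℤ × ℤ} (h : Nbr u v) (h' : Nbr u' v') (h1 : u.1 + v.1 = u'.1 + v'.1)
    (h2 : u.2 + v.2 = u'.2 + v'.2) : (u = u' ∧ v = v') ∨ (u = v' ∧ v = u') := by
  simp only [Nbr, Prod.ext_iff] at *
  omega

/-- The set consists of edges of the grid. -/
def InGrid {m n : ℕ} (C : Finset (Sym2 (Fin m × Fin n))) : Prop :=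
  ∀ u v, s(u, v) ∈ C → Nbr (emb u) (emb v)

section
variable {m n : ℕ} {C : Finset (Sym2 (Fin m × Fin n))}

lemma InGrid.mem_iff (hC : InGrid C) {u v : Fin m × Fin n} (huv : Nbr (emb u) (emb v)) :
    s(u, v) ∈ C ↔ edg C ((emb u).1 + (emb v).1 + 1) ((emb u).2 + (emb v).2 + 1) := by
  constructor
  · exact fun h => ⟨u, v, h, rfl, rfl⟩
  · rintro ⟨u', v', h, h1, h2⟩
    rcases nbr_mid (hC _ _ h) huv (by omega) (by omega) with h3 | h3
    · rwa [← emb_injective h3.1, ← emb_injective h3.2]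
    · rw [Sym2.eq_swap]
      rwa [← emb_injective h3.1, ← emb_injective h3.2]

lemma InGrid.supp (hC : InGrid C) : Supp m n (edg C) := by
  rintro a b ⟨u, v, h, h1, h2⟩
  have := hC _ _ h
  have := u.1.2
  have := u.2.2
  have := v.1.2
  have := v.2.2
  simp only [Nbr, emb] at *
  omega

lemma InGrid.adj_iff (hC : InGrid C) (u v : Fin m × Fin n) :
    (gr (edg C)).Adj (emb u) (emb v) ↔ s(u, v) ∈ C := by
  rw [gr_adj]
  constructor
  · rintro ⟨h1, h2⟩
    exact (hC.mem_iff h1).2 h2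
  · intro h
    exact ⟨hC _ _ h, (hC.mem_iff (hC _ _ h)).1 h⟩

lemma IsCycle.inGrid (hC : IsCycle C) : InGrid C := by
  obtain ⟨u, p, hp, rfl⟩ := hC
  intro a b hab
  rw [List.mem_toFinset] at hab
  exact (grid_adj_iff _ _).1 (p.adj_of_mem_edges hab)

lemma IsCycle.deg_eq (hC : IsCycle C) (x y : ℤ) :
    deg (edg C) (2 * x + 1) (2 * y + 1) = 0 ∨ deg (edg C) (2 * x + 1) (2 * y + 1) = 2 := by
  have hG := hC.inGrid
  rw [← ncard_neighborSet_gr]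
  by_cases hne : ((gr (edg C)).neighborSet (x, y)).Nonempty
  · right
    obtain ⟨w, hw⟩ := hne
    obtain ⟨u, hu⟩ := hG.supp.mem_of_adj hw
    rw [← hu, ← image_neighborSet hG.supp, Set.ncard_image_of_injective _ emb_injective]
    obtain ⟨w, rfl⟩ := hG.supp.mem_of_adj hw.symm
    obtain ⟨z, p, hp, rfl⟩ := hC
    have hmem : s(u, w) ∈ p.edges.toFinset := (hG.adj_iff u w).1 (by rw [hu]; exact hw)
    have : (ggr m n (edg p.edges.toFinset)).neighborSet u = p.toSubgraph.neighborSet u := by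
      ext v
      change (gr _).Adj _ _ ↔ p.toSubgraph.Adj u v
      rw [hG.adj_iff, List.mem_toFinset, ← SimpleGraph.Walk.mem_edges_toSubgraph,
        SimpleGraph.Subgraph.mem_edgeSet]
    rw [this, hp.ncard_neighborSet_toSubgraph_eq_two]
    · rfl
    · rw [List.mem_toFinset] at hmem
      exact p.fst_mem_support_of_mem_edges hmem
  · left
    rw [Set.not_nonempty_iff_eq_empty] at hne
    simp [hne]

lemma InGrid.signature_eq (hC : InGrid C) (c : Cell m n) :
    (signature C c : ℤ) = deg (edg C) (2 * (c.1 : ℕ) + 2) (2 * (c.2 : ℕ) + 2) := by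
  classical
  have key : ∀ a b a' b' : Fin 2, Nbr (emb (c.vertex a b)) (emb (c.vertex a' b')) →
      ((if s(c.vertex a b, c.vertex a' b') ∈ C then 1 else 0 : ℕ) : ℤ) =
      ind (edg C (2 * (c.1 : ℕ) + (a : ℕ) + (a' : ℕ) + 1) (2 * (c.2 : ℕ) + (b : ℕ) + (b' : ℕ) + 1)) := by
    intro a b a' b' h
    trans ind (s(c.vertex a b, c.vertex a' b') ∈ C)
    · simp [ind]
    · rw [ind_congr (hC.mem_iff h)]
      simp only [emb, Cell.vertex]
      push_cast
      congr 2 <;> ring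
  unfold signature
  rw [Finset.inter_comm, ← Finset.filter_mem_eq_inter.trans (Finset.inter_comm _ _),
    Finset.card_filter]
  unfold Cell.edges
  have hinj : ∀ a b a' b' : Fin 2, c.vertex a b = c.vertex a' b' ↔ a = a' ∧ b = b' := by
    intro a b a' b'
    simp only [Cell.vertex, Prod.mk.injEq, Fin.ext_iff]
    omega
  rw [Finset.sum_insert, Finset.sum_insert, Finset.sum_insert, Finset.sum_singleton]
  · push_cast
    have h1 := key 0 0 1 0 (by simp [Nbr, emb, Cell.vertex])
    have h2 := key 0 1 1 1 (by simp [Nbr, emb, Cell.vertex])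
    have h3 := key 0 0 0 1 (by simp [Nbr, emb, Cell.vertex])
    have h4 := key 1 0 1 1 (by simp [Nbr, emb, Cell.vertex])
    push_cast at h1 h2 h3 h4
    rw [h1, h2, h3, h4]
    simp only [deg, around, Fin.val_zero, Fin.val_one, Nat.cast_zero, Nat.cast_one]
    ring_nf
  · simp [hinj]
  · simp [hinj]
  · simp [hinj]

end

/-! ### Differences and signatures in terms of midpoints. -/

/-- The number of midpoints in the grid at which two sets of edges differ. -/
noncomputable def dcard (m n : ℤ) (f : ℤ → ℤ → ℤ) : ℕ :=
  ((Finset.Ioo 0 (2 * m) ×ˢ Finset.Ioo 0 (2 * n)).filter (fun p => f p.1 p.2 ≠ 0)).card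

/-- The difference of two sets of edges. -/
noncomputable def dif (e₁ e₂ : ℤ → ℤ → Prop) (a b : ℤ) : ℤ := ind (e₁ a b) - ind (e₂ a b)

lemma dif_ne_zero {e₁ e₂ : ℤ → ℤ → Prop} {a b : ℤ} :
    dif e₁ e₂ a b ≠ 0 ↔ ¬(e₁ a b ↔ e₂ a b) := by
  unfold dif
  by_cases h : e₁ a b <;> by_cases h' : e₂ a b <;> simp [ind, h, h']

lemma card_symmDiff_eq {m n : ℕ} {C₁ C₂ : Finset (Sym2 (Fin m × Fin n))} (h₁ : InGrid C₁)
    (h₂ : InGrid C₂) : (symmDiff C₁ C₂).card = dcard m n (dif (edg C₁) (edg C₂)) := by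
  classical
  let mid : Sym2 (Fin m × Fin n) → ℤ × ℤ := Sym2.lift
    ⟨fun u v => ((emb u).1 + (emb v).1 + 1, (emb u).2 + (emb v).2 + 1), fun u v => by
      simp only [add_comm]⟩
  have hmid : ∀ u v, mid s(u, v) = ((emb u).1 + (emb v).1 + 1, (emb u).2 + (emb v).2 + 1) :=
    fun u v => rfl
  have hN : ∀ u v, s(u, v) ∈ symmDiff C₁ C₂ → Nbr (emb u) (emb v) := by
    intro u v h
    rw [Finset.mem_symmDiff] at h
    rcases h with h | h
    · exact h₁ _ _ h.1
    · exact h₂ _ _ h.1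
  have hbox : ∀ a b, edg C₁ a b ∨ edg C₂ a b →
      ((0 < a ∧ a < 2 * m) ∧ (0 < b ∧ b < 2 * n)) := by
    rintro a b (h | h)
    · have := h₁.supp a b h; omega
    · have := h₂.supp a b h; omega
  unfold dcard
  apply Finset.card_bij (fun s _ => mid s)
  · intro s
    induction s using Sym2.ind with
    | _ u v =>
    intro hs
    have hnb := hN u v hs
    rw [Finset.mem_symmDiff, h₁.mem_iff hnb, h₂.mem_iff hnb] at hs
    rw [hmid, Finset.mem_filter, Finset.mem_product, Finset.mem_Ioo, Finset.mem_Ioo, dif_ne_zero]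
    exact ⟨hbox _ _ (by tauto), by tauto⟩
  · intro s hs t ht
    induction s using Sym2.ind with
    | _ u v =>
    induction t using Sym2.ind with
    | _ u' v' =>
    intro h
    rw [hmid, hmid, Prod.mk.injEq] at h
    rcases nbr_mid (hN _ _ hs) (hN _ _ ht) (by omega) (by omega) with h3 | h3
    · rw [emb_injective h3.1, emb_injective h3.2]
    · rw [emb_injective h3.1, emb_injective h3.2, Sym2.eq_swap]
  · rintro ⟨a, b⟩ h
    rw [Finset.mem_filter, dif_ne_zero] at h
    replace h := h.2
    by_cases h1 : edg C₁ a b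
    · obtain ⟨u, v, huv, rfl, rfl⟩ := h1
      refine ⟨s(u, v), ?_, rfl⟩
      rw [Finset.mem_symmDiff, h₁.mem_iff (h₁ _ _ huv), h₂.mem_iff (h₁ _ _ huv)]
      have := (h₁.mem_iff (h₁ _ _ huv)).1 huv
      tauto
    · have h2 : edg C₂ a b := by tauto
      obtain ⟨u, v, huv, rfl, rfl⟩ := h2
      refine ⟨s(u, v), ?_, rfl⟩
      rw [Finset.mem_symmDiff, h₁.mem_iff (h₂ _ _ huv), h₂.mem_iff (h₂ _ _ huv)]
      have := (h₂.mem_iff (h₂ _ _ huv)).1 huv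
      tauto

lemma around_dif (e₁ e₂ : ℤ → ℤ → Prop) (a b : ℤ) :
    around (dif e₁ e₂) a b = deg e₁ a b - deg e₂ a b := by
  simp only [around, dif, deg]; ring

/-- Equality of signatures in terms of the difference of the two sets of edges. -/
lemma signature_eq_iff {m n : ℕ} {C₁ C₂ : Finset (Sym2 (Fin m × Fin n))} (h₁ : InGrid C₁)
    (h₂ : InGrid C₂) : signature C₁ = signature C₂ ↔
      ∀ x y : ℤ, 0 < x → x < m → 0 < y → y < n →
        around (dif (edg C₁) (edg C₂)) (2 * x) (2 * y) = 0 := by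
  constructor
  · intro h x y hx hxm hy hyn
    rw [around_dif, sub_eq_zero]
    let c : Cell m n := (⟨(x - 1).toNat, by omega⟩, ⟨(y - 1).toNat, by omega⟩)
    have := congrFun h c
    rw [← Nat.cast_inj (R := ℤ), h₁.signature_eq, h₂.signature_eq] at this
    have hx' : 2 * (((c.1 : ℕ) : ℤ)) + 2 = 2 * x := by simp only [c]; omega
    have hy' : 2 * (((c.2 : ℕ) : ℤ)) + 2 = 2 * y := by simp only [c]; omega
    rwa [hx', hy'] at this
  · intro h
    funext c
    rw [← Nat.cast_inj (R := ℤ), h₁.signature_eq, h₂.signature_eq]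
    have := h (((c.1 : ℕ) : ℤ) + 1) (((c.2 : ℕ) : ℤ) + 1) (by omega) (by omega) (by omega) (by omega)
    rw [around_dif, sub_eq_zero] at this
    rwa [show 2 * (((c.1 : ℕ) : ℤ)) + 2 = 2 * (((c.1 : ℕ) : ℤ) + 1) by ring,
      show 2 * (((c.2 : ℕ) : ℤ)) + 2 = 2 * (((c.2 : ℕ) : ℤ) + 1) by ring]

/-- Two loops with equal cell sums give two cycles of the grid with equal signatures. -/
lemma exists_cycles {m n : ℕ} {e₁ e₂ : ℤ → ℤ → Prop} (h₁ : IsLoop m n e₁) (h₂ : IsLoop m n e₂)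
    (h : ∀ x y : ℤ, 0 < x → x < m → 0 < y → y < n → around (dif e₁ e₂) (2 * x) (2 * y) = 0) :
    ∃ C₁ C₂ : Finset (Sym2 (Fin m × Fin n)), IsCycle C₁ ∧ IsCycle C₂ ∧
      signature C₁ = signature C₂ ∧ (symmDiff C₁ C₂).card = dcard m n (dif e₁ e₂) := by
  have key : ∀ e, IsLoop m n e → ∃ C : Finset (Sym2 (Fin m × Fin n)), IsCycle C ∧ edg C = e := by
    intro e he
    obtain ⟨C, hC, hmem⟩ := he.exists_isCycle
    refine ⟨C, hC, ?_⟩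
    funext a b
    apply propext
    constructor
    · rintro ⟨u, v, huv, rfl, rfl⟩
      exact ((hmem u v).1 huv).2
    · intro hab
      have hs := he.supp a b hab
      rcases Int.emod_two_eq_zero_or_one a with h0 | h0
      · obtain ⟨x, rfl⟩ : ∃ x, a = 2 * x + 2 := ⟨a / 2 - 1, by omega⟩
        obtain ⟨y, rfl⟩ : ∃ y, b = 2 * y + 1 := ⟨b / 2, by omega⟩
        have hadj := gr_right.2 hab
        obtain ⟨u, hu⟩ := he.supp.mem_of_adj hadj
        obtain ⟨v, hv⟩ := he.supp.mem_of_adj hadj.symm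
        rw [← hu, ← hv, ← hmem] at hadj
        refine ⟨u, v, hadj, ?_, ?_⟩ <;> rw [hu, hv] <;> ring
      · obtain ⟨x, rfl⟩ : ∃ x, a = 2 * x + 1 := ⟨a / 2, by omega⟩
        obtain ⟨y, rfl⟩ : ∃ y, b = 2 * y + 2 := ⟨b / 2 - 1, by omega⟩
        have hadj := gr_up.2 hab
        obtain ⟨u, hu⟩ := he.supp.mem_of_adj hadj
        obtain ⟨v, hv⟩ := he.supp.mem_of_adj hadj.symm
        rw [← hu, ← hv, ← hmem] at hadj
        refine ⟨u, v, hadj, ?_, ?_⟩ <;> rw [hu, hv] <;> ring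
  obtain ⟨C₁, hC₁, rfl⟩ := key e₁ h₁
  obtain ⟨C₂, hC₂, rfl⟩ := key e₂ h₂
  exact ⟨C₁, C₂, hC₁, hC₂, (signature_eq_iff hC₁.inGrid hC₂.inGrid).2 h,
    card_symmDiff_eq hC₁.inGrid hC₂.inGrid⟩

/-! ### Solutions of the discrete wave equation modulo two -/

lemma const_of_step {α : Type*} {h : ℤ → α} (hs : ∀ i, h (i + 1) = h i) (i j : ℤ) : h i = h j := by
  have key : ∀ i, h i = h 0 := by
    intro i
    induction i using Int.induction_on with
    | zero => rfl
    | succ i ih => rw [hs, ih]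
    | pred i ih => rw [← ih, ← hs (-(i : ℤ) - 1)]; congr 1; ring
  rw [key i, key j]

section Wave

variable {G : ℤ → ℤ → ZMod 2}

/-- The wave equation at the points with even coordinate sum. -/
def Wave (G : ℤ → ℤ → ZMod 2) : Prop :=
  ∀ a b, (a + b) % 2 = 0 → G (a + 1) b + G (a - 1) b + G a (b + 1) + G a (b - 1) = 0

/-- In the diagonal coordinates `i`, `j` the wave equation says that a mixed second difference
vanishes, so the solution is a function of `i` plus a function of `j`. Vanishing on the axis, that
is for `i = j`, makes these two functions agree. -/
lemma Wave.eq_add (hG : Wave G) (h0 : ∀ a, G a 0 = 0) (i j : ℤ) :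
    G (i + j + 1) (i - j) = G (i + 1) i + G (j + 1) j := by
  set K : ℤ → ℤ → ZMod 2 := fun i j => G (i + j + 1) (i - j) with hK
  have hsq : ∀ i j, K (i + 1) (j + 1) + K i j + K (i + 1) j + K i (j + 1) = 0 := by
    intro i j
    have := hG (i + j + 2) (i - j) (by omega)
    simp only [hK]
    rw [← this]
    congr 2
    · congr 2 <;> ring
    all_goals ring_nf
  have h1 : ∀ i j, K (i + 1) j + K i j = K (i + 1) 0 + K i 0 := by
    intro i j
    apply const_of_step (h := fun j => K (i + 1) j + K i j)
    intro j
    have := hsq i j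
    -- Signs do not matter in characteristic 2; the multiple of `2 = 0` accounts for them.
    linear_combination this - (K (i + 1) j + K i j) * (CharTwo.two_eq_zero (R := ZMod 2))
  have h2 : K i j + K i 0 = K 0 j + K 0 0 := by
    apply const_of_step (h := fun i => K i j + K i 0)
    intro i
    have := h1 i j
    linear_combination this + (K (i + 1) 0 - K i j) * (CharTwo.two_eq_zero (R := ZMod 2))
  have hd : ∀ i, K i i = 0 := by
    intro i
    simp only [hK, sub_self]
    exact h0 _
  have h3 : K j j + K j 0 = K 0 j + K 0 0 := by
    apply const_of_step (h := fun i => K i j + K i 0)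
    intro i
    have := h1 i j
    linear_combination this + (K (i + 1) 0 - K i j) * (CharTwo.two_eq_zero (R := ZMod 2))
  rw [hd] at h3
  have hA : ∀ i, G (i + 1) i = K i 0 := by intro i; simp [hK]
  rw [hA, hA]
  change K i j = _
  linear_combination h2 - h3 - (K i 0) * (CharTwo.two_eq_zero (R := ZMod 2))

end Wave

/-- The reflection of the integers into the interval from `0` to `M`. -/
def fold (M a : ℤ) : ℤ := |(a + M) % (2 * M) - M|

lemma fold_spec {M : ℤ} (hM : 0 < M) (a : ℤ) :
    (0 ≤ fold M a ∧ fold M a ≤ M) ∧ ∃ q : ℤ, a = fold M a + 2 * M * q ∨ a = - fold M a + 2 * M * q := by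
  have h1 := Int.emod_add_mul_ediv (a + M) (2 * M)
  have h2 := Int.emod_nonneg (a + M) (b := 2 * M) (by omega)
  have h3 := Int.emod_lt_of_pos (a + M) (b := 2 * M) (by omega)
  unfold fold
  rcases abs_cases ((a + M) % (2 * M) - M) with h | h
  · exact ⟨by omega, (a + M) / (2 * M), Or.inl (by linarith)⟩
  · exact ⟨by omega, (a + M) / (2 * M), Or.inr (by linarith)⟩

lemma fold_unique {M : ℤ} (hM : 0 < M) {a v q : ℤ} (hv : 0 ≤ v) (hv' : v ≤ M)
    (h : a = v + 2 * M * q ∨ a = -v + 2 * M * q) : fold M a = v := by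
  obtain ⟨⟨h1, h2⟩, q', h3⟩ := fold_spec hM a
  have key : ∀ u k : ℤ, 0 ≤ u → u ≤ M →
      (u - v = 2 * M * k ∨ u + v = 2 * M * k) → u = v := by
    intro u k hu hu' h
    -- As `u` and `v` lie between `0` and `M`, only `k = 0` and `k = 1` survive, the latter with `u
    -- = v = M`.
    have hk : k = 0 ∨ k = 1 ∨ k ≤ -1 ∨ 2 ≤ k := by omega
    rcases hk with rfl | rfl | hk | hk
    · omega
    · omega
    · have : M * k ≤ M * (-1) := mul_le_mul_of_nonneg_left hk hM.le
      rcases h with h | h <;> linarith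
    · have : M * 2 ≤ M * k := mul_le_mul_of_nonneg_left hk hM.le
      rcases h with h | h <;> linarith
  rcases h3 with h3 | h3 <;> rcases h with h | h
  · exact key _ (q - q') h1 h2 (Or.inl (by linarith))
  · exact key _ (q - q') h1 h2 (Or.inr (by linarith))
  · exact key _ (q' - q) h1 h2 (Or.inr (by linarith))
  · exact key _ (q' - q) h1 h2 (Or.inl (by linarith))

lemma fold_of_mem {M a : ℤ} (hM : 0 < M) (h : 0 ≤ a) (h' : a ≤ M) : fold M a = a :=
  fold_unique hM (q := 0) h h' (Or.inl (by ring))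

/-- Between the walls the folding is a local isometry, perhaps reversing direction; at a wall the
two neighbours are folded onto each other. -/
lemma fold_step {M : ℤ} (hM : 0 < M) (a : ℤ) :
    (0 < fold M a ∧ fold M a < M ∧
      ((fold M (a + 1) = fold M a + 1 ∧ fold M (a - 1) = fold M a - 1) ∨
      (fold M (a + 1) = fold M a - 1 ∧ fold M (a - 1) = fold M a + 1))) ∨
    ((fold M a = 0 ∨ fold M a = M) ∧ fold M (a + 1) = fold M (a - 1)) := by
  obtain ⟨⟨h1, h2⟩, q, h3⟩ := fold_spec hM a
  generalize fold M a = v at *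
  by_cases hv0 : v = 0
  · subst hv0
    right
    refine ⟨Or.inl rfl, ?_⟩
    rw [fold_unique hM (a := a + 1) (v := 1) (q := q) (by omega) (by omega) (Or.inl (by omega)),
      fold_unique hM (a := a - 1) (v := 1) (q := q) (by omega) (by omega) (Or.inr (by omega))]
  by_cases hvM : v = M
  · right
    refine ⟨Or.inr hvM, ?_⟩
    subst hvM
    rcases h3 with h3 | h3
    · rw [fold_unique hM (a := a + 1) (v := v - 1) (q := q + 1) (by omega) (by omega)
          (Or.inr (by linarith)),
        fold_unique hM (a := a - 1) (v := v - 1) (q := q) (by omega) (by omega)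
          (Or.inl (by linarith))]
    · rw [fold_unique hM (a := a + 1) (v := v - 1) (q := q) (by omega) (by omega)
          (Or.inr (by linarith)),
        fold_unique hM (a := a - 1) (v := v - 1) (q := q - 1) (by omega) (by omega)
          (Or.inl (by linarith))]
  · left
    refine ⟨by omega, by omega, ?_⟩
    rcases h3 with h3 | h3
    · left
      exact ⟨fold_unique hM (q := q) (by omega) (by omega) (Or.inl (by linarith)),
        fold_unique hM (q := q) (by omega) (by omega) (Or.inl (by linarith))⟩
    · right
      exact ⟨fold_unique hM (q := q) (by omega) (by omega) (Or.inr (by linarith)),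
        fold_unique hM (q := q) (by omega) (by omega) (Or.inr (by linarith))⟩

lemma fold_parity {m : ℤ} (hm : 0 < m) (a : ℤ) : fold (2 * m) a % 2 = a % 2 := by
  obtain ⟨-, q, h⟩ := fold_spec (M := 2 * m) (by omega) a
  have : 2 * (2 * m) * q = 2 * (2 * m * q) := by ring
  omega

/-! ### The profile of a difference. -/

/-- The properties of the difference of two cycles with equal signatures that are needed for the
upper bound: it takes the values `-1`, `0`, `1`, is even around the vertices and vanishes around
the cells. -/
structure IsDif (m n : ℤ) (f : ℤ → ℤ → ℤ) : Prop where
  values : ∀ a b, f a b = 0 ∨ f a b = 1 ∨ f a b = -1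
  supp : ∀ a b, f a b ≠ 0 → 0 < a ∧ a < 2 * m ∧ 0 < b ∧ b < 2 * n ∧ (a + b) % 2 = 1
  vertex : ∀ x y, around f (2 * x + 1) (2 * y + 1) % 2 = 0
  cell : ∀ x y, 0 < x → x < m → 0 < y → y < n → around f (2 * x) (2 * y) = 0

/-- A symmetric function which describes the support of a difference. -/
structure Profile (m n : ℤ) (f : ℤ → ℤ → ℤ) (A : ℤ → ℤ) : Prop where
  values : ∀ i, A i = 0 ∨ A i = 1
  neg : ∀ i, A (-1 - i) = A i
  refl₁ : ∀ i, A (2 * m - 1 - i) = A i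
  refl₂ : ∀ i, A (2 * n - 1 - i) = A i
  ne_iff : ∀ i j, 0 ≤ i + j + 1 → i + j + 1 ≤ 2 * m → 0 ≤ i - j → i - j ≤ 2 * n →
    (f (i + j + 1) (i - j) ≠ 0 ↔ A i ≠ A j)
  diag : ∀ i, 0 ≤ i → i + 1 ≤ 2 * m → i ≤ 2 * n → (f (i + 1) i ≠ 0 ↔ A i = 1)
  vanish : ∀ q, 0 ≤ q → q ≤ m → (∀ b, f (2 * q) b = 0) → ∀ i, A (2 * q - 1 - i) = A i

section
variable {m n : ℤ} {f : ℤ → ℤ → ℤ}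

lemma IsDif.cast_ne (hf : IsDif m n f) (a b : ℤ) : (f a b : ZMod 2) ≠ 0 ↔ f a b ≠ 0 := by
  rcases hf.values a b with h | h | h <;> simp [h]

/-- Inside, the equation is the vertex or the cell condition modulo 2. On a wall the two neighbours
across it coincide, hence cancel modulo 2, and the two along it lie outside the support. -/
lemma IsDif.wave (hf : IsDif m n f) (hm : 0 < m) (hn : 0 < n) :
    Wave (fun a b => (f (fold (2 * m) a) (fold (2 * n) b) : ZMod 2)) := by
  intro a b hab
  have hz : ∀ c d, c = 0 ∨ c = 2 * m ∨ d = 0 ∨ d = 2 * n → f c d = 0 := by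
    intro c d h
    by_contra hne
    have := hf.supp c d hne
    omega
  have htwo : ∀ x : ZMod 2, x + x = 0 := CharTwo.add_self_eq_zero
  have pa := fold_parity hm a
  have pb := fold_parity hn b
  have ha := fold_step (M := 2 * m) (by omega) a
  have hb := fold_step (M := 2 * n) (by omega) b
  simp only
  generalize fold (2 * m) a = α at *
  generalize fold (2 * n) b = β at *
  rcases ha with ⟨ha1, ha2, ha3⟩ | ⟨ha1, ha2⟩
  · rcases hb with ⟨hb1, hb2, hb3⟩ | ⟨hb1, hb2⟩
    · have hsum : ((around f α β : ℤ) : ZMod 2) = 0 := by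
        rcases Int.emod_two_eq_zero_or_one α with h0 | h0
        · obtain ⟨x, rfl⟩ : ∃ x, α = 2 * x := ⟨α / 2, by omega⟩
          obtain ⟨y, rfl⟩ : ∃ y, β = 2 * y := ⟨β / 2, by omega⟩
          rw [hf.cell x y (by omega) (by omega) (by omega) (by omega)]
          rfl
        · obtain ⟨x, rfl⟩ : ∃ x, α = 2 * x + 1 := ⟨α / 2, by omega⟩
          obtain ⟨y, rfl⟩ : ∃ y, β = 2 * y + 1 := ⟨β / 2, by omega⟩
          rw [ZMod.intCast_zmod_eq_zero_iff_dvd]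
          exact Int.dvd_of_emod_eq_zero (hf.vertex x y)
      unfold around at hsum
      push_cast at hsum
      rcases ha3 with ⟨h1, h2⟩ | ⟨h1, h2⟩ <;> rcases hb3 with ⟨h3, h4⟩ | ⟨h3, h4⟩ <;>
        rw [h1, h2, h3, h4] <;> linear_combination hsum
    · rw [hb2, add_assoc, htwo, add_zero, hz _ β (by omega), hz _ β (by omega)]
      simp
  · rw [ha2, htwo, zero_add, hz α _ (by omega), hz α _ (by omega)]
    simp

/-- The profile is `A i = G (i + 1) i`. A zero of `G` at `(i + j + 1, i - j)` forces `A i = A j`, so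
every grid line on which `f` vanishes becomes a symmetry of `A`. -/
lemma IsDif.exists_profile (hf : IsDif m n f) (hm : 0 < m) (hn : 0 < n) :
    ∃ A, Profile m n f A := by
  set G : ℤ → ℤ → ZMod 2 := fun a b => (f (fold (2 * m) a) (fold (2 * n) b) : ZMod 2) with hG
  have hw : Wave G := hf.wave hm hn
  have hz : ∀ c d, c = 0 ∨ c = 2 * m ∨ d = 0 ∨ d = 2 * n → f c d = 0 := by
    intro c d h
    by_contra hne
    have := hf.supp c d hne
    omega
  have fm0 : fold (2 * m) 0 = 0 := fold_of_mem (by omega) (by omega) (by omega)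
  have fn0 : fold (2 * n) 0 = 0 := fold_of_mem (by omega) (by omega) (by omega)
  have fm1 : fold (2 * m) (2 * m) = 2 * m := fold_of_mem (by omega) (by omega) (by omega)
  have fn1 : fold (2 * n) (2 * n) = 2 * n := fold_of_mem (by omega) (by omega) (by omega)
  have hadd := hw.eq_add (fun a => by simp only [hG, fn0]; rw [hz _ 0 (by simp)]; rfl)
  have hadd0 : ∀ i j, G (i + j + 1) (i - j) = 0 → G (i + 1) i = G (j + 1) j := by
    intro i j h
    rw [hadd] at h
    linear_combination h - (G (j + 1) j) * (CharTwo.two_eq_zero (R := ZMod 2))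
  have hval : ∀ x : ZMod 2, x.val = 0 ∨ x.val = 1 := by decide
  have hvanish : ∀ q, 0 ≤ q → q ≤ m → (∀ b, f (2 * q) b = 0) →
      ∀ i, G (2 * q - 1 - i + 1) (2 * q - 1 - i) = G (i + 1) i := by
    intro q hq hq' h i
    apply hadd0
    have : fold (2 * m) (2 * q - 1 - i + i + 1) = 2 * q := by
      rw [show 2 * q - 1 - i + i + 1 = 2 * q by ring]
      exact fold_of_mem (by omega) (by omega) (by omega)
    simp only [hG, this, h]
    rfl
  refine ⟨fun i => (G (i + 1) i).val, ⟨?_, ?_, ?_, ?_, ?_, ?_, ?_⟩⟩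
  · intro i
    have := hval (G (i + 1) i)
    omega
  · intro i
    have := hvanish 0 le_rfl hm.le (fun b => hz _ _ (by simp)) i
    rw [← this]
    ring_nf
  · intro i
    have := hvanish m hm.le le_rfl (fun b => hz _ _ (by simp)) i
    rw [← this]
  · intro i
    -- Vanishing on the row `2 * n` gives a translation of `A`; composed with the symmetry `i ↦ -1 -
    -- i` it becomes the second reflection.
    rw [hadd0 (2 * n - 1 - i) (-1 - i)]
    · have := hvanish 0 le_rfl hm.le (fun b => hz _ _ (by simp)) i
      rw [← this]
      ring_nf
    · simp only [hG]
      rw [show 2 * n - 1 - i - (-1 - i) = 2 * n by ring, fn1, hz _ _ (by simp)]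
      rfl
  · intro i j h1 h2 h3 h4
    have := hadd i j
    simp only [hG] at this
    rw [fold_of_mem (by omega) h1 h2, fold_of_mem (by omega) h3 h4] at this
    rw [← hf.cast_ne, this]
    change G (i + 1) i + G (j + 1) j ≠ 0 ↔ _
    generalize G (i + 1) i = u
    generalize G (j + 1) j = v
    revert u v
    decide
  · intro i h1 h2 h3
    rw [← hf.cast_ne]
    simp only [hG]
    rw [fold_of_mem (a := i + 1) (by omega) (by omega) h2, fold_of_mem (a := i) (by omega) h1 h3]
    generalize (f (i + 1) i : ZMod 2) = u
    revert u
    decide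
  · intro q h1 h2 h i
    rw [hvanish q h1 h2 h i]

end

/-! ### Counting the support of a difference -/

section

open Finset

lemma sum_range_shift {h : ℤ → ℤ} {T : ℕ} (hT : ∀ i, h (i + T) = h i) (c : ℤ) :
    ∑ i ∈ range T, h (i + c) = ∑ i ∈ range T, h i := by
  have key : ∀ c : ℤ, ∑ i ∈ range T, h (i + (c + 1)) = ∑ i ∈ range T, h (i + c) := by
    intro c
    have h1 := Finset.sum_range_succ (fun i : ℕ => h (i + c)) T
    have h2 := Finset.sum_range_succ' (fun i : ℕ => h (i + c)) T
    have h3 : h ((T : ℤ) + c) = h (((0 : ℕ) : ℤ) + c) := by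
      rw [← hT (((0 : ℕ) : ℤ) + c)]; congr 1; push_cast; ring
    have h4 : ∑ i ∈ range T, h (((i + 1 : ℕ) : ℤ) + c) = ∑ i ∈ range T, h (i + (c + 1)) := by
      apply sum_congr rfl; intro i _; congr 1; push_cast; ring
    linarith
  have := const_of_step (h := fun c : ℤ => ∑ i ∈ range T, h (i + c)) key c 0
  simpa using this

lemma sum_range_mul {h : ℤ → ℤ} {T : ℕ} (hT : ∀ i, h (i + T) = h i) (k : ℕ) :
    ∑ i ∈ range (k * T), h i = k * ∑ i ∈ range T, h i := by
  induction k with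
  | zero => simp
  | succ k ih =>
    rw [Nat.succ_mul, Finset.sum_range_add, ih]
    have : ∑ i ∈ range T, h ((k * T + i : ℕ) : ℤ) = ∑ i ∈ range T, h i := by
      rw [← sum_range_shift hT ((k * T : ℕ) : ℤ)]
      apply sum_congr rfl; intro i _; congr 1; push_cast; ring
    rw [this]; push_cast; ring

/-- The index `i` is paired with `2 * L - i`; the fixed points `0` and `L` contribute nothing. -/
lemma sum_range_two_mul_of_symm {h : ℤ → ℤ} {L : ℕ} (hs : ∀ i, h (-i) = h i)
    (hT : ∀ i, h (i + 2 * L) = h i) (h0 : h 0 = 0) (hL : h L = 0) :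
    ∑ i ∈ range (2 * L), h i = 2 * ∑ i ∈ range L, h i := by
  rw [two_mul L, Finset.sum_range_add, ← Finset.sum_range_reflect (fun i => h ((L + i : ℕ) : ℤ))]
  have : ∑ i ∈ range L, h ((L + (L - 1 - i) : ℕ) : ℤ) = ∑ i ∈ range L, h ((i + 1 : ℕ) : ℤ) := by
    apply sum_congr rfl
    intro i hi
    rw [mem_range] at hi
    rw [← hs, ← hT]
    congr 1
    omega
  rw [this]
  have h1 := Finset.sum_range_succ (fun i : ℕ => h i) L
  have h2 := Finset.sum_range_succ' (fun i : ℕ => h i) L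
  simp only [Nat.cast_zero] at h2
  linarith

lemma sum_range_two_mul_parity (h : ℤ → ℤ) (L : ℕ) :
    ∑ i ∈ range (2 * L), h i = ∑ j ∈ range L, (h (2 * j) + h (2 * j + 1)) := by
  induction L with
  | zero => simp
  | succ L ih =>
    rw [show 2 * (L + 1) = 2 * L + 1 + 1 by ring, Finset.sum_range_succ, Finset.sum_range_succ,
      ih, Finset.sum_range_succ]
    push_cast
    ring

lemma sum_range_eq_sum_Ioo {h : ℤ → ℤ} (M : ℕ) {M' : ℤ} (h0 : h 0 = 0) (hM : (M : ℤ) = M') :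
    ∑ a ∈ range M, h a = ∑ a ∈ Ioo 0 M', h a := by
  subst hM
  have : ∑ a ∈ range M, h a = ∑ a ∈ Ico (0 : ℤ) M, h a := by
    refine sum_nbij (fun a : ℕ => (a : ℤ)) ?_ ?_ ?_ (fun _ _ => rfl)
    · intro a ha; rw [mem_range] at ha; rw [mem_Ico]; omega
    · intro a _ b _ hab; exact Nat.cast_injective hab
    · intro a ha
      rw [coe_Ico, Set.mem_Ico] at ha
      exact ⟨a.toNat, by rw [coe_range, Set.mem_Iio]; omega, by simp [ha.1]⟩
  rw [this]
  symm
  apply sum_subset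
  · intro a ha; rw [mem_Ioo] at ha; rw [mem_Ico]; omega
  · intro a ha ha'
    rw [mem_Ico] at ha
    rw [mem_Ioo] at ha'
    rw [show a = 0 by omega, h0]

/-- The number of odd points at which a profile differs. -/
lemma dcard_eq {m n q m' n' : ℕ} {f : ℤ → ℤ → ℤ} {A : ℤ → ℤ} (hf : IsDif m n f)
    (hA : Profile m n f A) (hq : ∀ i, A (2 * q - 1 - i) = A i) (hm : m = q * m') (hn : n = q * n') :
    (dcard m n f : ℤ) =
      4 * (∑ i ∈ range q, A i) * (q - ∑ i ∈ range q, A i) * m' * n' := by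
  have per : ∀ L : ℤ, (∀ i, A (2 * L - 1 - i) = A i) → ∀ i, A (i + 2 * L) = A i := by
    intro L hL i
    have := hL (-1 - i)
    rw [hA.neg] at this
    rw [← this]
    congr 1
    ring
  -- The polynomial form of the indicator of `A i ≠ A j` can be summed term by term.
  set B : ℤ → ℤ → ℤ := fun i j => A i + A j - 2 * A i * A j with hB
  have hBs : ∀ i j, B i j = B j i := fun i j => by simp only [hB]; ring
  -- `F` continues the indicator of the support from the grid to the whole plane.
  set F : ℤ → ℤ → ℤ := fun a b => if (a + b) % 2 = 1 then B ((a + b - 1) / 2) ((a - b - 1) / 2) else 0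
    with hF
  have hFodd : ∀ i j : ℤ, F (i + j + 1) (i - j) = B i j := by
    intro i j
    simp only [hF]
    rw [if_pos (by omega), show (i + j + 1 + (i - j) - 1) / 2 = i by omega,
      show (i + j + 1 - (i - j) - 1) / 2 = j by omega]
  have hFeven : ∀ a b : ℤ, (a + b) % 2 ≠ 1 → F a b = 0 := fun a b h => if_neg h
  have hcases : ∀ a b : ℤ, (a + b) % 2 ≠ 1 ∨ ∃ i j : ℤ, a = i + j + 1 ∧ b = i - j := by
    intro a b
    by_cases h : (a + b) % 2 = 1
    · exact Or.inr ⟨(a + b - 1) / 2, (a - b - 1) / 2, by omega, by omega⟩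
    · exact Or.inl h
  have hB01 : ∀ i j, (A i ≠ A j → B i j = 1) ∧ (A i = A j → B i j = 0) := by
    intro i j
    simp only [hB]
    rcases hA.values i with h | h <;> rcases hA.values j with h' | h' <;> simp [h, h']
  have hcount : (dcard m n f : ℤ) = ∑ a ∈ range (2 * m), ∑ b ∈ range (2 * n), F a b := by
    have hdiff : ∀ a b : ℤ, 0 ≤ a → a ≤ 2 * m → 0 ≤ b → b ≤ 2 * n →
        (if f a b ≠ 0 then (1 : ℤ) else 0) = F a b := by
      intro a b h1 h2 h3 h4
      rcases hcases a b with h | ⟨i, j, rfl, rfl⟩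
      · rw [hFeven _ _ h, if_neg]
        intro hne
        exact h (hf.supp _ _ hne).2.2.2.2
      · rw [hFodd]
        have := hA.ne_iff i j h1 h2 h3 h4
        split_ifs with h
        · exact ((hB01 i j).1 (this.1 h)).symm
        · exact ((hB01 i j).2 (by by_contra hne; exact h (this.2 hne))).symm
    unfold dcard
    rw [Finset.card_filter, Finset.sum_product]
    push_cast
    have hz : ∀ c d, c = 0 ∨ d = 0 → f c d = 0 := by
      intro c d h
      by_contra hne
      have := hf.supp c d hne
      omega
    rw [← sum_range_eq_sum_Ioo (h := fun a => ∑ b ∈ Ioo 0 (2 * (n : ℤ)), if f a b ≠ 0 then 1 else 0)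
      (2 * m) (by simp [hz]) (by push_cast; ring)]
    apply sum_congr rfl
    intro a ha
    rw [← sum_range_eq_sum_Ioo (h := fun b => if f a b ≠ 0 then 1 else 0)
      (2 * n) (by simp [hz]) (by push_cast; ring)]
    apply sum_congr rfl
    intro b hb
    rw [mem_range] at ha hb
    exact hdiff _ _ (by omega) (by omega) (by omega) (by omega)
  have hFa : ∀ a b, F (-a) b = F a b := by
    intro a b
    rcases hcases a b with h | ⟨i, j, rfl, rfl⟩
    · rw [hFeven _ _ h, hFeven _ _ (by omega)]
    · rw [hFodd, show -(i + j + 1) = (-1 - j) + (-1 - i) + 1 by ring,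
        show i - j = (-1 - j) - (-1 - i) by ring, hFodd, hBs]
      simp only [hB, hA.neg]
  have hFb : ∀ a b, F a (-b) = F a b := by
    intro a b
    rcases hcases a b with h | ⟨i, j, rfl, rfl⟩
    · rw [hFeven _ _ h, hFeven _ _ (by omega)]
    · rw [hFodd, show -(i - j) = j - i by ring, show i + j + 1 = j + i + 1 by ring, hFodd, hBs]
  have hFma : ∀ a b, F (a + 2 * (2 * m : ℕ)) b = F a b := by
    intro a b
    rcases hcases a b with h | ⟨i, j, rfl, rfl⟩
    · rw [hFeven _ _ h, hFeven _ _ (by omega)]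
    · rw [hFodd, show i + j + 1 + 2 * ((2 * m : ℕ) : ℤ) = (i + 2 * m) + (j + 2 * m) + 1 by
        push_cast; ring, show i - j = (i + 2 * m) - (j + 2 * m) by ring, hFodd]
      simp only [hB, per m hA.refl₁]
  have hFnb : ∀ a b, F a (b + 2 * (2 * n : ℕ)) = F a b := by
    intro a b
    rcases hcases a b with h | ⟨i, j, rfl, rfl⟩
    · rw [hFeven _ _ h, hFeven _ _ (by omega)]
    · rw [hFodd, show i - j + 2 * ((2 * n : ℕ) : ℤ) = (i + 2 * n) - (j - 2 * n) by
        push_cast; ring, show i + j + 1 = (i + 2 * n) + (j - 2 * n) + 1 by ring, hFodd]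
      have := per n hA.refl₂ (j - 2 * n)
      rw [sub_add_cancel] at this
      simp only [hB, per n hA.refl₂, this]
  have hF0a : ∀ b, F 0 b = 0 := by
    intro b
    rcases hcases 0 b with h | ⟨i, j, h, rfl⟩
    · exact hFeven _ _ h
    · have := hFodd i j
      rw [← h] at this
      rw [this, (hB01 i j).2]
      rw [← hA.neg]; congr 1; omega
  have hFMa : ∀ b, F (2 * m : ℕ) b = 0 := by
    intro b
    rcases hcases (2 * m : ℕ) b with h | ⟨i, j, h, rfl⟩
    · exact hFeven _ _ h
    · rw [h, hFodd, (hB01 i j).2]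
      rw [← hA.refl₁]; congr 1; push_cast at h; omega
  have hF0b : ∀ a, F a 0 = 0 := by
    intro a
    rcases hcases a 0 with h | ⟨i, j, rfl, h⟩
    · exact hFeven _ _ h
    · have := hFodd i j
      rw [← h] at this
      rw [this, (hB01 i j).2]
      congr 1; omega
  have hFNb : ∀ a, F a (2 * n : ℕ) = 0 := by
    intro a
    rcases hcases a (2 * n : ℕ) with h | ⟨i, j, rfl, h⟩
    · exact hFeven _ _ h
    · rw [h, hFodd, (hB01 i j).2]
      rw [← per n hA.refl₂ j]; congr 1; push_cast at h; omega
  -- The torus with sides `4 * m` and `4 * n` is made of four mirror images of the grid, and `F`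
  -- vanishes on the walls between them.
  have htorus : 4 * (dcard m n f : ℤ) =
      ∑ b ∈ range (2 * (2 * n)), ∑ a ∈ range (2 * (2 * m)), F a b := by
    rw [sum_range_two_mul_of_symm (h := fun b => ∑ a ∈ range (2 * (2 * m)), F a b)
      (fun b => sum_congr rfl fun a _ => hFb a b) (fun b => sum_congr rfl fun a _ => hFnb a b)
      (sum_eq_zero fun a _ => hF0b a) (sum_eq_zero fun a _ => hFNb a)]
    have : ∀ b : ℤ, ∑ a ∈ range (2 * (2 * m)), F a b = 2 * ∑ a ∈ range (2 * m), F a b := fun b =>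
      sum_range_two_mul_of_symm (h := fun a => F a b) (fun a => hFa a b) (fun a => hFma a b)
        (hF0a b) (hFMa b)
    simp only [this]
    rw [hcount, Finset.sum_comm, ← Finset.mul_sum]
    ring
  -- Shifting row `b` by `b` sends the points `2 * j + 1` of that row to the index pairs `(j + b,
  -- j)`; the other parity contributes zero. The two diagonal indices can then be summed
  -- independently over full periods.
  have hshear : ∀ b : ℤ, ∑ a ∈ range (2 * (2 * m)), F a b = ∑ j ∈ range (2 * m), B (j + b) j := by
    intro b
    rw [← sum_range_shift (h := fun a => F a b) (fun a => by
      have := hFma a b; push_cast at this ⊢; exact this) b,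
      sum_range_two_mul_parity (fun a => F (a + b) b)]
    apply sum_congr rfl
    intro j _
    rw [hFeven _ _ (by omega), zero_add]
    have := hFodd (j + b) j
    rw [← this]
    congr 1 <;> ring
  have hperq := per q hq
  have hBp : ∀ i j, B (i + (2 * q : ℕ)) j = B i j := by
    intro i j; simp only [hB]; push_cast; rw [hperq]
  have hBp' : ∀ i j, B i (j + (2 * q : ℕ)) = B i j := by
    intro i j; rw [hBs, hBp, hBs]
  have hK : ∑ i ∈ range (2 * q), A i = 2 * ∑ i ∈ range q, A i := by
    rw [two_mul q, Finset.sum_range_add, ← Finset.sum_range_reflect (fun i => A ((q + i : ℕ) : ℤ)),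
      two_mul]
    congr 1
    apply sum_congr rfl
    intro i hi
    rw [mem_range] at hi
    rw [← hq]; congr 1; omega
  have hfin : ∑ b ∈ range (2 * (2 * n)), ∑ a ∈ range (2 * (2 * m)), F a b =
      (2 * n') * (m' * ∑ j ∈ range (2 * q), ∑ i ∈ range (2 * q), B i j) := by
    simp only [hshear]
    rw [Finset.sum_comm]
    have h1 : ∀ j : ℤ, ∑ b ∈ range (2 * (2 * n)), B (j + b) j =
        2 * n' * ∑ i ∈ range (2 * q), B i j := by
      intro j
      have h2 := sum_range_mul (h := fun i => B i j) (fun i => hBp i j) (2 * n')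
      rw [show 2 * n' * (2 * q) = 2 * (2 * n) by rw [hn]; ring] at h2
      push_cast at h2
      rw [← h2, ← sum_range_shift (h := fun i => B i j) _ j]
      · apply sum_congr rfl; intro b _; rw [add_comm]
      · intro i
        rw [show i + ((2 * (2 * n) : ℕ) : ℤ) = (i + 2 * n) + 2 * n by push_cast; ring]
        simp only [hB, per n hA.refl₂]
    simp only [h1]
    have h3 := sum_range_mul (T := 2 * q) (h := fun j => 2 * n' * ∑ i ∈ range (2 * q), B i j)
      (fun j => by
        have : ∀ i, B i (j + ((2 * q : ℕ) : ℤ)) = B i j := fun i => hBp' i j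
        simp only [this]) m'
    rw [show m' * (2 * q) = 2 * m by rw [hm]; ring] at h3
    rw [h3, ← Finset.mul_sum]
    ring
  -- A period of length `2 * q` contains twice as many ones as the first half; the sum counts
  -- ordered pairs of unequal values.
  have hsum : ∑ j ∈ range (2 * q), ∑ i ∈ range (2 * q), B i j =
      8 * (∑ i ∈ range q, A i) * (q - ∑ i ∈ range q, A i) := by
    simp only [hB, Finset.sum_add_distrib, Finset.sum_sub_distrib, ← Finset.mul_sum,
      ← Finset.sum_mul, hK, Finset.sum_const, Finset.card_range, nsmul_eq_mul]
    push_cast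
    ring
  rw [hfin, hsum] at htorus
  linarith

end

/-! ### Even sets of edges as boundaries -/

/-- A set of edges of the grid with an even number of edges at each vertex. -/
structure EvenSet (m n : ℤ) (e : ℤ → ℤ → Prop) : Prop where
  supp : Supp m n e
  even : ∀ x y, deg e (2 * x + 1) (2 * y + 1) % 2 = 0

/-- `-1` on the edges of the set and `1` elsewhere. -/
noncomputable def sgn (e : ℤ → ℤ → Prop) (a b : ℤ) : ℤ := 1 - 2 * ind (e a b)

lemma sgn_mul_self (e : ℤ → ℤ → Prop) (a b : ℤ) : sgn e a b * sgn e a b = 1 := by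
  rcases ind_eq (e a b) with h | h <;> simp [sgn, h.2]

lemma Supp.sgn_eq_one {m n : ℤ} {e : ℤ → ℤ → Prop} (h : Supp m n e) {a b : ℤ}
    (hab : a ≤ 0 ∨ 2 * m ≤ a ∨ b ≤ 0 ∨ 2 * n ≤ b) : sgn e a b = 1 := by
  have : ¬ e a b := fun h' => by have := h a b h'; omega
  simp [sgn, ind_false this]

lemma EvenSet.sgn_vertex {m n : ℤ} {e : ℤ → ℤ → Prop} (h : EvenSet m n e) (x y : ℤ) :
    sgn e (2 * x + 2) (2 * y + 1) * sgn e (2 * x) (2 * y + 1) * sgn e (2 * x + 1) (2 * y + 2) *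
      sgn e (2 * x + 1) (2 * y) = 1 := by
  have := h.even x y
  simp only [deg, around] at this
  rw [show 2 * x + 1 + 1 = 2 * x + 2 by ring, show 2 * y + 1 + 1 = 2 * y + 2 by ring,
    show 2 * x + 1 - 1 = 2 * x by ring, show 2 * y + 1 - 1 = 2 * y by ring] at this
  simp only [sgn]
  rcases ind_eq (e (2 * x + 2) (2 * y + 1)) with h1 | h1 <;>
  rcases ind_eq (e (2 * x) (2 * y + 1)) with h2 | h2 <;>
  rcases ind_eq (e (2 * x + 1) (2 * y + 2)) with h3 | h3 <;>
  rcases ind_eq (e (2 * x + 1) (2 * y)) with h4 | h4 <;>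
  rw [h1.2, h2.2, h3.2, h4.2] at this ⊢ <;> omega

/-- The sign of a cell: `1` outside of the region bounded by the set, and `-1` inside. -/
noncomputable def spin (e : ℤ → ℤ → Prop) (x y : ℤ) : ℤ :=
  ∏ j ∈ Finset.range y.toNat, sgn e (2 * x) (2 * j + 1)

lemma spin_mul_self (e : ℤ → ℤ → Prop) (x y : ℤ) : spin e x y * spin e x y = 1 := by
  rw [spin, ← Finset.prod_mul_distrib]
  exact Finset.prod_eq_one fun j _ => sgn_mul_self _ _ _

lemma spin_succ (e : ℤ → ℤ → Prop) (x : ℤ) {y : ℤ} (hy : 0 ≤ y) :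
    spin e x (y + 1) = spin e x y * sgn e (2 * x) (2 * y + 1) := by
  rw [spin, show (y + 1).toNat = y.toNat + 1 by omega, Finset.prod_range_succ, spin]
  congr 3
  omega

lemma spin_up (e : ℤ → ℤ → Prop) (x : ℤ) {y : ℤ} (hy : 0 ≤ y) :
    spin e x y * spin e x (y + 1) = sgn e (2 * x) (2 * y + 1) := by
  rw [spin_succ e x hy, ← mul_assoc, spin_mul_self, one_mul]

section
variable {m n : ℤ} {e : ℤ → ℤ → Prop}

/-- The two vertical rays that define these spins enclose a column of vertices. Multiplying the
parity relations at these vertices cancels everything but the edges crossed by the rays and the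
vertical edge at the top. -/
lemma EvenSet.spin_right (h : EvenSet m n e) (x : ℤ) {y : ℤ} (hy : 0 ≤ y) :
    spin e x y * spin e (x + 1) y = sgn e (2 * x + 1) (2 * y) := by
  obtain ⟨k, rfl⟩ := Int.eq_ofNat_of_zero_le hy
  induction k with
  | zero => rw [h.supp.sgn_eq_one (by simp)]; simp [spin]
  | succ k ih =>
    have ih := ih (by omega)
    have hv := h.sgn_vertex x k
    push_cast
    rw [spin_succ _ _ (by omega), spin_succ _ _ (by omega)]
    rw [show 2 * (x + 1) = 2 * x + 2 by ring, show 2 * ((k : ℤ) + 1) = 2 * k + 2 by ring]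
    have h1 := sgn_mul_self e (2 * x + 1) (2 * k + 2)
    linear_combination (sgn e (2 * x) (2 * k + 1) * sgn e (2 * x + 2) (2 * k + 1)) * ih +
      (sgn e (2 * x + 1) (2 * k + 2)) * hv - (sgn e (2 * x + 2) (2 * k + 1) *
        sgn e (2 * x) (2 * k + 1) * sgn e (2 * x + 1) (2 * k)) * h1

/-- To the left and right of the grid the ray meets no edge. Above it, a sideways move crosses no
edge, so the spin equals that of a column outside. -/
lemma EvenSet.spin_outside (h : EvenSet m n e) {x y : ℤ}
    (hxy : x ≤ 0 ∨ m ≤ x ∨ y ≤ 0 ∨ n ≤ y) : spin e x y = 1 := by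
  have hx : ∀ x y, x ≤ 0 ∨ m ≤ x → spin e x y = 1 := by
    intro x y hx
    exact Finset.prod_eq_one fun j _ => h.supp.sgn_eq_one (by omega)
  by_cases hy : y ≤ 0
  · rw [spin, show y.toNat = 0 by omega]; rfl
  by_cases hx' : x ≤ 0 ∨ m ≤ x
  · exact hx x y hx'
  have hc : ∀ i : ℤ, spin e (i + 1) y = spin e i y := by
    intro i
    have h1 := h.spin_right i (y := y) (by omega)
    rw [h.supp.sgn_eq_one (by omega)] at h1
    have h2 := spin_mul_self e i y
    linear_combination (spin e i y) * h1 - (spin e (i + 1) y) * h2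
  rw [const_of_step (h := fun i => spin e i y) hc x 0]
  exact hx 0 y (by simp)

end

/-! ### Auxiliary signs -/

/-- The parity sign. -/
def par (u : ℤ) : ℤ := if u % 2 = 0 then 1 else -1

/-- The sign with period `1, 1, -1, -1`. -/
def sg (u : ℤ) : ℤ := if u % 4 < 2 then 1 else -1

lemma par_add (u v : ℤ) : par (u + v) = par u * par v := by
  unfold par
  split_ifs <;> omega

lemma par_mul_self (u : ℤ) : par u * par u = 1 := by
  unfold par; split_ifs <;> norm_num

lemma par_of_even {u : ℤ} (h : u % 2 = 0) : par u = 1 := if_pos h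

lemma par_of_odd {u : ℤ} (h : u % 2 = 1) : par u = -1 := if_neg (by omega)

lemma par_sub (u v : ℤ) : par (u - v) = par u * par v := by
  unfold par
  split_ifs <;> omega

lemma sg_mul_self (u : ℤ) : sg u * sg u = 1 := by
  unfold sg; split_ifs <;> norm_num

lemma sg_add_two_mul (u k : ℤ) : sg (u + 2 * k) = par k * sg u := by
  unfold sg par
  split_ifs <;> omega

lemma sg_neg_mul (u : ℤ) : sg (-u) * sg u = par u := by
  unfold sg par
  split_ifs <;> omega

/-- For `i ≥ 0` the value `P i` sums `A` over `0, ..., i - 1`. Truncation by `toNat` empties the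
first sum for negative `i` and the second for positive `i`. -/
lemma exists_primitive (A : ℤ → ℤ) : ∃ P : ℤ → ℤ, P 0 = 0 ∧ ∀ i, P (i + 1) = P i + A i := by
  refine ⟨fun i => ∑ j ∈ Finset.range i.toNat, A j - ∑ j ∈ Finset.range (-i).toNat, A (-1 - j),
    by simp, fun i => ?_⟩
  rcases lt_or_ge i 0 with hi | hi
  · obtain ⟨k, rfl⟩ : ∃ k : ℕ, i = -1 - k := ⟨(-1 - i).toNat, by omega⟩
    simp only
    rw [show (-1 - (k : ℤ) + 1).toNat = 0 by omega, show (-1 - (k : ℤ)).toNat = 0 by omega,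
      show (-(-1 - (k : ℤ) + 1)).toNat = k by omega, show (-(-1 - (k : ℤ))).toNat = k + 1 by omega,
      Finset.sum_range_succ]
    ring
  · obtain ⟨k, rfl⟩ := Int.eq_ofNat_of_zero_le hi
    simp only
    rw [show ((k : ℤ) + 1).toNat = k + 1 by omega, show ((k : ℤ)).toNat = k by omega,
      show (-((k : ℤ) + 1)).toNat = 0 by omega, show (-(k : ℤ)).toNat = 0 by omega,
      Finset.sum_range_succ]
    simp

section
variable {A P : ℤ → ℤ} (hP0 : P 0 = 0) (hP : ∀ i, P (i + 1) = P i + A i)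
include hP

/-- A primitive of a sequence symmetric about `L - 1/2` is centrally symmetric about `L`. -/
lemma primitive_reflect {L : ℤ} (hL : ∀ i, A (2 * L - 1 - i) = A i) (y : ℤ) :
    P (L + y) + P (L - y) = 2 * P L := by
  have := const_of_step (h := fun y => P (L + y) + P (L - y)) (fun y => by
    have h1 := hP (L + y)
    have h2 := hP (L - (y + 1))
    have h3 := hL (L + y)
    rw [show L - (y + 1) + 1 = L - y by ring] at h2
    rw [show 2 * L - 1 - (L + y) = L - (y + 1) by ring] at h3
    rw [← add_assoc]
    linarith) y 0
  simp only [add_zero, sub_zero] at this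
  linarith

include hP0

lemma primitive_neg (hneg : ∀ i, A (-1 - i) = A i) (y : ℤ) : P (-y) = - P y := by
  have := primitive_reflect hP (L := 0) (fun i => by simpa using hneg i) y
  simp only [zero_add, zero_sub, hP0] at this
  linarith

/-- The central symmetries about `0` and `L` compose to a translation by `2 * L`, which adds `2 * P
L`; hence the induction in steps of two. -/
lemma primitive_mul (hneg : ∀ i, A (-1 - i) = A i) {L : ℤ} (hL : ∀ i, A (2 * L - 1 - i) = A i)
    (j : ℕ) : P (j * L) = j * P L := by
  induction j using Nat.twoStepInduction with
  | zero => simp [hP0]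
  | one => simp
  | more j ih1 _ =>
    have h1 := primitive_reflect hP hL ((j + 1) * L)
    rw [show L - (j + 1) * L = -(j * L) by ring, primitive_neg hP0 hP hneg, ih1] at h1
    push_cast
    rw [show ((j : ℤ) + 2) * L = L + (j + 1) * L by ring]
    linarith

end

/-! ### A weight on the cells whose sum across the edges of the difference vanishes. -/

/-- A solution of the signed equation. -/
def wgt (P : ℤ → ℤ) (x y : ℤ) : ℤ :=
  sg (P (x + y) + P (x - y) - (x - y)) * sg (x + y - P (x + y) + P (x - y))

section
variable {A P : ℤ → ℤ} (hA : ∀ i, A i = 0 ∨ A i = 1) (hP : ∀ i, P (i + 1) = P i + A i)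
include hA hP

/-- Across an edge of the difference the weight is multiplied by a difference of two profile values,
and by its negative in `wgt_up`; on other edges the square makes the identity trivial. The four
signed factors around a cell cancel in pairs. -/
lemma wgt_right (x y : ℤ) :
    wgt P (x + 1) y * (A (x + y) - A (x - y)) ^ 2 = wgt P x y * (A (x + y) - A (x - y)) := by
  unfold wgt
  rw [show x + 1 + y = x + y + 1 by ring, show x + 1 - y = x - y + 1 by ring, hP, hP]
  rcases hA (x + y) with h | h <;> rcases hA (x - y) with h' | h' <;> rw [h, h']
  · ring
  · rw [show P (x + y) + 0 + (P (x - y) + 1) - (x - y + 1) = P (x + y) + P (x - y) - (x - y) by ring,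
      show x + y + 1 - (P (x + y) + 0) + (P (x - y) + 1) =
        x + y - P (x + y) + P (x - y) + 2 * 1 by ring, sg_add_two_mul, par_of_odd (by norm_num)]
    ring
  · rw [show P (x + y) + 1 + (P (x - y) + 0) - (x - y + 1) = P (x + y) + P (x - y) - (x - y) by ring,
      show x + y + 1 - (P (x + y) + 1) + (P (x - y) + 0) =
        x + y - P (x + y) + P (x - y) by ring]
    ring
  · ring

lemma wgt_up (x y : ℤ) :
    wgt P x (y + 1) * (A (x + y) - A (x - y - 1)) ^ 2 =
      - wgt P x y * (A (x + y) - A (x - y - 1)) := by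
  have h1 := hP (x - y - 1)
  rw [sub_add_cancel] at h1
  have h1 : P (x - y - 1) = P (x - y) - A (x - y - 1) := by linarith
  unfold wgt
  rw [show x + (y + 1) = x + y + 1 by ring, show x - (y + 1) = x - y - 1 by ring, hP, h1]
  rcases hA (x + y) with h | h <;> rcases hA (x - y - 1) with h' | h' <;> rw [h, h']
  · ring
  · rw [show P (x + y) + 0 + (P (x - y) - 1) - (x - y - 1) = P (x + y) + P (x - y) - (x - y) by ring,
      show x + y + 1 - (P (x + y) + 0) + (P (x - y) - 1) =
        x + y - P (x + y) + P (x - y) by ring]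
    ring
  · rw [show P (x + y) + 1 + (P (x - y) - 0) - (x - y - 1) =
        P (x + y) + P (x - y) - (x - y) + 2 * 1 by ring,
      show x + y + 1 - (P (x + y) + 1) + (P (x - y) - 0) =
        x + y - P (x + y) + P (x - y) by ring, sg_add_two_mul, par_of_odd (by norm_num)]
    ring
  · ring

lemma wgt_right' (x y : ℤ) :
    wgt P x y * (A (x + y) - A (x - y)) ^ 2 = wgt P (x + 1) y * (A (x + y) - A (x - y)) := by
  have h := wgt_right hA hP x y
  rcases hA (x + y) with h1 | h1 <;> rcases hA (x - y) with h2 | h2 <;> rw [h1, h2] at h ⊢ <;>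
    linarith

lemma wgt_up' (x y : ℤ) :
    wgt P x y * (A (x + y) - A (x - y - 1)) ^ 2 =
      - wgt P x (y + 1) * (A (x + y) - A (x - y - 1)) := by
  have h := wgt_up hA hP x y
  rcases hA (x + y) with h1 | h1 <;> rcases hA (x - y - 1) with h2 | h2 <;> rw [h1, h2] at h ⊢ <;>
    linarith

end

/-! ### The boundary flux -/

/-- A discrete Green identity. -/
lemma green {m n : ℕ} {S W : ℤ → ℤ → ℤ}
    (h : ∀ x y : ℤ, 0 < x → x < m + 1 → 0 < y → y < n + 1 →
      W x y * around S x y = S x y * around W x y) :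
    ∑ y ∈ Finset.range n, ((W m (y + 1) * S (m + 1) (y + 1) - S m (y + 1) * W (m + 1) (y + 1)) -
        (W 0 (y + 1) * S 1 (y + 1) - S 0 (y + 1) * W 1 (y + 1))) +
      ∑ x ∈ Finset.range m, ((W (x + 1) n * S (x + 1) (n + 1) - S (x + 1) n * W (x + 1) (n + 1)) -
        (W (x + 1) 0 * S (x + 1) 1 - S (x + 1) 0 * W (x + 1) 1)) = 0 := by
  have h1 : ∀ y : ℕ, (W m (y + 1) * S (m + 1) (y + 1) - S m (y + 1) * W (m + 1) (y + 1)) -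
        (W 0 (y + 1) * S 1 (y + 1) - S 0 (y + 1) * W 1 (y + 1)) =
      ∑ x ∈ Finset.range m, ((W (x + 1 : ℕ) (y + 1) * S ((x + 1 : ℕ) + 1) (y + 1) -
        S (x + 1 : ℕ) (y + 1) * W ((x + 1 : ℕ) + 1) (y + 1)) -
        (W x (y + 1) * S (x + 1) (y + 1) - S x (y + 1) * W (x + 1) (y + 1))) := by
    intro y
    rw [Finset.sum_range_sub (fun x : ℕ => W x (y + 1) * S (x + 1) (y + 1) -
      S x (y + 1) * W (x + 1) (y + 1))]
    simp
  have h2 : ∀ x : ℕ, (W (x + 1) n * S (x + 1) (n + 1) - S (x + 1) n * W (x + 1) (n + 1)) -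
        (W (x + 1) 0 * S (x + 1) 1 - S (x + 1) 0 * W (x + 1) 1) =
      ∑ y ∈ Finset.range n, ((W (x + 1) (y + 1 : ℕ) * S (x + 1) ((y + 1 : ℕ) + 1) -
        S (x + 1) (y + 1 : ℕ) * W (x + 1) ((y + 1 : ℕ) + 1)) -
        (W (x + 1) y * S (x + 1) (y + 1) - S (x + 1) y * W (x + 1) (y + 1))) := by
    intro x
    rw [Finset.sum_range_sub (fun y : ℕ => W (x + 1) y * S (x + 1) (y + 1) -
      S (x + 1) y * W (x + 1) (y + 1))]
    simp
  simp only [h1, h2]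
  rw [Finset.sum_comm, ← Finset.sum_add_distrib]
  apply Finset.sum_eq_zero
  intro x hx
  rw [← Finset.sum_add_distrib]
  apply Finset.sum_eq_zero
  intro y hy
  rw [Finset.mem_range] at hx hy
  have := h (x + 1) (y + 1) (by omega) (by omega) (by omega) (by omega)
  simp only [around, add_sub_cancel_right] at this
  push_cast
  linarith

/-- The sign `par (P i)` changes exactly when `A i = 1`, so `par (P i) * (1 - A i)` is unchanged if
`P i` is replaced by `P (i + 1)`, and the sum telescopes. -/
lemma sum_par_primitive {A P : ℤ → ℤ} (hA : ∀ i, A i = 0 ∨ A i = 1)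
    (hP : ∀ i, P (i + 1) = P i + A i) (c : ℤ) (k : ℕ) :
    ∑ i ∈ Finset.range k, par (P (c + i + 1)) * (A (c + i + 1) - A (c + i)) =
      par (P c) * (1 - A c) - par (P (c + k)) * (1 - A (c + k)) := by
  induction k with
  | zero => simp
  | succ k ih =>
    rw [Finset.sum_range_succ, ih]
    push_cast
    rw [← add_assoc]
    rcases hA (c + k) with h | h
    · rw [hP, h, add_zero]; ring
    · rw [h]; ring

/-- Here the sign of `P i + i` changes exactly when `A i = 0`, so the product with `A i` telescopes.
-/
lemma sum_par_primitive_add {A P : ℤ → ℤ} (hA : ∀ i, A i = 0 ∨ A i = 1)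
    (hP : ∀ i, P (i + 1) = P i + A i) (c : ℤ) (k : ℕ) :
    ∑ i ∈ Finset.range k, par (P (c + i + 1) + (c + i + 1)) * (A (c + i) - A (c + i + 1)) =
      par (P c + c) * A c - par (P (c + k) + (c + k)) * A (c + k) := by
  induction k with
  | zero => simp
  | succ k ih =>
    rw [Finset.sum_range_succ, ih]
    push_cast
    rw [← add_assoc c]
    rcases hA (c + k) with h | h
    · rw [h]; ring
    · rw [hP, h, show P (c + k) + 1 + (c + k + 1) = P (c + k) + (c + k) + 2 by ring, par_add _ 2,
        par_of_even (u := 2) (by norm_num)]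
      ring

section
variable {A P : ℤ → ℤ} (hP0 : P 0 = 0) (hP : ∀ i, P (i + 1) = P i + A i)
  (hneg : ∀ i, A (-1 - i) = A i)
include hP0 hP hneg

/-- Along a side the two arguments of `sg` are related by the symmetry of `P` (trivially so at the
bottom), and the two signs of period four merge into one parity sign. This makes the flux summable
on all four sides. -/
lemma wgt_left_side (y : ℤ) : wgt P 0 y = par (P y) := by
  unfold wgt
  rw [zero_add, zero_sub, primitive_neg hP0 hP hneg,
    show P y + -P y - -y = y by ring, show y - P y + -P y = y + 2 * -P y by ring, sg_add_two_mul,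
    mul_left_comm, sg_mul_self, mul_one]
  unfold par; split_ifs <;> omega

omit hP0 hP hneg in
lemma wgt_bottom_side (x : ℤ) : wgt P x 0 = par (P x + x) := by
  unfold wgt
  rw [add_zero, sub_zero, show P x + P x - x = -x + 2 * P x by ring, sg_add_two_mul, sub_add_cancel,
    mul_assoc, sg_neg_mul, par_add]

omit hP0 hneg in
lemma wgt_right_side {m : ℤ} (hm : ∀ i, A (2 * m - 1 - i) = A i) (y : ℤ) :
    wgt P m y = par (P (m + y)) * par m := by
  have h := primitive_reflect hP hm y
  unfold wgt
  rw [show P (m + y) + P (m - y) - (m - y) = (y - m) + 2 * P m by linarith,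
    show m + y - P (m + y) + P (m - y) = (y - m) + 2 * (m + P m - P (m + y)) by linarith,
    sg_add_two_mul, sg_add_two_mul, par_sub, par_add]
  linear_combination (par (P (m + y)) * par m * sg (y - m) * sg (y - m)) * par_mul_self (P m) +
    (par (P (m + y)) * par m) * sg_mul_self (y - m)

lemma wgt_top_side {n : ℤ} (hn : ∀ i, A (2 * n - 1 - i) = A i) (x : ℤ) :
    wgt P x n = par (P (n + x)) * par x := by
  have h := primitive_reflect hP hn x
  have h2 := primitive_neg hP0 hP hneg (x - n)
  rw [neg_sub] at h2
  unfold wgt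
  rw [add_comm x n]
  rw [show P (n + x) + P (x - n) - (x - n) = (-(x - n)) + 2 * (P (n + x) - P n) by linarith,
    show n + x - P (n + x) + P (x - n) = (x - n) + 2 * (n - P n) by linarith,
    sg_add_two_mul, sg_add_two_mul, par_sub, par_sub]
  have h3 := sg_neg_mul (x - n)
  rw [par_sub] at h3
  linear_combination (par (P (n + x)) * par n * sg (-(x - n)) * sg (x - n)) * par_mul_self (P n) +
    (par (P (n + x)) * par n) * h3 + (par (P (n + x)) * par x) * par_mul_self n

end

/-! ### Spins and weights of two sets with equal cell sums. -/

section
variable {m n : ℤ} {e₁ e₂ : ℤ → ℤ → Prop}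

lemma EvenSet.isDif (h₁ : EvenSet m n e₁) (h₂ : EvenSet m n e₂)
    (hc : ∀ x y, 0 < x → x < m → 0 < y → y < n → around (dif e₁ e₂) (2 * x) (2 * y) = 0) :
    IsDif m n (dif e₁ e₂) where
  values a b := by
    unfold dif
    rcases ind_eq (e₁ a b) with h | h <;> rcases ind_eq (e₂ a b) with h' | h' <;>
      rw [h.2, h'.2] <;> norm_num
  supp a b h := by
    rw [dif_ne_zero] at h
    by_cases h' : e₁ a b
    · exact h₁.supp a b h'
    · exact h₂.supp a b (by tauto)
  vertex x y := by
    have h1 := h₁.even x y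
    have h2 := h₂.even x y
    rw [around_dif]
    omega
  cell := hc

lemma two_mul_dif (a b : ℤ) : 2 * dif e₁ e₂ a b = sgn e₂ a b - sgn e₁ a b := by
  unfold dif sgn; ring

lemma one_sub_sgn (a b : ℤ) : (dif e₁ e₂ a b ≠ 0 → 1 - sgn e₁ a b * sgn e₂ a b = 2) ∧
    (dif e₁ e₂ a b = 0 → 1 - sgn e₁ a b * sgn e₂ a b = 0) := by
  unfold dif sgn
  rcases ind_eq (e₁ a b) with h | h <;> rcases ind_eq (e₂ a b) with h' | h' <;>
      rw [h.2, h'.2] <;> norm_num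

/-- The spin of the first set on the cells at which the two spins agree. -/
noncomputable def plus (e₁ e₂ : ℤ → ℤ → Prop) (x y : ℤ) : ℤ :=
  spin e₁ x y + spin e₂ x y

/-- The weight on the cells at which the two spins disagree. -/
noncomputable def minus (P : ℤ → ℤ) (e₁ e₂ : ℤ → ℤ → Prop) (x y : ℤ) : ℤ :=
  wgt P x y * (1 - spin e₁ x y * spin e₂ x y)

lemma spin_mul_cases (x y : ℤ) : spin e₁ x y * spin e₂ x y = 1 ∨ spin e₁ x y * spin e₂ x y = -1 := by
  have h1 := spin_mul_self e₁ x y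
  have h2 := spin_mul_self e₂ x y
  have : (spin e₁ x y * spin e₂ x y) * (spin e₁ x y * spin e₂ x y) = 1 := by
    linear_combination (spin e₂ x y * spin e₂ x y) * h1 + h2
  exact mul_self_eq_one_iff.1 this

/-- The product of the two spins changes across an edge exactly when the edge belongs to one set
only, which the profile detects. -/
lemma Profile.one_sub_spin_right {A : ℤ → ℤ} (h₁ : EvenSet m n e₁) (h₂ : EvenSet m n e₂)
    (hA : Profile m n (dif e₁ e₂) A) {x y : ℤ} (hx : 0 ≤ x) (hx' : x < m) (hy : 0 ≤ y)
    (hy' : y ≤ n) :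
    1 - (spin e₁ x y * spin e₂ x y) * (spin e₁ (x + 1) y * spin e₂ (x + 1) y) =
      2 * (A (x + y) - A (x - y)) ^ 2 := by
  have h := hA.ne_iff (x + y) (x - y) (by omega) (by omega) (by omega) (by omega)
  rw [show x + y + (x - y) + 1 = 2 * x + 1 by ring, show x + y - (x - y) = 2 * y by ring] at h
  have h1 := one_sub_sgn (e₁ := e₁) (e₂ := e₂) (2 * x + 1) (2 * y)
  rw [← h₁.spin_right x hy, ← h₂.spin_right x hy] at h1
  rcases hA.values (x + y) with ha | ha <;> rcases hA.values (x - y) with hb | hb <;>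
    rw [ha, hb] at h ⊢ <;>
    [have := h1.2 (by simpa using h); have := h1.1 (by simpa using h);
      have := h1.1 (by simpa using h); have := h1.2 (by simpa using h)] <;>
    linarith

lemma Profile.one_sub_spin_up {A : ℤ → ℤ} (hA : Profile m n (dif e₁ e₂) A) {x y : ℤ} (hx : 0 ≤ x)
    (hx' : x ≤ m) (hy : 0 ≤ y) (hy' : y < n) :
    1 - (spin e₁ x y * spin e₂ x y) * (spin e₁ x (y + 1) * spin e₂ x (y + 1)) =
      2 * (A (x + y) - A (x - y - 1)) ^ 2 := by
  have h := hA.ne_iff (x + y) (x - y - 1) (by omega) (by omega) (by omega) (by omega)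
  rw [show x + y + (x - y - 1) + 1 = 2 * x by ring,
    show x + y - (x - y - 1) = 2 * y + 1 by ring] at h
  have h1 := one_sub_sgn (e₁ := e₁) (e₂ := e₂) (2 * x) (2 * y + 1)
  rw [← spin_up e₁ x hy, ← spin_up e₂ x hy] at h1
  rcases hA.values (x + y) with ha | ha <;> rcases hA.values (x - y - 1) with hb | hb <;>
    rw [ha, hb] at h ⊢ <;>
    [have := h1.2 (by simpa using h); have := h1.1 (by simpa using h);
      have := h1.1 (by simpa using h); have := h1.2 (by simpa using h)] <;>
    linarith

/-- The weights and the spins satisfy the same linear equations at the cells. -/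
lemma Profile.plus_minus {A P : ℤ → ℤ} (h₁ : EvenSet m n e₁) (h₂ : EvenSet m n e₂)
    (hc : ∀ x y, 0 < x → x < m → 0 < y → y < n → around (dif e₁ e₂) (2 * x) (2 * y) = 0)
    (hA : Profile m n (dif e₁ e₂) A) (hP : ∀ i, P (i + 1) = P i + A i) {x y : ℤ}
    (hx : 0 < x) (hx' : x < m) (hy : 0 < y) (hy' : y < n) :
    minus P e₁ e₂ x y * around (plus e₁ e₂) x y = plus e₁ e₂ x y * around (minus P e₁ e₂) x y := by
  -- Equal cell sums mean that the spin of the centre times the sum of the neighbouring spins is the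
  -- same for both sets.
  have hs : around (fun x y => spin e₂ x y) x y = (spin e₁ x y * spin e₂ x y) *
      around (fun x y => spin e₁ x y) x y := by
    have h := hc x y hx hx' hy hy'
    have r1 := h₁.spin_right x hy.le
    have r2 := h₂.spin_right x hy.le
    have l1 := h₁.spin_right (x - 1) hy.le
    have l2 := h₂.spin_right (x - 1) hy.le
    have u1 := spin_up e₁ x hy.le
    have u2 := spin_up e₂ x hy.le
    have d1 := spin_up e₁ x (y := y - 1) (by omega)
    have d2 := spin_up e₂ x (y := y - 1) (by omega)
    rw [sub_add_cancel, show 2 * (x - 1) + 1 = 2 * x - 1 by ring] at l1 l2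
    rw [sub_add_cancel, show 2 * (y - 1) + 1 = 2 * y - 1 by ring] at d1 d2
    have e1 := two_mul_dif (e₁ := e₁) (e₂ := e₂) (2 * x + 1) (2 * y)
    have e2 := two_mul_dif (e₁ := e₁) (e₂ := e₂) (2 * x - 1) (2 * y)
    have e3 := two_mul_dif (e₁ := e₁) (e₂ := e₂) (2 * x) (2 * y + 1)
    have e4 := two_mul_dif (e₁ := e₁) (e₂ := e₂) (2 * x) (2 * y - 1)
    have s1 := spin_mul_self e₁ x y
    have s2 := spin_mul_self e₂ x y
    unfold around at h ⊢
    have key : spin e₂ x y * (spin e₂ (x + 1) y + spin e₂ (x - 1) y + spin e₂ x (y + 1) +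
        spin e₂ x (y - 1)) = spin e₁ x y * (spin e₁ (x + 1) y + spin e₁ (x - 1) y +
        spin e₁ x (y + 1) + spin e₁ x (y - 1)) := by linarith
    linear_combination (spin e₂ x y) * key - (spin e₂ (x + 1) y + spin e₂ (x - 1) y +
      spin e₂ x (y + 1) + spin e₂ x (y - 1)) * s2
  -- The weights of the neighbours across edges of the difference sum to zero, by the cancellation
  -- of the four factors from `wgt_right` and `wgt_up`.
  have hw : around (wgt P) x y = (spin e₁ x y * spin e₂ x y) *
      around (fun x y => wgt P x y * (spin e₁ x y * spin e₂ x y)) x y := by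
    have r := hA.one_sub_spin_right h₁ h₂ hx.le hx' hy.le hy'.le
    have l := hA.one_sub_spin_right h₁ h₂ (x := x - 1) (by omega) (by omega) hy.le hy'.le
    have u := hA.one_sub_spin_up hx.le hx'.le hy.le hy'
    have d := hA.one_sub_spin_up (y := y - 1) hx.le hx'.le (by omega) (by omega)
    have wr := wgt_right hA.values hP x y
    have wl := wgt_right' hA.values hP (x - 1) y
    have wu := wgt_up hA.values hP x y
    have wd := wgt_up' hA.values hP x (y - 1)
    rw [sub_add_cancel] at l d wl wd
    rw [show x - (y - 1) - 1 = x - y by ring] at d wd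
    rw [show x + (y - 1) = x + y - 1 by ring] at d wd
    rw [show x - 1 + y = x + y - 1 by ring, show x - 1 - y = x - y - 1 by ring] at l wl
    unfold around
    linear_combination (wgt P (x + 1) y) * r + (wgt P (x - 1) y) * l + (wgt P x (y + 1)) * u +
      (wgt P x (y - 1)) * d + 2 * wr + 2 * wl + 2 * wu + 2 * wd
  have s1 := spin_mul_self e₁ x y
  have hp : around (plus e₁ e₂) x y = (1 + spin e₁ x y * spin e₂ x y) *
      around (fun x y => spin e₁ x y) x y := by
    have : around (plus e₁ e₂) x y = around (fun x y => spin e₁ x y) x y +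
      around (fun x y => spin e₂ x y) x y := by simp only [around, plus]; ring
    rw [this, hs]; ring
  have hm : around (minus P e₁ e₂) x y = (spin e₁ x y * spin e₂ x y - 1) *
      around (fun x y => wgt P x y * (spin e₁ x y * spin e₂ x y)) x y := by
    have : around (minus P e₁ e₂) x y = around (wgt P) x y -
      around (fun x y => wgt P x y * (spin e₁ x y * spin e₂ x y)) x y := by
        simp only [around, minus]; ring
    rw [this, hw]; ring
  have hpl : plus e₁ e₂ x y = spin e₁ x y * (1 + spin e₁ x y * spin e₂ x y) := by
    unfold plus; linear_combination (- spin e₂ x y) * s1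
  -- Both sides vanish: `minus` and its neighbour sum are zero where the spins agree, `plus` and its
  -- neighbour sum where they disagree.
  rw [hp, hm, hpl, minus]
  rcases spin_mul_cases (e₁ := e₁) (e₂ := e₂) x y with h | h <;> rw [h] <;> ring

end

section
variable {m n : ℤ} {e₁ e₂ : ℤ → ℤ → Prop} {A P : ℤ → ℤ}

lemma plus_minus_outside (h₁ : EvenSet m n e₁) (h₂ : EvenSet m n e₂) {x y : ℤ}
    (hxy : x ≤ 0 ∨ m ≤ x ∨ y ≤ 0 ∨ n ≤ y) : plus e₁ e₂ x y = 2 ∧ minus P e₁ e₂ x y = 0 := by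
  rw [plus, minus, h₁.spin_outside hxy, h₂.spin_outside hxy]
  norm_num

/-- The flux through the boundary of the grid vanishes. -/
lemma Profile.boundary {m n : ℕ} (h₁ : EvenSet (m + 1 : ℕ) (n + 1 : ℕ) e₁)
    (h₂ : EvenSet (m + 1 : ℕ) (n + 1 : ℕ) e₂)
    (hc : ∀ x y : ℤ, 0 < x → x < (m + 1 : ℕ) → 0 < y → y < (n + 1 : ℕ) →
      around (dif e₁ e₂) (2 * x) (2 * y) = 0)
    (hA : Profile (m + 1 : ℕ) (n + 1 : ℕ) (dif e₁ e₂) A) (hP : ∀ i, P (i + 1) = P i + A i) :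
    ∑ y ∈ Finset.range n, (wgt P (m + 1) (y + 1) * (A (m + (y + 1)) - A (m - (y + 1))) +
        wgt P 0 (y + 1) * (A (y + 1) - A (-(y + 1)))) -
      ∑ x ∈ Finset.range m, (wgt P (x + 1) (n + 1) * (A (x + 1 + n) - A (x + 1 - n - 1)) +
        wgt P (x + 1) 0 * (A (x + 1) - A x)) = 0 := by
  have hg := green (m := m) (n := n) (S := plus e₁ e₂) (W := minus P e₁ e₂)
    (fun x y hx hx' hy hy' => hA.plus_minus h₁ h₂ hc hP hx (by push_cast; exact hx') hy
      (by push_cast; exact hy'))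
  have hpm : ∀ x y : ℤ, x ≤ 0 ∨ m + 1 ≤ x ∨ y ≤ 0 ∨ n + 1 ≤ y →
      plus e₁ e₂ x y = 2 ∧ minus P e₁ e₂ x y = 0 :=
    fun x y h => plus_minus_outside h₁ h₂ (by push_cast; exact h)
  -- Outside the grid `plus` is 2 and `minus` is 0, so only the values of `minus` on the outermost
  -- cells enter. The weight is transported across the boundary edge where needed, so that it is
  -- evaluated on the wall.
  have hv : ∑ y ∈ Finset.range n, ((minus P e₁ e₂ m (y + 1) * plus e₁ e₂ (m + 1) (y + 1) -
        plus e₁ e₂ m (y + 1) * minus P e₁ e₂ (m + 1) (y + 1)) -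
        (minus P e₁ e₂ 0 (y + 1) * plus e₁ e₂ 1 (y + 1) -
          plus e₁ e₂ 0 (y + 1) * minus P e₁ e₂ 1 (y + 1))) =
      4 * ∑ y ∈ Finset.range n, (wgt P (m + 1) (y + 1) * (A (m + (y + 1)) - A (m - (y + 1))) +
        wgt P 0 (y + 1) * (A (y + 1) - A (-(y + 1)))) := by
    rw [Finset.mul_sum]
    apply Finset.sum_congr rfl
    intro y hy
    rw [Finset.mem_range] at hy
    obtain ⟨p1, q1⟩ := hpm (m + 1) (y + 1) (by omega)
    obtain ⟨p0, q0⟩ := hpm 0 (y + 1) (by omega)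
    have o1 := h₁.spin_outside (x := m + 1) (y := y + 1) (by push_cast; omega)
    have o2 := h₂.spin_outside (x := m + 1) (y := y + 1) (by push_cast; omega)
    have o3 := h₁.spin_outside (x := 0) (y := y + 1) (by omega)
    have o4 := h₂.spin_outside (x := 0) (y := y + 1) (by omega)
    have r := hA.one_sub_spin_right h₁ h₂ (x := m) (y := y + 1) (by omega) (by push_cast; omega)
      (by omega) (by push_cast; omega)
    have l := hA.one_sub_spin_right h₁ h₂ (x := 0) (y := y + 1) (by omega) (by push_cast; omega)
      (by omega) (by push_cast; omega)
    have wr := wgt_right' hA.values hP m (y + 1)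
    have wl := wgt_right hA.values hP 0 (y + 1)
    rw [o1, o2] at r
    rw [o3, o4] at l
    simp only [zero_add, zero_sub] at l wl
    rw [p1, q1, p0, q0]
    unfold minus
    linear_combination (2 * wgt P m (y + 1)) * r + (2 * wgt P 1 (y + 1)) * l + 4 * wr + 4 * wl
  have hh : ∑ x ∈ Finset.range m, ((minus P e₁ e₂ (x + 1) n * plus e₁ e₂ (x + 1) (n + 1) -
        plus e₁ e₂ (x + 1) n * minus P e₁ e₂ (x + 1) (n + 1)) -
        (minus P e₁ e₂ (x + 1) 0 * plus e₁ e₂ (x + 1) 1 -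
          plus e₁ e₂ (x + 1) 0 * minus P e₁ e₂ (x + 1) 1)) =
      -4 * ∑ x ∈ Finset.range m, (wgt P (x + 1) (n + 1) * (A (x + 1 + n) - A (x + 1 - n - 1)) +
        wgt P (x + 1) 0 * (A (x + 1) - A x)) := by
    rw [Finset.mul_sum]
    apply Finset.sum_congr rfl
    intro x hx
    rw [Finset.mem_range] at hx
    obtain ⟨p1, q1⟩ := hpm (x + 1) (n + 1) (by omega)
    obtain ⟨p0, q0⟩ := hpm (x + 1) 0 (by omega)
    have o1 := h₁.spin_outside (x := x + 1) (y := n + 1) (by push_cast; omega)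
    have o2 := h₂.spin_outside (x := x + 1) (y := n + 1) (by push_cast; omega)
    have o3 := h₁.spin_outside (x := x + 1) (y := 0) (by omega)
    have o4 := h₂.spin_outside (x := x + 1) (y := 0) (by omega)
    have r := hA.one_sub_spin_up (x := x + 1) (y := n) (by omega) (by push_cast; omega)
      (by omega) (by push_cast; omega)
    have l := hA.one_sub_spin_up (x := x + 1) (y := 0) (by omega) (by push_cast; omega)
      (by omega) (by push_cast; omega)
    have wr := wgt_up' hA.values hP (x + 1) n
    have wl := wgt_up hA.values hP (x + 1) 0
    rw [o1, o2] at r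
    rw [o3, o4] at l
    simp only [zero_add, sub_zero, add_zero, add_sub_cancel_right] at l wl
    rw [p1, q1, p0, q0]
    unfold minus
    linear_combination (2 * wgt P (x + 1) n) * r + (2 * wgt P (x + 1) 1) * l + 4 * wr + 4 * wl
  rw [hv, hh] at hg
  linarith

/-- The flux along each side telescopes to its two ends. The parity conditions give every end term
the same sign, except that the two terms at the origin add up to `(1 - A 0) + A 0 = 1`. The total is
positive, yet it must be zero. -/
lemma Profile.false_of_odd {m n : ℕ} (h₁ : EvenSet (m + 1 : ℕ) (n + 1 : ℕ) e₁)
    (h₂ : EvenSet (m + 1 : ℕ) (n + 1 : ℕ) e₂)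
    (hc : ∀ x y : ℤ, 0 < x → x < (m + 1 : ℕ) → 0 < y → y < (n + 1 : ℕ) →
      around (dif e₁ e₂) (2 * x) (2 * y) = 0)
    (hA : Profile (m + 1 : ℕ) (n + 1 : ℕ) (dif e₁ e₂) A) (hP0 : P 0 = 0)
    (hP : ∀ i, P (i + 1) = P i + A i) (hm : (m : ℤ) % 2 = 1) (hn : (n : ℤ) % 2 = 1)
    (hPm : P (m + 1) % 2 = 1) (hPn : P (n + 1) % 2 = 1)
    (hPmn : P (m + n + 2) % 2 = 0) : False := by
  have hb := hA.boundary h₁ h₂ hc hP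
  have hm1 : ∀ i, A (2 * (m + 1) - 1 - i) = A i := fun i => by
    have := hA.refl₁ i; push_cast at this; exact this
  have hn1 : ∀ i, A (2 * (n + 1) - 1 - i) = A i := fun i => by
    have := hA.refl₂ i; push_cast at this; exact this
  rw [Finset.sum_add_distrib, Finset.sum_add_distrib] at hb
  have hL : ∑ y ∈ Finset.range n, wgt P 0 (y + 1) * (A (y + 1) - A (-(y + 1))) =
      - (par (P n) * (1 - A n)) + (1 - A 0) := by
    have := sum_par_primitive hA.values hP 0 n
    simp only [zero_add, hP0, par_of_even (u := 0) rfl] at this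
    trans (1 * (1 - A 0) - par (P n) * (1 - A n))
    · rw [← this]
      apply Finset.sum_congr rfl
      intro y _
      rw [wgt_left_side hP0 hP hA.neg, ← hA.neg y]
      congr 3; ring
    · ring
  have hB : ∑ x ∈ Finset.range m, wgt P (x + 1) 0 * (A (x + 1) - A x) =
      par (P m + m) * A m - A 0 := by
    have := sum_par_primitive_add hA.values hP 0 m
    simp only [zero_add, hP0, par_of_even (u := 0) rfl] at this
    trans -(1 * A 0 - par (P m + m) * A m)
    · rw [← this, ← Finset.sum_neg_distrib]
      apply Finset.sum_congr rfl
      intro x _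
      rw [wgt_bottom_side]
      ring
    · ring
  have hR : ∑ y ∈ Finset.range n, wgt P (m + 1) (y + 1) * (A (m + (y + 1)) - A (m - (y + 1))) =
      (1 - A (m + 1)) + par (P (m + 1 + n)) * (1 - A (m + 1 + n)) := by
    have := sum_par_primitive hA.values hP (m + 1) n
    rw [par_of_odd hPm] at this
    trans -(-1 * (1 - A (m + 1)) - par (P (m + 1 + n)) * (1 - A (m + 1 + n)))
    · rw [← this, ← Finset.sum_neg_distrib]
      apply Finset.sum_congr rfl
      intro y _
      rw [wgt_right_side hP hm1, par_of_even (u := m + 1) (by omega), ← hm1 (m - (y + 1)),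
        show 2 * ((m : ℤ) + 1) - 1 - (m - (y + 1)) = m + 1 + y + 1 by ring,
        show (m : ℤ) + (y + 1) = m + 1 + y by ring,
        show (m : ℤ) + 1 + (y + 1) = m + 1 + y + 1 by ring]
      ring
    · ring
  have hT : ∑ x ∈ Finset.range m, wgt P (x + 1) (n + 1) * (A (x + 1 + n) - A (x + 1 - n - 1)) =
      - A (n + 1) - par (P (n + 1 + m) + (n + 1 + m)) * A (n + 1 + m) := by
    have := sum_par_primitive_add hA.values hP (n + 1) m
    rw [par_of_odd (u := P (n + 1) + (n + 1)) (by omega)] at this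
    trans (-1 * A (n + 1) - par (P (n + 1 + m) + (n + 1 + m)) * A (n + 1 + m))
    · rw [← this]
      apply Finset.sum_congr rfl
      intro x _
      rw [wgt_top_side hP0 hP hA.neg hn1, ← hA.neg (x + 1 - n - 1),
        ← hn1 (-1 - (x + 1 - n - 1)),
        show 2 * ((n : ℤ) + 1) - 1 - (-1 - (x + 1 - n - 1)) = n + 1 + x + 1 by ring,
        show (x : ℤ) + 1 + n = n + 1 + x by ring,
        show (n : ℤ) + 1 + (x + 1) = n + 1 + x + 1 by ring, par_add (P _), add_assoc (_ + _) _ 1,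
        par_add (_ + 1), par_of_even (u := n + 1) (by omega), one_mul]
    · ring
  have hPm' := hP m
  have hPn' := hP n
  have hPmn1 := hP (m + 1 + n)
  rw [show (m : ℤ) + 1 + n + 1 = m + n + 2 by ring] at hPmn1
  have v0 := hA.values 0
  rw [hL, hB, hR, hT, show (n : ℤ) + 1 + m = m + 1 + n by ring] at hb
  rw [par_add, par_add (P m), par_of_odd hm,
    par_of_odd (u := m + 1 + n) (by omega)] at hb
  -- A corner term is nonzero only for one value of `A`, and then the known parity of `P` one step
  -- further fixes its sign.
  have t1 : par (P n) * (1 - A n) ≤ 0 := by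
    rcases hA.values n with h | h
    · rw [h, par_of_odd (by omega)]; norm_num
    · rw [h]; norm_num
  have t2 : 0 ≤ par (P m) * A m := by
    rcases hA.values m with h | h
    · rw [h]; norm_num
    · rw [h, par_of_even (by omega)]; norm_num
  have t3 : 0 ≤ par (P (m + 1 + n)) * (1 - A (m + 1 + n)) := by
    rcases hA.values (m + 1 + n) with h | h
    · rw [h, par_of_even (by omega)]; norm_num
    · rw [h]; norm_num
  have t4 : par (P (m + 1 + n)) * A (m + 1 + n) ≤ 0 := by
    rcases hA.values (m + 1 + n) with h | h
    · rw [h]; norm_num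
    · rw [h, par_of_odd (by omega)]; norm_num
  have t5 := hA.values (m + 1)
  have t6 := hA.values (n + 1)
  have : 0 ≤ 1 - A (m + 1) := by omega
  have : 0 ≤ A (n + 1) := by omega
  linarith

/-- A corner of a narrow grid excludes a balanced profile. -/
lemma Profile.false_of_narrow {m n : ℤ} (hm : 2 ≤ m) (hn : 2 ≤ n) (h2 : m = 2 ∨ n = 2)
    (h₁ : EvenSet m n e₁) (h₂ : EvenSet m n e₂)
    (hc : ∀ x y : ℤ, 0 < x → x < m → 0 < y → y < n → around (dif e₁ e₂) (2 * x) (2 * y) = 0)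
    (hA : Profile m n (dif e₁ e₂) A) (h01 : A 0 ≠ A 1) : False := by
  have n1 : A (-1) = A 0 := by simpa using hA.neg 0
  have n2 : A 2 = A 1 := by
    rcases h2 with rfl | rfl
    · have := hA.refl₁ 1; norm_num at this; exact this
    · have := hA.refl₂ 1; norm_num at this; exact this
  -- All four sides of the corner cell lie in the difference.
  have d1 := (hA.ne_iff 1 0 (by norm_num) (by omega) (by norm_num) (by omega)).2 h01.symm
  have d2 := (hA.ne_iff 1 (-1) (by norm_num) (by omega) (by norm_num) (by omega)).2
    (by rw [n1]; exact h01.symm)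
  have d3 := (hA.ne_iff 2 0 (by norm_num) (by omega) (by norm_num) (by omega)).2
    (by rw [n2]; exact h01.symm)
  have d4 := (hA.ne_iff 2 (-1) (by norm_num) (by omega) (by norm_num) (by omega)).2
    (by rw [n1, n2]; exact h01.symm)
  norm_num at d1 d2 d3 d4
  have c := hc 1 1 (by norm_num) (by omega) (by norm_num) (by omega)
  have z : ∀ a b : ℤ, a ≤ 0 ∨ 2 * m ≤ a ∨ b ≤ 0 ∨ 2 * n ≤ b → ind (e₁ a b) = 0 := by
    intro a b h
    exact ind_false fun h' => by have := h₁.supp a b h'; omega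
  have v00 := h₁.even 0 0
  simp only [deg, around] at v00 c
  norm_num at v00 c
  rw [z 0 1 (by omega), z 1 0 (by omega)] at v00
  have val : ∀ a b, dif e₁ e₂ a b ≠ 0 → dif e₁ e₂ a b = 2 * ind (e₁ a b) - 1 := by
    intro a b h
    unfold dif at *
    rcases ind_eq (e₁ a b) with h1 | h1 <;> rcases ind_eq (e₂ a b) with h2 | h2 <;>
      rw [h1.2, h2.2] at h ⊢ <;> omega
  -- The cell condition now says that exactly two of the four sides belong to `e₁`. But the cell
  -- touches two corners of the narrow grid, where only two edges meet, and evenness there forces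
  -- three of its sides to be in or out together.
  rw [val _ _ d1, val _ _ d2, val _ _ d3, val _ _ d4] at c
  have w1 := ind_eq (e₁ 2 1)
  have w2 := ind_eq (e₁ 1 2)
  have w3 := ind_eq (e₁ 3 2)
  have w4 := ind_eq (e₁ 2 3)
  rcases h2 with rfl | rfl
  · have v10 := h₁.even 1 0
    simp only [deg, around] at v10
    norm_num at v10
    rw [z 4 1 (by omega), z 3 0 (by omega)] at v10
    omega
  · have v01 := h₁.even 0 1
    simp only [deg, around] at v01
    norm_num at v01
    rw [z 0 3 (by omega), z 1 4 (by omega)] at v01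
    omega

/-! ### The upper bound. -/

/-- Two reflections compose to a translation, so `2 * m` and `2 * n` are periods, and by Bézout so
is twice their gcd. -/
lemma Profile.refl_gcd {m n : ℕ} {f : ℤ → ℤ → ℤ} (hA : Profile m n f A) (i : ℤ) :
    A (2 * (Nat.gcd m n : ℕ) - 1 - i) = A i := by
  have hm : Function.Periodic A (2 * m) := fun i => by
    rw [← hA.refl₁, ← hA.neg i]; congr 1; ring
  have hn : Function.Periodic A (2 * n) := fun i => by
    rw [← hA.refl₂, ← hA.neg i]; congr 1; ring
  have h := (hm.int_mul (Nat.gcdA m n)).add_period (hn.int_mul (Nat.gcdB m n)) (-1 - i)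
  rw [hA.neg] at h
  rw [← h, Nat.gcd_eq_gcd_ab]
  congr 1
  push_cast
  ring

/-- The size is `(d² - (d - 2k)²)m'n'`, so the claim reduces to `delta m n ≤ (d - 2k)²`. -/
lemma dcard_dif_le {m n d m' n' : ℕ} (hm : 2 ≤ m) (hn : 2 ≤ n) (hd : d = Nat.gcd m n)
    (hm' : m = d * m') (hn' : n = d * n') (h₁ : EvenSet m n e₁) (h₂ : EvenSet m n e₂)
    (hc : ∀ x y : ℤ, 0 < x → x < m → 0 < y → y < n → around (dif e₁ e₂) (2 * x) (2 * y) = 0) :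
    (dcard m n (dif e₁ e₂) : ℤ) ≤ (m : ℤ) * n - (delta m n : ℤ) * m' * n' := by
  have hf := h₁.isDif h₂ hc
  obtain ⟨A, hA⟩ := hf.exists_profile (by omega) (by omega)
  have hq := hA.refl_gcd
  rw [← hd] at hq
  rw [dcard_eq hf hA hq hm' hn']
  set k : ℤ := ∑ i ∈ Finset.range d, A i with hk
  have hmn : (m : ℤ) * n = d * d * m' * n' := by
    rw [hm', hn']; push_cast; ring
  have hd0 : 0 < d := by rw [hd]; exact Nat.gcd_pos_of_pos_left _ (by omega)
  suffices h : 4 * k * (d - k) ≤ d * d - (delta m n : ℤ) by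
    have h0 : (0 : ℤ) ≤ m' * n' := by positivity
    have := mul_le_mul_of_nonneg_right h h0
    rw [hmn]
    linarith
  have key : 4 * k * ((d : ℤ) - k) = d * d - (d - 2 * k) ^ 2 := by ring
  rw [key]
  unfold delta
  rw [← hd]
  split_ifs with c1 c2 c3
  · have : (d : ℤ) - 2 * k ≠ 0 := by
      obtain ⟨r, hr⟩ := c1
      omega
    have := sq_pos_of_ne_zero this
    push_cast
    linarith
  · push_cast; nlinarith [sq_nonneg ((d : ℤ) - 2 * k)]
  · push_cast; nlinarith [sq_nonneg ((d : ℤ) - 2 * k)]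
  have hev : d % 2 = 0 := Nat.even_iff.1 (Nat.not_odd_iff_even.1 c1)
  -- For even `d` the number `d - 2k` is even, so once it is nonzero its square is at least 4.
  have hk2 : (d : ℤ) ≠ 2 * k := by
    intro hdk
    obtain ⟨P, hP0, hP⟩ := exists_primitive A
    have hPk : ∀ j : ℕ, P j = ∑ i ∈ Finset.range j, A i := by
      intro j
      induction j with
      | zero => simpa using hP0
      | succ j ih => rw [Finset.sum_range_succ, ← ih]; push_cast; exact hP j
    have hPd : P d = k := hPk d
    by_cases hnar : m = 2 ∨ n = 2
    · have hd2 : d = 2 := by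
        have h1 : d ∣ m := ⟨m', hm'⟩
        have h2 : d ∣ n := ⟨n', hn'⟩
        have : d ≤ 2 := by
          rcases hnar with h | h
          · rw [h] at h1; exact Nat.le_of_dvd (by norm_num) h1
          · rw [h] at h2; exact Nat.le_of_dvd (by norm_num) h2
        omega
      rw [hd2, Finset.sum_range_succ, Finset.sum_range_one] at hk
      push_cast at hk
      have v0 := hA.values 0
      refine hA.false_of_narrow (by omega) (by omega) (by omega) h₁ h₂ hc (fun h01 => ?_)
      rw [← h01] at hk
      omega
    · have hm2 : m % 2 = 0 := by rw [hm', Nat.mul_mod, hev]; simp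
      have hn2 : n % 2 = 0 := by rw [hn', Nat.mul_mod, hev]; simp
      have hm4 : 4 ≤ m := by omega
      have hn4 : 4 ≤ n := by omega
      have hodd : Odd (m' * n') := by
        by_contra hne
        refine c3 ⟨by omega, hm4, hn4, ?_⟩
        rw [show m * n = m' * n' * d ^ 2 by rw [hm', hn']; ring,
          Nat.mul_div_cancel _ (by positivity)]
        exact Nat.not_odd_iff_even.1 hne
      rw [Nat.odd_mul] at hodd
      obtain ⟨⟨a, ha⟩, ⟨b, hb⟩⟩ := hodd
      have hPm := primitive_mul hP0 hP hA.neg hq m'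
      have hPn := primitive_mul hP0 hP hA.neg hq n'
      have hPmn := primitive_mul hP0 hP hA.neg hq (m' + n')
      obtain ⟨m, rfl⟩ : ∃ r, m = r + 1 := ⟨m - 1, by omega⟩
      obtain ⟨n, rfl⟩ : ∃ r, n = r + 1 := ⟨n - 1, by omega⟩
      -- `k` is odd because `d = 2k` is not divisible by 4.
      obtain ⟨r, hr⟩ : ∃ r, k = 2 * r + 1 := ⟨k / 2, by omega⟩
      rw [show (m' : ℤ) * d = m + 1 by
        rw [mul_comm]; have := congrArg (Nat.cast (R := ℤ)) hm'; push_cast at this; linarith,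
        hPd, ha, hr] at hPm
      rw [show (n' : ℤ) * d = n + 1 by
        rw [mul_comm]; have := congrArg (Nat.cast (R := ℤ)) hn'; push_cast at this; linarith,
        hPd, hb, hr] at hPn
      rw [show ((m' + n' : ℕ) : ℤ) * d = m + n + 2 by
        have h1 := congrArg (Nat.cast (R := ℤ)) hn'; push_cast at h1
        have h2 := congrArg (Nat.cast (R := ℤ)) hm'; push_cast at h2; push_cast; linarith,
        hPd, ha, hb, hr] at hPmn
      push_cast at hPm hPn hPmn
      refine hA.false_of_odd h₁ h₂ hc hP0 hP (by omega) (by omega) ?_ ?_ ?_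
      · rw [hPm, show (2 * (a : ℤ) + 1) * (2 * r + 1) = 2 * (2 * a * r + a + r) + 1 by ring]
        omega
      · rw [hPn, show (2 * (b : ℤ) + 1) * (2 * r + 1) = 2 * (2 * b * r + b + r) + 1 by ring]
        omega
      · rw [hPmn, show (2 * (a : ℤ) + 1 + (2 * b + 1)) * (2 * r + 1) =
          2 * ((a + b + 1) * (2 * r + 1)) by ring]
        omega
  push_cast
  have : ((d : ℤ) - 2 * k ≤ -2) ∨ (2 ≤ (d : ℤ) - 2 * k) := by omega
  rcases this with h | h <;> nlinarith

lemma IsCycle.evenSet {m n : ℕ} {C : Finset (Sym2 (Fin m × Fin n))} (hC : IsCycle C) :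
    EvenSet m n (edg C) where
  supp := hC.inGrid.supp
  even x y := by rcases hC.deg_eq x y with h | h <;> rw [h] <;> rfl

/-- The upper bound. -/
lemma IsCycle.card_symmDiff_le {m n d m' n' : ℕ} (hm : 2 ≤ m) (hn : 2 ≤ n) (hd : d = Nat.gcd m n)
    (hm' : m = d * m') (hn' : n = d * n') {C₁ C₂ : Finset (Sym2 (Fin m × Fin n))}
    (h₁ : IsCycle C₁) (h₂ : IsCycle C₂) (hs : signature C₁ = signature C₂) :
    ((symmDiff C₁ C₂).card : ℤ) ≤ (m : ℤ) * n - (delta m n : ℤ) * m' * n' := by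
  rw [card_symmDiff_eq h₁.inGrid h₂.inGrid]
  exact dcard_dif_le hm hn hd hm' hn' h₁.evenSet h₂.evenSet
    ((signature_eq_iff h₁.inGrid h₂.inGrid).1 hs)

end

/-! ### Gluing pairs of loops -/

section
variable {V W : Type*} {G : SimpleGraph V} {H : SimpleGraph W}

lemma reachable_of_adj_reachable {φ : V → W}
    (h : ∀ u v, G.Adj u v → H.Reachable (φ u) (φ v)) {u v : V} (huv : G.Reachable u v) :
    H.Reachable (φ u) (φ v) := by
  obtain ⟨p⟩ := huv
  induction p with
  | nil => exact SimpleGraph.Reachable.refl _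
  | cons hadj _ ih => exact (h _ _ hadj).trans ih

end

/-- Two loops with given difference, whose signatures agree, and which have the edges of `K` in
common. -/
def Pair (m n : ℤ) (f : ℤ → ℤ → ℤ) (K : ℤ → ℤ → Prop) : Prop :=
  ∃ e₁ e₂, IsLoop m n e₁ ∧ IsLoop m n e₂ ∧ dif e₁ e₂ = f ∧
    (∀ x y : ℤ, 0 < x → x < m → 0 < y → y < n → around f (2 * x) (2 * y) = 0) ∧
    ∀ a b, K a b → e₁ a b ∧ e₂ a b

section
variable {m n : ℤ} {e : ℤ → ℤ → Prop}

/-- A correspondence between the graphs of two sets of edges transfers loops. -/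
lemma IsLoop.of_equiv {m' n' : ℤ} {e' : ℤ → ℤ → Prop} (h : IsLoop m n e) (φ : ℤ × ℤ ≃ ℤ × ℤ)
    (hφ : ∀ u v, (gr e').Adj (φ u) (φ v) ↔ (gr e).Adj u v) (hs : Supp m' n' e')
    (hd : ∀ x y, ∃ x' y', Slitherlink.deg e' (2 * x + 1) (2 * y + 1) =
      Slitherlink.deg e (2 * x' + 1) (2 * y' + 1)) :
    IsLoop m' n' e' where
  supp := hs
  deg x y := by
    obtain ⟨x', y', h'⟩ := hd x y
    rw [h']
    exact h.deg x' y'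
  conn u v hu hv := by
    obtain ⟨u, rfl⟩ := φ.surjective u
    obtain ⟨v, rfl⟩ := φ.surjective v
    have hs : ∀ u, (∃ w, (gr e').Adj (φ u) w) → ∃ w, (gr e).Adj u w := by
      rintro u ⟨w, hw⟩
      obtain ⟨w, rfl⟩ := φ.surjective w
      exact ⟨w, (hφ _ _).1 hw⟩
    exact reachable_of_adj_reachable (fun a b hab => ((hφ a b).2 hab).reachable)
      (h.conn u v (hs u hu) (hs v hv))
  nonempty := by
    obtain ⟨u, w, huw⟩ := h.nonempty
    exact ⟨_, _, (hφ _ _).2 huw⟩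

lemma IsLoop.mirror (h : IsLoop m n e) : IsLoop m n (fun a b => e (2 * m - a) b) := by
  refine h.of_equiv (Equiv.prodCongr (Equiv.subLeft (m - 1)) (Equiv.refl ℤ)) ?_ ?_ ?_
  · rintro ⟨a, b⟩ ⟨c, d⟩
    simp only [gr_adj, Equiv.prodCongr_apply, Prod.map_apply, Equiv.subLeft_apply,
      Equiv.refl_apply, Nbr]
    rw [show 2 * m - (m - 1 - a + (m - 1 - c) + 1) = a + c + 1 by ring]
    refine and_congr_left fun _ => ?_
    omega
  · intro a b hab
    have := h.supp _ _ hab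
    omega
  · intro x y
    refine ⟨m - 1 - x, y, ?_⟩
    simp only [Slitherlink.deg, around]
    rw [show 2 * m - (2 * x + 1 + 1) = 2 * (m - 1 - x) + 1 - 1 by ring,
      show 2 * m - (2 * x + 1 - 1) = 2 * (m - 1 - x) + 1 + 1 by ring,
      show 2 * m - (2 * x + 1) = 2 * (m - 1 - x) + 1 by ring]
    ring

lemma IsLoop.transpose (h : IsLoop m n e) : IsLoop n m (fun a b => e b a) := by
  refine h.of_equiv (Equiv.prodComm ℤ ℤ) ?_ ?_ ?_
  · rintro ⟨a, b⟩ ⟨c, d⟩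
    simp only [gr_adj, Equiv.prodComm_apply, Prod.swap_prod_mk, Nbr]
    refine and_congr_left fun _ => ?_
    omega
  · intro a b hab
    have := h.supp _ _ hab
    omega
  · intro x y
    refine ⟨y, x, ?_⟩
    simp only [Slitherlink.deg, around]
    ring

lemma IsLoop.reachable_delete' (h : IsLoop m n e) {u v : ℤ × ℤ} (huv : (gr e).Adj u v) :
    ((gr e).deleteEdges {s(u, v)}).Reachable u v := by
  have := h.supp _ _ huv.2
  obtain ⟨m, rfl⟩ := Int.eq_ofNat_of_zero_le (a := m) (by omega)
  obtain ⟨n, rfl⟩ := Int.eq_ofNat_of_zero_le (a := n) (by omega)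
  exact h.reachable_delete huv

end

section
variable {m n : ℤ} {f : ℤ → ℤ → ℤ} {K : ℤ → ℤ → Prop}

lemma Pair.swap (h : Pair m n f K) : Pair m n (fun a b => - f a b) K := by
  obtain ⟨e₁, e₂, h₁, h₂, rfl, hc, hK⟩ := h
  refine ⟨e₂, e₁, h₂, h₁, ?_, ?_, fun a b hab => (hK a b hab).symm⟩
  · funext a b; unfold dif; ring
  · intro x y hx hx' hy hy'
    have := hc x y hx hx' hy hy'
    unfold around at *
    linarith

lemma Pair.mirror (h : Pair m n f K) :
    Pair m n (fun a b => f (2 * m - a) b) (fun a b => K (2 * m - a) b) := by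
  obtain ⟨e₁, e₂, h₁, h₂, rfl, hc, hK⟩ := h
  refine ⟨_, _, h₁.mirror, h₂.mirror, ?_, ?_, fun a b hab => hK _ b hab⟩
  · funext a b; unfold dif; ring
  · intro x y hx hx' hy hy'
    have := hc (m - x) y (by omega) (by omega) hy hy'
    unfold around at *
    rw [show 2 * (m - x) + 1 = 2 * m - (2 * x - 1) by ring,
      show 2 * (m - x) - 1 = 2 * m - (2 * x + 1) by ring,
      show 2 * (m - x) = 2 * m - 2 * x by ring] at this
    linarith

lemma Pair.transpose (h : Pair m n f K) : Pair n m (fun a b => f b a) (fun a b => K b a) := by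
  obtain ⟨e₁, e₂, h₁, h₂, rfl, hc, hK⟩ := h
  refine ⟨_, _, h₁.transpose, h₂.transpose, ?_, ?_, fun a b hab => hK _ _ hab⟩
  · funext a b; unfold dif; ring
  · intro x y hx hx' hy hy'
    have := hc y x hy hy' hx hx'
    unfold around at *
    linarith

lemma Pair.eq_zero (h : Pair m n f K) {a b : ℤ} (hab : a ≤ 0 ∨ 2 * m ≤ a ∨ b ≤ 0 ∨ 2 * n ≤ b) :
    f a b = 0 := by
  obtain ⟨e₁, e₂, h₁, h₂, rfl, -, -⟩ := h
  unfold dif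
  rw [ind_false fun h => by have := h₁.supp a b h; omega,
    ind_false fun h => by have := h₂.supp a b h; omega, sub_zero]

end

/-- The union of two loops in adjacent boxes, joined across the cell with centre `(2 * m, c)`. -/
def join (m c : ℤ) (e e' : ℤ → ℤ → Prop) (a b : ℤ) : Prop :=
  (e a b ∧ ¬(a = 2 * m - 1 ∧ b = c)) ∨ (e' (a - 2 * m) b ∧ ¬(a = 2 * m + 1 ∧ b = c)) ∨
    (a = 2 * m ∧ (b = c - 1 ∨ b = c + 1))

section
variable {m n m' c : ℤ} {e e' : ℤ → ℤ → Prop}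

/-- The correction depends only on `m` and `c`, so it disappears from the difference of two joined
loops. -/
lemma ind_join (h : Supp m n e) (h' : Supp m' n e') (hc : e (2 * m - 1) c) (hc' : e' 1 c)
    (a b : ℤ) : ind (join m c e e' a b) = ind (e a b) + ind (e' (a - 2 * m) b) +
      ((if a = 2 * m ∧ (b = c - 1 ∨ b = c + 1) then 1 else 0) -
        (if (a = 2 * m - 1 ∨ a = 2 * m + 1) ∧ b = c then 1 else 0)) := by
  have s1 := h a b
  have s2 := h' (a - 2 * m) b
  rcases lt_trichotomy a (2 * m) with ha | ha | ha
  · rw [ind_false (p := e' _ _) (fun hh => by have := s2 hh; omega), if_neg (by omega)]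
    by_cases hd : a = 2 * m - 1 ∧ b = c
    · obtain ⟨rfl, rfl⟩ := hd
      rw [ind_true hc, if_pos (by omega), ind_false]; · norm_num
      rintro (h1 | h1 | h1)
      · exact h1.2 ⟨rfl, rfl⟩
      · have := h' _ _ h1.1; omega
      · omega
    · rw [if_neg (by omega), ind_congr (q := e a b)]; · ring
      constructor
      · rintro (h1 | h1 | h1)
        · exact h1.1
        · have := s2 h1.1; omega
        · omega
      · exact fun h1 => Or.inl ⟨h1, hd⟩
  · rw [ind_false (p := e' _ _) (fun hh => by have := s2 hh; omega),
      ind_false (p := e _ _) (fun hh => by have := s1 hh; omega), if_neg (c := _ ∧ b = c) (by omega)]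
    rw [ind_congr (q := a = 2 * m ∧ (b = c - 1 ∨ b = c + 1))]
    · unfold ind; split_ifs <;> norm_num
    · constructor
      · rintro (h1 | h1 | h1)
        · have := s1 h1.1; omega
        · have := s2 h1.1; omega
        · exact h1
      · exact fun h1 => Or.inr (Or.inr h1)
  · rw [ind_false (p := e _ _) (fun hh => by have := s1 hh; omega), if_neg (by omega)]
    by_cases hd : a = 2 * m + 1 ∧ b = c
    · obtain ⟨rfl, rfl⟩ := hd
      rw [show 2 * m + 1 - 2 * m = 1 by ring, ind_true hc', if_pos (by omega), ind_false]; · norm_num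
      rintro (h1 | h1 | h1)
      · have := h _ _ h1.1; omega
      · exact h1.2 ⟨rfl, rfl⟩
      · omega
    · rw [if_neg (by omega), ind_congr (q := e' (a - 2 * m) b)]; · ring
      constructor
      · rintro (h1 | h1 | h1)
        · have := s1 h1.1; omega
        · exact h1.1
        · omega
      · exact fun h1 => Or.inr (Or.inl ⟨h1, hd⟩)

lemma deg_eq_zero (h : Supp m n e) {x y : ℤ} (hx : x < 0 ∨ m ≤ x) :
    deg e (2 * x + 1) (2 * y + 1) = 0 := by
  have z : ∀ a b : ℤ, a ≤ 0 ∨ 2 * m ≤ a → ind (e a b) = 0 := by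
    intro a b hab
    exact ind_false fun h' => by have := h a b h'; omega
  simp only [deg, around]
  rw [z _ _ (by omega), z _ _ (by omega), z _ _ (by omega), z _ _ (by omega)]
  rfl

/-- A loop stays connected without one edge, so a map may destroy that edge and still preserve
connectedness. -/
lemma IsLoop.reachable_map {W : Type*} {G : SimpleGraph W} (h : IsLoop m n e) (φ : ℤ × ℤ → W)
    {u v : ℤ × ℤ} (huv : (gr e).Adj u v)
    (hG : ∀ a b, (gr e).Adj a b →
      ¬(a.1 + b.1 + 1 = u.1 + v.1 + 1 ∧ a.2 + b.2 + 1 = u.2 + v.2 + 1) → G.Adj (φ a) (φ b))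
    {a b : ℤ × ℤ} (hab : (gr e).Reachable a b) : G.Reachable (φ a) (φ b) := by
  have key : ∀ a b, ((gr e).deleteEdges {s(u, v)}).Adj a b → G.Adj (φ a) (φ b) := by
    intro a b hab
    rw [SimpleGraph.deleteEdges_adj] at hab
    refine hG a b hab.1 fun hne => hab.2 ?_
    rw [Set.mem_singleton_iff, Sym2.eq_iff]
    exact nbr_mid hab.1.1 huv.1 (by omega) (by omega)
  refine reachable_of_adj_reachable (fun a b hab => ?_) hab
  by_cases heq : s(a, b) = s(u, v)
  · have := reachable_of_adj_reachable (fun a b hab => (key a b hab).reachable)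
      (h.reachable_delete' huv)
    rw [Sym2.eq_iff] at heq
    rcases heq with ⟨rfl, rfl⟩ | ⟨rfl, rfl⟩
    · exact this
    · exact this.symm
  · exact (key _ _ (by rw [SimpleGraph.deleteEdges_adj]; exact ⟨hab, heq⟩)).reachable

/-- Each of the four vertices of the joining cell loses one edge and gains one. -/
lemma deg_join (h : Supp m n e) (h' : Supp m' n e') (hc : e (2 * m - 1) c) (hc' : e' 1 c)
    (x z : ℤ) : deg (join m c e e') (2 * x + 1) (2 * z + 1) =
      deg e (2 * x + 1) (2 * z + 1) + deg e' (2 * (x - m) + 1) (2 * z + 1) := by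
  have sc := h _ _ hc
  simp only [deg, around, ind_join h h' hc hc']
  rw [show 2 * x + 1 + 1 - 2 * m = 2 * (x - m) + 1 + 1 by ring,
    show 2 * x + 1 - 1 - 2 * m = 2 * (x - m) + 1 - 1 by ring,
    show 2 * x + 1 - 2 * m = 2 * (x - m) + 1 by ring,
    if_neg (c := (2 * x + 1 + 1 = 2 * m - 1 ∨ _) ∧ _) (by omega),
    if_neg (c := (2 * x + 1 - 1 = 2 * m - 1 ∨ _) ∧ _) (by omega),
    if_neg (c := 2 * x + 1 = 2 * m ∧ (2 * z + 1 + 1 = _ ∨ _)) (by omega),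
    if_neg (c := 2 * x + 1 = 2 * m ∧ (2 * z + 1 - 1 = _ ∨ _)) (by omega)]
  split_ifs <;> omega

/-- Opening each loop at its removed edge leaves a path; the two bridges close these paths into a
single loop. -/
lemma IsLoop.join (h : IsLoop m n e) (h' : IsLoop m' n e') (hc : e (2 * m - 1) c) (hc' : e' 1 c) :
    IsLoop (m + m') n (join m c e e') := by
  have sc := h.supp _ _ hc
  have sc' := h'.supp _ _ hc'
  obtain ⟨y, rfl⟩ : ∃ y, c = 2 * y + 2 := ⟨c / 2 - 1, by omega⟩
  have hadj : (gr e).Adj (m - 1, y) (m - 1, y + 1) :=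
    gr_up.2 (by rw [show 2 * (m - 1) + 1 = 2 * m - 1 by ring]; exact hc)
  have hadj' : (gr e').Adj (0, y) (0, y + 1) := gr_up.2 hc'
  set G := gr (Slitherlink.join m (2 * y + 2) e e') with hG
  have hl : ∀ u v, (gr e).Reachable u v → G.Reachable u v := fun u v huv =>
    h.reachable_map (G := G) id hadj (fun a b hab hne => by
      refine ⟨hab.1, Or.inl ⟨hab.2, fun hh => hne ⟨?_, ?_⟩⟩⟩
      · simp only [id] at hh ⊢; omega
      · simp only [id] at hh ⊢; omega) huv
  have hr : ∀ u v, (gr e').Reachable u v → G.Reachable (u.1 + m, u.2) (v.1 + m, v.2) :=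
    fun u v huv =>
    h'.reachable_map (G := G) (fun u => (u.1 + m, u.2)) hadj' (fun a b hab hne => by
      refine ⟨?_, Or.inr (Or.inl ⟨?_, fun hh => hne ⟨?_, ?_⟩⟩)⟩
      · have := hab.1; simp only [Nbr] at *; omega
      · have := hab.2
        rwa [show a.1 + b.1 + 1 = (a.1 + m) + (b.1 + m) + 1 - 2 * m by ring] at this
      · simp only at hh ⊢; omega
      · simp only at hh ⊢; omega) huv
  have hbridge : ∀ z, z = y ∨ z = y + 1 → G.Adj (m - 1, z) (m, z) := by
    intro z hz
    have := gr_right (e := Slitherlink.join m (2 * y + 2) e e') (x := m - 1) (y := z)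
    rw [sub_add_cancel] at this
    rw [hG, this]
    exact Or.inr (Or.inr (by omega))
  have main : ∀ u w, Nbr u w → (e (u.1 + w.1 + 1) (u.2 + w.2 + 1) ∨
      e' (u.1 + w.1 + 1 - 2 * m) (u.2 + w.2 + 1)) → G.Reachable u (m - 1, y) := by
    rintro u w hn (h1 | h1)
    · exact hl _ _ (h.conn _ _ ⟨w, hn, h1⟩ ⟨_, hadj⟩)
    · have := hr (u.1 - m, u.2) (0, y) (h'.conn _ _ ⟨(w.1 - m, w.2),
        by simp only [Nbr] at *; omega, by
          simp only
          rwa [show u.1 - m + (w.1 - m) + 1 = u.1 + w.1 + 1 - 2 * m by ring]⟩ ⟨_, hadj'⟩)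
      simp only [sub_add_cancel, zero_add] at this
      exact this.trans (hbridge y (Or.inl rfl)).symm.reachable
  have hbase : ∀ u, (∃ w, G.Adj u w) → G.Reachable u (m - 1, y) := by
    rintro u ⟨w, hn, h1 | h1 | h1⟩
    · exact main u w hn (Or.inl h1.1)
    · exact main u w hn (Or.inr h1.1)
    · obtain ⟨a, b⟩ := u
      simp only [Nbr] at hn h1
      have h2 : b = y ∨ b = y + 1 := by omega
      have hm1 : G.Reachable (m - 1, b) (m - 1, y) := by
        rcases h2 with rfl | rfl
        · exact SimpleGraph.Reachable.refl _
        · exact (hl _ _ hadj.reachable).symm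
      have h3 : a = m - 1 ∨ a = m := by omega
      rcases h3 with rfl | rfl
      · exact hm1
      · exact (hbridge b h2).symm.reachable.trans hm1
  refine ⟨?_, ?_, fun u v hu hv => (hbase u hu).trans (hbase v hv).symm,
    ⟨_, _, hbridge y (Or.inl rfl)⟩⟩
  · rintro a b (h1 | h1 | h1)
    · have := h.supp _ _ h1.1; omega
    · have := h'.supp _ _ h1.1; omega
    · omega
  · intro x z
    rw [deg_join h.supp h'.supp hc hc']
    by_cases hx : x < m
    · rw [deg_eq_zero h'.supp (by omega), add_zero]
      exact h.deg x z
    · rw [deg_eq_zero h.supp (by omega), zero_add]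
      exact h'.deg _ z

end

/-- The bridges belong to both loops, so in a cell between the boxes only the two facing edges
count; `hf` is precisely the cell condition there. -/
lemma Pair.join {m n m' c : ℤ} {f f' : ℤ → ℤ → ℤ} {K K' : ℤ → ℤ → Prop} (h : Pair m n f K)
    (h' : Pair m' n f' K') (hc : K (2 * m - 1) c) (hc' : K' 1 c)
    (hf : ∀ b, f (2 * m - 1) b + f' 1 b = 0) :
    Pair (m + m') n (fun a b => f a b + f' (a - 2 * m) b)
      (fun a b => K a b ∧ ¬(a = 2 * m - 1 ∧ b = c)) := by
  have hz : ∀ a b, 2 * m ≤ a → f a b = 0 := fun a b ha => h.eq_zero (by omega)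
  have hz' : ∀ a b, a ≤ 0 → f' a b = 0 := fun a b ha => h'.eq_zero (by omega)
  obtain ⟨e₁, e₂, h₁, h₂, rfl, hcell, hK⟩ := h
  obtain ⟨e₁', e₂', h₁', h₂', rfl, hcell', hK'⟩ := h'
  have k := hK _ _ hc
  have k' := hK' _ _ hc'
  refine ⟨_, _, h₁.join h₁' k.1 k'.1, h₂.join h₂' k.2 k'.2, ?_, ?_, ?_⟩
  · funext a b
    unfold dif
    rw [ind_join h₁.supp h₁'.supp k.1 k'.1, ind_join h₂.supp h₂'.supp k.2 k'.2]
    ring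
  · intro x y hx hx' hy hy'
    have e : around (fun a b => dif e₁ e₂ a b + dif e₁' e₂' (a - 2 * m) b) (2 * x) (2 * y) =
        around (dif e₁ e₂) (2 * x) (2 * y) + around (dif e₁' e₂') (2 * (x - m)) (2 * y) := by
      simp only [around]
      rw [show 2 * x + 1 - 2 * m = 2 * (x - m) + 1 by ring,
        show 2 * x - 1 - 2 * m = 2 * (x - m) - 1 by ring,
        show 2 * x - 2 * m = 2 * (x - m) by ring]
      ring
    rw [e]
    rcases lt_trichotomy x m with hxm | rfl | hxm
    · rw [hcell x y hx hxm hy hy']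
      simp only [around]
      rw [hz' _ _ (by omega), hz' _ _ (by omega), hz' _ _ (by omega), hz' _ _ (by omega)]
      rfl
    · simp only [around, sub_self, mul_zero, zero_add, zero_sub]
      rw [hz' (-1) _ (by omega), hz' 0 _ (by omega), hz' 0 _ (by omega), hz (2 * x + 1) _ (by omega),
        hz (2 * x) _ (by omega), hz (2 * x) _ (by omega)]
      have := hf (2 * y)
      linarith
    · rw [hcell' (x - m) y (by omega) (by omega) hy hy']
      simp only [around]
      rw [hz _ _ (by omega), hz _ _ (by omega), hz _ _ (by omega), hz _ _ (by omega)]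
      rfl
  · rintro a b ⟨hab, hne⟩
    have := hK a b hab
    exact ⟨Or.inl ⟨this.1, hne⟩, Or.inl ⟨this.2, hne⟩⟩

/-- A row of copies of a pair of loops, every second one reflected and with the loops exchanged. -/
lemma Pair.row {m n c c' : ℤ} (hm : 2 ≤ m) (k : ℕ) {f : ℤ → ℤ → ℤ} {K : ℤ → ℤ → Prop}
    (h : Pair m n f K) (hc : K 1 c) (hc' : K (2 * m - 1) c') :
    ∃ f' K', Pair ((k + 1 : ℕ) * m) n f' K' ∧ (∀ a b, a ≤ 2 * m → f' a b = f a b) ∧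
      (∀ z, (∀ a, f a z = 0) → ∀ a, f' a z = 0) ∧ (∀ a b, b % 2 = 1 → K a b → K' a b) ∧
      K' 1 c := by
  induction k generalizing f K c c' with
  | zero =>
    refine ⟨f, K, by simpa using h, fun _ _ _ => rfl, fun _ h => h, fun _ _ _ h => h, hc⟩
  | succ k ih =>
    -- The rest of the row starts with the mirrored and exchanged pair, whose left column is minus
    -- the right column of `f`.
    obtain ⟨f', K', h1, h2, h3, h4, h5⟩ := ih (c := c') (c' := c) h.mirror.swap
      hc' (by rwa [show 2 * m - (2 * m - 1) = 1 by ring])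
    -- The removed edge is vertical, so the common horizontal edges survive and remain available for
    -- stacking rows.
    have hodd : c' % 2 = 0 := by
      obtain ⟨e₁, e₂, h₁, -, -, -, hK⟩ := h
      have := h₁.supp _ _ (hK _ _ hc').1
      omega
    have h6 := h.join h1 hc' h5 (fun b => by rw [h2 _ _ (by omega)]; ring_nf)
    rw [show m + ((k + 1 : ℕ) : ℤ) * m = ((k + 1 + 1 : ℕ) : ℤ) * m by push_cast; ring] at h6
    refine ⟨_, _, h6, ?_, ?_, ?_, ?_⟩
    · intro a b ha
      rw [h1.eq_zero (by omega), add_zero]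
    · intro z hz a
      rw [hz, h3 z (fun a => by rw [hz, neg_zero]), add_zero]
    · intro a b hb hab
      exact ⟨hab, by omega⟩
    · exact ⟨hc, by omega⟩

/-- A rectangular array of copies of a pair of loops. -/
lemma Pair.array {m n a a' c c' : ℤ} (hm : 2 ≤ m) (hn : 2 ≤ n) (k l : ℕ) {f : ℤ → ℤ → ℤ}
    {K : ℤ → ℤ → Prop} (h : Pair m n f K) (hl : K 1 c) (hr : K (2 * m - 1) c') (hb : K a 1)
    (ht : K a' (2 * n - 1)) :
    ∃ f' K', Pair ((k + 1 : ℕ) * m) ((l + 1 : ℕ) * n) f' K' ∧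
      (∀ a b, a ≤ 2 * m → b ≤ 2 * n → f' a b = f a b) ∧
      (∀ z, z ≤ 2 * m → (∀ b, f z b = 0) → ∀ b, f' z b = 0) := by
  obtain ⟨f₁, K₁, h1, h2, -, h4, -⟩ := h.row hm k hl hr
  obtain ⟨f₂, K₂, g1, g2, g3, -, -⟩ := h1.transpose.row hn l (c := a) (c' := a')
    (h4 _ _ (by norm_num) hb) (h4 _ _ (by omega) ht)
  refine ⟨_, _, g1.transpose, fun a b ha hb => ?_, fun z hz h0 b => ?_⟩
  · rw [g2 _ _ hb, h2 _ _ ha]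
  · exact g3 z (fun b => by rw [h2 _ _ hz]; exact h0 b) b

lemma IsLoop.evenSet {m n : ℤ} {e : ℤ → ℤ → Prop} (h : IsLoop m n e) : EvenSet m n e where
  supp := h.supp
  even x y := by rcases h.deg x y with h | h <;> rw [h] <;> rfl

open Classical in
/-- The size of the difference in terms of its profile on the diagonal. -/
lemma Pair.dcard_eq {m n q m' n' : ℕ} {f : ℤ → ℤ → ℤ} {K : ℤ → ℤ → Prop} (h : Pair m n f K)
    (hm : m = q * m') (hn : n = q * n') (hm0 : 0 < m) (hn0 : 0 < n)
    (hz : ∀ b, f (2 * q) b = 0) {k : ℤ}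
    (hk : ∑ i ∈ Finset.range q, (if f (i + 1) i ≠ 0 then (1 : ℤ) else 0) = k) :
    (dcard m n f : ℤ) = 4 * k * (q - k) * m' * n' := by
  obtain ⟨e₁, e₂, h₁, h₂, rfl, hc, -⟩ := h
  have hf := h₁.evenSet.isDif h₂.evenSet hc
  obtain ⟨A, hA⟩ := hf.exists_profile (by omega) (by omega)
  have hqm : q ≤ m := Nat.le_of_dvd hm0 ⟨m', hm⟩
  have hqn : q ≤ n := Nat.le_of_dvd hn0 ⟨n', hn⟩
  -- Vanishing on the column `2 * q` supplies the reflection of the profile about `q`, so only the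
  -- first `q` diagonal entries matter.
  rw [Slitherlink.dcard_eq hf hA (hA.vanish q (by omega) (by omega) hz) hm hn, ← hk]
  have : ∑ i ∈ Finset.range q, A i =
      ∑ i ∈ Finset.range q, (if dif e₁ e₂ (i + 1) i ≠ 0 then (1 : ℤ) else 0) := by
    apply Finset.sum_congr rfl
    intro i hi
    rw [Finset.mem_range] at hi
    have := hA.diag i (by omega) (by omega) (by omega)
    rcases hA.values i with h0 | h0
    · rw [h0, if_neg]
      rw [this, h0]; norm_num
    · rw [h0, if_pos (this.2 h0)]
  rw [this]

lemma dcard_transpose (m n : ℤ) (f : ℤ → ℤ → ℤ) : dcard n m (fun a b => f b a) = dcard m n f := by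
  unfold dcard
  refine Finset.card_bij' (fun p _ => p.swap) (fun p _ => p.swap) ?_ ?_ ?_ ?_
  · rintro ⟨a, b⟩ h
    simp only [Finset.mem_filter, Finset.mem_product, Prod.swap] at h ⊢
    exact ⟨h.1.symm, h.2⟩
  · rintro ⟨a, b⟩ h
    simp only [Finset.mem_filter, Finset.mem_product, Prod.swap] at h ⊢
    exact ⟨h.1.symm, h.2⟩
  · intros; rfl
  · intros; rfl

/-! ### Loops given by lists of vertices -/

/-- The midpoints of the edges of a closed polygon. -/
def mids (l : List (ℤ × ℤ)) : List (ℤ × ℤ) :=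
  List.zipWith (fun u v => (u.1 + v.1 + 1, u.2 + v.2 + 1)) l (l.rotate 1)

instance (u v : ℤ × ℤ) : Decidable (Nbr u v) := by unfold Nbr; infer_instance

/-- The edges of a closed polygon. -/
def polygon (l : List (ℤ × ℤ)) (a b : ℤ) : Prop := (a, b) ∈ mids l

instance (l : List (ℤ × ℤ)) (a b : ℤ) : Decidable (polygon l a b) := by
  unfold polygon; infer_instance

/-- A computable form of the indicator. -/
def bit (p : Prop) [Decidable p] : ℤ := if p then 1 else 0

lemma ind_eq_bit (p : Prop) [Decidable p] : ind p = bit p := by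
  unfold ind bit; congr

lemma reachable_of_isChain {V : Type*} {G : SimpleGraph V} {u : V} {l : List V}
    (h : List.IsChain G.Adj (u :: l)) : ∀ v ∈ u :: l, G.Reachable u v := by
  induction l generalizing u with
  | nil => simp
  | cons w l ih =>
    rw [List.isChain_cons_cons] at h
    intro v hv
    rcases List.mem_cons.1 hv with rfl | hv
    · exact SimpleGraph.Reachable.refl _
    · exact h.1.reachable.trans (ih h.2 v hv)

/-- The hypotheses are finite checks. The last two clauses of `hbox` name the ends of the edge with
midpoint `p`, so vertices off the list have degree zero. -/
lemma isLoop_polygon {m n : ℤ} {u : ℤ × ℤ} {l : List (ℤ × ℤ)}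
    (hbox : ∀ p ∈ mids (u :: l), 0 < p.1 ∧ p.1 < 2 * m ∧ 0 < p.2 ∧ p.2 < 2 * n ∧
      (p.1 + p.2) % 2 = 1 ∧ ((p.1 - 1) / 2, (p.2 - 1) / 2) ∈ u :: l ∧ (p.1 / 2, p.2 / 2) ∈ u :: l)
    (hdeg : ∀ v ∈ u :: l, bit (polygon (u :: l) (2 * v.1 + 2) (2 * v.2 + 1)) +
      bit (polygon (u :: l) (2 * v.1) (2 * v.2 + 1)) +
      bit (polygon (u :: l) (2 * v.1 + 1) (2 * v.2 + 2)) +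
      bit (polygon (u :: l) (2 * v.1 + 1) (2 * v.2)) = 2)
    (hchain : List.IsChain (fun u' v => Nbr u' v ∧ polygon (u :: l) (u'.1 + v.1 + 1) (u'.2 + v.2 + 1))
      (u :: l)) (hl : l ≠ []) : IsLoop m n (polygon (u :: l)) := by
  have hmem : ∀ v w, (gr (polygon (u :: l))).Adj v w → v ∈ u :: l := by
    rintro ⟨v1, v2⟩ ⟨w1, w2⟩ ⟨hn, h⟩
    obtain ⟨-, -, -, -, -, h1, h2⟩ := hbox _ h
    simp only [Nbr] at hn h1 h2
    have : (v1 = (v1 + w1 + 1 - 1) / 2 ∧ v2 = (v2 + w2 + 1 - 1) / 2) ∨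
        (v1 = (v1 + w1 + 1) / 2 ∧ v2 = (v2 + w2 + 1) / 2) := by omega
    rcases this with ⟨h3, h4⟩ | ⟨h3, h4⟩ <;> rw [h3, h4] <;> assumption
  refine ⟨fun a b h => ?_, fun x y => ?_, fun v w hv hw => ?_, ?_⟩
  · have := hbox _ h
    simp only at this
    omega
  · by_cases hv : (x, y) ∈ u :: l
    · right
      have := hdeg _ hv
      simp only [← ind_eq_bit] at this
      refine Eq.trans ?_ this
      simp only [deg, around]
      rw [show 2 * x + 1 + 1 = 2 * x + 2 by ring, show 2 * y + 1 + 1 = 2 * y + 2 by ring,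
        show 2 * x + 1 - 1 = 2 * x by ring, show 2 * y + 1 - 1 = 2 * y by ring]
    · left
      rw [← ncard_neighborSet_gr]
      have : (gr (polygon (u :: l))).neighborSet (x, y) = ∅ := by
        ext w
        simp only [SimpleGraph.mem_neighborSet, Set.mem_empty_iff_false, iff_false]
        exact fun hw => hv (hmem _ _ hw)
      simp [this]
  · obtain ⟨v', hv⟩ := hv
    obtain ⟨w', hw⟩ := hw
    have := reachable_of_isChain (G := gr (polygon (u :: l))) hchain
    exact (this _ (hmem _ _ hv)).symm.trans (this _ (hmem _ _ hw))
  · cases l with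
    | nil => exact absurd rfl hl
    | cons w l =>
      rw [List.isChain_cons_cons] at hchain
      exact ⟨u, w, hchain.1⟩

lemma IsLoop.mono {m n m' n' : ℤ} {e : ℤ → ℤ → Prop} (h : IsLoop m n e) (hm : m ≤ m')
    (hn : n ≤ n') : IsLoop m' n' e :=
  { h with supp := fun a b hab => by have := h.supp a b hab; omega }

/-- The boundary of a cell. -/
def square : List (ℤ × ℤ) := [(0, 0), (1, 0), (1, 1), (0, 1)]

lemma isLoop_square : IsLoop 2 2 (polygon square) :=
  isLoop_polygon (by decide) (by decide) (by decide) (by decide)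

/-- The first loop of a pair on the `4 × 4` grid. -/
def fourA : List (ℤ × ℤ) := [(0, 0), (1, 0), (2, 0), (2, 1), (3, 1), (3, 2), (3, 3), (2, 3), (1, 3),
  (1, 2), (0, 2), (0, 1)]

/-- The second loop of a pair on the `4 × 4` grid. -/
def fourB : List (ℤ × ℤ) := [(1, 0), (2, 0), (3, 0), (3, 1), (3, 2), (2, 2), (2, 3), (1, 3), (0, 3),
  (0, 2), (0, 1), (1, 1)]

/-- The first loop of a pair on the `6 × 4` grid. -/
def sixA : List (ℤ × ℤ) := [(1, 3), (2, 3), (3, 3), (4, 3), (4, 2), (5, 2), (5, 1), (5, 0), (4, 0),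
  (3, 0), (3, 1), (3, 2), (2, 2), (2, 1), (2, 0), (1, 0), (0, 0), (0, 1), (0, 2), (1, 2)]

/-- The second loop of a pair on the `6 × 4` grid. -/
def sixB : List (ℤ × ℤ) := [(0, 3), (1, 3), (2, 3), (2, 2), (2, 1), (3, 1), (3, 2), (3, 3), (4, 3),
  (5, 3), (5, 2), (5, 1), (4, 1), (4, 0), (3, 0), (2, 0), (1, 0), (1, 1), (0, 1), (0, 2)]

lemma isLoop_fourA : IsLoop 4 4 (polygon fourA) :=
  isLoop_polygon (by decide +kernel) (by decide +kernel) (by decide +kernel) (by decide)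

lemma isLoop_fourB : IsLoop 4 4 (polygon fourB) :=
  isLoop_polygon (by decide +kernel) (by decide +kernel) (by decide +kernel) (by decide)

lemma isLoop_sixA : IsLoop 6 4 (polygon sixA) :=
  isLoop_polygon (by decide +kernel) (by decide +kernel) (by decide +kernel) (by decide)

lemma isLoop_sixB : IsLoop 6 4 (polygon sixB) :=
  isLoop_polygon (by decide +kernel) (by decide +kernel) (by decide +kernel) (by decide)

lemma dif_polygon (l l' : List (ℤ × ℤ)) (a b : ℤ) :
    dif (polygon l) (polygon l') a b = bit (polygon l a b) - bit (polygon l' a b) := by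
  rw [dif, ind_eq_bit, ind_eq_bit]

lemma pair_polygon {m n : ℤ} {l l' : List (ℤ × ℤ)} (h : IsLoop m n (polygon l))
    (h' : IsLoop m n (polygon l'))
    (hc : ∀ x ∈ Finset.Ioo 0 m, ∀ y ∈ Finset.Ioo 0 n,
      around (fun a b => bit (polygon l a b) - bit (polygon l' a b)) (2 * x) (2 * y) = 0) :
    Pair m n (dif (polygon l) (polygon l')) (fun a b => polygon l a b ∧ polygon l' a b) := by
  refine ⟨_, _, h, h', rfl, fun x y hx hx' hy hy' => ?_, fun a b hab => hab⟩
  have := hc x (Finset.mem_Ioo.2 ⟨hx, hx'⟩) y (Finset.mem_Ioo.2 ⟨hy, hy'⟩)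
  simp only [around, dif_polygon] at this ⊢
  exact this

lemma pair_four : Pair 4 4 (dif (polygon fourA) (polygon fourB))
    (fun a b => polygon fourA a b ∧ polygon fourB a b) :=
  pair_polygon isLoop_fourA isLoop_fourB (by decide +kernel)

lemma pair_six : Pair 6 4 (dif (polygon sixA) (polygon sixB))
    (fun a b => polygon sixA a b ∧ polygon sixB a b) :=
  pair_polygon isLoop_sixA isLoop_sixB (by decide +kernel)

/-- This column makes the profile symmetric about `q = 2`, and copies in an array inherit the
symmetry. -/
lemma dif_four_four (b : ℤ) : dif (polygon fourA) (polygon fourB) 4 b = 0 := by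
  by_cases hb : b ≤ 0 ∨ 8 ≤ b
  · exact pair_four.eq_zero (by omega)
  · have : ∀ b ∈ Finset.Ioo (0 : ℤ) 8, bit (polygon fourA 4 b) - bit (polygon fourB 4 b) = 0 := by
      decide +kernel
    rw [dif_polygon]
    exact this b (Finset.mem_Ioo.2 (by omega))

lemma dif_six_four (b : ℤ) : dif (polygon sixA) (polygon sixB) 4 b = 0 := by
  by_cases hb : b ≤ 0 ∨ 8 ≤ b
  · exact pair_six.eq_zero (by omega)
  · have : ∀ b ∈ Finset.Ioo (0 : ℤ) 8, bit (polygon sixA 4 b) - bit (polygon sixB 4 b) = 0 := by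
      decide +kernel
    rw [dif_polygon]
    exact this b (Finset.mem_Ioo.2 (by omega))

/-- This is the matching condition for gluing a `4 × 4` pair, with its loops exchanged, to the right
of the `6 × 4` pair. -/
lemma dif_six_add_dif_four (b : ℤ) : dif (polygon sixA) (polygon sixB) 11 b +
    -dif (polygon fourA) (polygon fourB) 1 b = 0 := by
  by_cases hb : b ≤ 0 ∨ 8 ≤ b
  · rw [pair_six.eq_zero (by omega), pair_four.eq_zero (by omega)]; rfl
  · have : ∀ b ∈ Finset.Ioo (0 : ℤ) 8, bit (polygon sixA 11 b) - bit (polygon sixB 11 b) +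
        -(bit (polygon fourA 1 b) - bit (polygon fourB 1 b)) = 0 := by
      decide +kernel
    rw [dif_polygon, dif_polygon]
    exact this b (Finset.mem_Ioo.2 (by omega))

/-- With `q = 2` the profile starts with 0 and 1; it is balanced, so nothing is lost from `m * n`.
-/
lemma Pair.dcard_eq_mul {m n : ℕ} {f : ℤ → ℤ → ℤ} {K : ℤ → ℤ → Prop} (h : Pair m n f K)
    (hm : m % 2 = 0) (hn : n % 2 = 0) (hm0 : 0 < m) (hn0 : 0 < n) (hz : ∀ b, f 4 b = 0)
    (h1 : f 2 1 ≠ 0) : (dcard m n f : ℤ) = m * n := by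
  have hm' : m = 2 * (m / 2) := by omega
  have hn' : n = 2 * (n / 2) := by omega
  have h0 : f 1 0 = 0 := h.eq_zero (by omega)
  rw [h.dcard_eq hm' hn' hm0 hn0 hz (k := 1)]
  · conv_rhs => rw [hm', hn']
    push_cast
    ring
  · rw [Finset.sum_range_succ, Finset.sum_range_one]
    norm_num [h0, h1]

/-! ### Attained sizes from the `4 × 4` and `6 × 4` pairs. -/

/-- There are two cycles with equal signatures whose difference has size `s`. -/
def Attained (m n : ℕ) (s : ℤ) : Prop := ∃ f K, Pair m n f K ∧ (dcard m n f : ℤ) = s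

lemma Attained.transpose {m n : ℕ} {s : ℤ} (h : Attained m n s) : Attained n m s := by
  obtain ⟨f, K, h1, h2⟩ := h
  exact ⟨_, _, h1.transpose, by rw [dcard_transpose]; exact h2⟩

lemma attained_of_four_dvd {m n : ℕ} (hm : 4 ∣ m) (hn : 4 ∣ n) (hm0 : 0 < m) (hn0 : 0 < n) :
    Attained m n (m * n) := by
  obtain ⟨k, rfl⟩ : ∃ k, m = (k + 1) * 4 := ⟨m / 4 - 1, by omega⟩
  obtain ⟨l, rfl⟩ : ∃ l, n = (l + 1) * 4 := ⟨n / 4 - 1, by omega⟩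
  obtain ⟨f, K, h1, h2, h3⟩ := pair_four.array (a := 4) (a' := 4) (c := 4) (c' := 4) (by norm_num)
    (by norm_num) k l (by decide) (by decide) (by decide) (by decide)
  have h1' : Pair ((k + 1) * 4 : ℕ) ((l + 1) * 4 : ℕ) f K := by
    rw [Nat.cast_mul, Nat.cast_mul]; exact h1
  refine ⟨f, K, h1', h1'.dcard_eq_mul (by omega) (by omega) (by omega) (by omega)
    (h3 4 (by norm_num) dif_four_four) ?_⟩
  rw [h2 2 1 (by norm_num) (by norm_num), dif_polygon]
  decide

lemma attained_of_mod_four_eq_two {m n : ℕ} (hm : m % 4 = 2) (hn : 4 ∣ n) (hm0 : 4 ≤ m)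
    (hn0 : 0 < n) : Attained m n (m * n) := by
  obtain ⟨k, rfl⟩ : ∃ k, m = 6 + k * 4 := ⟨(m - 6) / 4, by omega⟩
  obtain ⟨l, rfl⟩ : ∃ l, n = (l + 1) * 4 := ⟨n / 4 - 1, by omega⟩
  -- One block of width 6 absorbs the residue 2 modulo 4, and `k` blocks of width 4 follow. The
  -- horizontal edges at `(4, 1)` and `(4, 7)` stay common for vertical stacking.
  have hrow : ∃ f K, Pair (6 + k * 4 : ℕ) 4 f K ∧
      (∀ a b, a ≤ 11 → f a b = dif (polygon sixA) (polygon sixB) a b) ∧ K 4 1 ∧ K 4 7 := by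
    rcases k with _ | k
    · exact ⟨_, _, pair_six, fun _ _ _ => rfl, by decide, by decide⟩
    · obtain ⟨f, K, h1, h2, -, -, h5⟩ := pair_four.swap.row (c := 4) (c' := 4) (by norm_num) k
        (by decide) (by decide)
      have := pair_six.join h1 (c := 4) (by decide) h5 (fun b => by
        rw [h2 _ _ (by norm_num)]; exact dif_six_add_dif_four b)
      refine ⟨_, _, by push_cast at this ⊢; exact this, fun a b ha => ?_, by decide, by decide⟩
      rw [h1.eq_zero (by omega), add_zero]
  obtain ⟨f₀, K₀, h0, h01, h02, h03⟩ := hrow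
  obtain ⟨f, K, h1, h2, h3, -⟩ := h0.transpose.row (c := 4) (c' := 4) (by norm_num) l h02 h03
  have h1' : Pair (6 + k * 4 : ℕ) ((l + 1) * 4 : ℕ) (fun a b => f b a) (fun a b => K b a) := by
    rw [Nat.cast_mul]; exact h1.transpose
  refine ⟨_, _, h1', h1'.dcard_eq_mul (by omega) (by omega) (by omega) (by omega)
    (h3 4 (fun b => by rw [h01 _ _ (by norm_num)]; exact dif_six_four b)) ?_⟩
  rw [h2 1 2 (by norm_num), h01 _ _ (by norm_num), dif_polygon]
  decide

/-! ### Pairs of loops on odd square grids -/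

/-- The horizontal edges of the lower part. -/
def lowH (c x y : ℤ) : Prop :=
  0 ≤ x ∧ 0 ≤ y ∧ ((x % 2 = 0 ∧ (x / 2 + y) % 2 = c) ∨ (y = 0 ∧ x % 4 = 1) ∨
    ((y = 1 ∨ y = 2) ∧ x % 4 = 3))

/-- The vertical edges of the lower part. -/
def lowV (c x y : ℤ) : Prop :=
  0 ≤ x ∧ 0 ≤ y ∧ ((y % 2 = 0 ∧ (y / 2 + x) % 2 = c) ∨
    (y % 2 = 1 ∧ (x / 2 + y / 2 + x) % 2 = 0 ∧ (3 ≤ y ∨ x = 0)))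

/-- The horizontal edges of the upper part, after a rotation. -/
def upH (c x y : ℤ) : Prop :=
  0 ≤ x ∧ 0 ≤ y ∧ ((x % 2 = 0 ∧ (x / 2 + y) % 2 = 1 - c) ∨ (y = 0 ∧ x % 4 = 1))

/-- The vertical edges of the upper part, after a rotation. -/
def upV (c x y : ℤ) : Prop :=
  0 ≤ x ∧ 0 ≤ y ∧ ((y % 2 = 0 ∧ (y / 2 + x) % 2 = 1 - c) ∨
    (y % 2 = 1 ∧ (x / 2 + y / 2 + x) % 2 = 0))

instance (c x y : ℤ) : Decidable (lowH c x y) := by unfold lowH; infer_instance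

instance (c x y : ℤ) : Decidable (lowV c x y) := by unfold lowV; infer_instance

instance (c x y : ℤ) : Decidable (upH c x y) := by unfold upH; infer_instance

instance (c x y : ℤ) : Decidable (upV c x y) := by unfold upV; infer_instance

/-- Two coordinates which the edges in the lower and the upper parts do not distinguish. -/
def Sim (x x' : ℤ) : Prop := x % 4 = x' % 4 ∧ (x = x' ∨ (3 ≤ x ∧ 3 ≤ x'))

/-- The edge rules see only the residue modulo 4 and whether a coordinate is one of the few small
values, so a window of eight values represents every coordinate together with its neighbours. -/
lemma exists_sim {x : ℤ} (hx : 0 ≤ x) :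
    ∃ x' ∈ Finset.Ico (0 : ℤ) 8, Sim x x' ∧ Sim (x - 1) (x' - 1) ∧ Sim (x + 1) (x' + 1) := by
  by_cases h : x < 4
  · exact ⟨x, by rw [Finset.mem_Ico]; omega, by unfold Sim; omega⟩
  · exact ⟨x % 4 + 4, by rw [Finset.mem_Ico]; omega, by unfold Sim; omega⟩

section
variable {c x x' y y' : ℤ}

lemma lowH_congr (c : ℤ) (hx : Sim x x') (hy : Sim y y') :
    ind (lowH c x y) = bit (lowH c x' y') := by
  rw [← ind_eq_bit]
  refine ind_congr ?_
  unfold Sim at hx hy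
  have h1 : (x / 2 + y) % 2 = (x' / 2 + y') % 2 := by omega
  have h2 : x % 2 = x' % 2 := by omega
  have h3 : 0 ≤ x ↔ 0 ≤ x' := by omega
  have h4 : 0 ≤ y ↔ 0 ≤ y' := by omega
  have h5 : y = 0 ↔ y' = 0 := by omega
  have h6 : (y = 1 ∨ y = 2) ↔ (y' = 1 ∨ y' = 2) := by omega
  unfold lowH
  rw [h1, h2, h3, h4, h5, h6, hx.1]

lemma lowV_congr (c : ℤ) (hx : Sim x x') (hy : Sim y y') :
    ind (lowV c x y) = bit (lowV c x' y') := by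
  rw [← ind_eq_bit]
  refine ind_congr ?_
  unfold Sim at hx hy
  have h1 : (y / 2 + x) % 2 = (y' / 2 + x') % 2 := by omega
  have h2 : (x / 2 + y / 2 + x) % 2 = (x' / 2 + y' / 2 + x') % 2 := by omega
  have h3 : 0 ≤ x ↔ 0 ≤ x' := by omega
  have h4 : 0 ≤ y ↔ 0 ≤ y' := by omega
  have h5 : x = 0 ↔ x' = 0 := by omega
  have h6 : 3 ≤ y ↔ 3 ≤ y' := by omega
  have h7 : y % 2 = y' % 2 := by omega
  unfold lowV
  rw [h1, h2, h3, h4, h5, h6, h7]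

lemma upH_congr (c : ℤ) (hx : Sim x x') (hy : Sim y y') :
    ind (upH c x y) = bit (upH c x' y') := by
  rw [← ind_eq_bit]
  refine ind_congr ?_
  have h1 : (x / 2 + y) % 2 = (x' / 2 + y') % 2 := by have := hx.1; have := hy.1; omega
  unfold upH
  rw [h1]
  unfold Sim at hx hy
  omega

lemma upV_congr (c : ℤ) (hx : Sim x x') (hy : Sim y y') :
    ind (upV c x y) = bit (upV c x' y') := by
  rw [← ind_eq_bit]
  refine ind_congr ?_
  have h1 : (y / 2 + x) % 2 = (y' / 2 + x') % 2 := by have := hx.1; have := hy.1; omega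
  have h2 : (x / 2 + y / 2 + x) % 2 = (x' / 2 + y' / 2 + x') % 2 := by
    have := hx.1; have := hy.1; omega
  unfold upV
  rw [h1, h2]
  unfold Sim at hx hy
  omega

lemma low_deg (hc : c = 0 ∨ c = 1) (hx : 0 ≤ x) (hy : 0 ≤ y) :
    ind (lowH c x y) + ind (lowH c (x - 1) y) + ind (lowV c x y) + ind (lowV c x (y - 1)) = 0 ∨
    ind (lowH c x y) + ind (lowH c (x - 1) y) + ind (lowV c x y) + ind (lowV c x (y - 1)) = 2 := by
  obtain ⟨x', mx, sx, sx', -⟩ := exists_sim hx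
  obtain ⟨y', my, sy, sy', -⟩ := exists_sim hy
  rw [lowH_congr c sx sy, lowH_congr c sx' sy, lowV_congr c sx sy, lowV_congr c sx sy']
  have key : ∀ c ∈ ({0, 1} : Finset ℤ), ∀ x ∈ Finset.Ico (0 : ℤ) 8, ∀ y ∈ Finset.Ico (0 : ℤ) 8,
    bit (lowH c x y) + bit (lowH c (x - 1) y) + bit (lowV c x y) + bit (lowV c x (y - 1)) = 0 ∨
    bit (lowH c x y) + bit (lowH c (x - 1) y) + bit (lowV c x y) + bit (lowV c x (y - 1)) = 2 := by
    decide +kernel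
  exact key c (by simpa using hc) x' mx y' my

lemma up_deg (hc : c = 0 ∨ c = 1) (hx : 0 ≤ x) (hy : 0 ≤ y) :
    ind (upH c (x - 1) y) + ind (upH c x y) + ind (upV c x (y - 1)) + ind (upV c x y) = 0 ∨
    ind (upH c (x - 1) y) + ind (upH c x y) + ind (upV c x (y - 1)) + ind (upV c x y) = 2 := by
  obtain ⟨x', mx, sx, sx', -⟩ := exists_sim hx
  obtain ⟨y', my, sy, sy', -⟩ := exists_sim hy
  rw [upH_congr c sx sy, upH_congr c sx' sy, upV_congr c sx sy, upV_congr c sx sy']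
  have key : ∀ c ∈ ({0, 1} : Finset ℤ), ∀ x ∈ Finset.Ico (0 : ℤ) 8, ∀ y ∈ Finset.Ico (0 : ℤ) 8,
    bit (upH c (x - 1) y) + bit (upH c x y) + bit (upV c x (y - 1)) + bit (upV c x y) = 0 ∨
    bit (upH c (x - 1) y) + bit (upH c x y) + bit (upV c x (y - 1)) + bit (upV c x y) = 2 := by
    decide +kernel
  exact key c (by simpa using hc) x' mx y' my

/-- A vertex on the antidiagonal takes two candidate edges from each part; there `2 * N - x = y`, so
the rotation exchanges its coordinates. -/
lemma diag_deg (hc : c = 0 ∨ c = 1) (hx : 0 ≤ x) (hy : 0 ≤ y) (hxy : (x + y) % 2 = 0) :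
    ind (upH c (y - 1) x) + ind (lowH c (x - 1) y) + ind (upV c y (x - 1)) +
      ind (lowV c x (y - 1)) = 0 ∨
    ind (upH c (y - 1) x) + ind (lowH c (x - 1) y) + ind (upV c y (x - 1)) +
      ind (lowV c x (y - 1)) = 2 := by
  obtain ⟨x', mx, sx, sx', -⟩ := exists_sim hx
  obtain ⟨y', my, sy, sy', -⟩ := exists_sim hy
  rw [upH_congr c sy' sx, lowH_congr c sx' sy, upV_congr c sy sx', lowV_congr c sx sy']
  have key : ∀ c ∈ ({0, 1} : Finset ℤ), ∀ x ∈ Finset.Ico (0 : ℤ) 8, ∀ y ∈ Finset.Ico (0 : ℤ) 8,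
    (x + y) % 2 = 0 →
    bit (upH c (y - 1) x) + bit (lowH c (x - 1) y) + bit (upV c y (x - 1)) +
      bit (lowV c x (y - 1)) = 0 ∨
    bit (upH c (y - 1) x) + bit (lowH c (x - 1) y) + bit (upV c y (x - 1)) +
      bit (lowV c x (y - 1)) = 2 := by
    decide +kernel
  exact key c (by simpa using hc) x' mx y' my (by have := sx.1; have := sy.1; omega)

lemma low_cell (hx : 0 ≤ x) (hy : 0 ≤ y) :
    ind (lowH 0 x y) + ind (lowH 0 x (y + 1)) + ind (lowV 0 x y) + ind (lowV 0 (x + 1) y) =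
    ind (lowH 1 x y) + ind (lowH 1 x (y + 1)) + ind (lowV 1 x y) + ind (lowV 1 (x + 1) y) := by
  obtain ⟨x', mx, sx, -, sx'⟩ := exists_sim hx
  obtain ⟨y', my, sy, -, sy'⟩ := exists_sim hy
  simp only [lowH_congr _ sx sy, lowH_congr _ sx sy', lowV_congr _ sx sy, lowV_congr _ sx' sy]
  have key : ∀ x ∈ Finset.Ico (0 : ℤ) 8, ∀ y ∈ Finset.Ico (0 : ℤ) 8,
    bit (lowH 0 x y) + bit (lowH 0 x (y + 1)) + bit (lowV 0 x y) + bit (lowV 0 (x + 1) y) =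
    bit (lowH 1 x y) + bit (lowH 1 x (y + 1)) + bit (lowV 1 x y) + bit (lowV 1 (x + 1) y) := by
    decide +kernel
  exact key x' mx y' my

lemma up_cell (hx : 0 ≤ x) (hy : 0 ≤ y) :
    ind (upH 0 x (y + 1)) + ind (upH 0 x y) + ind (upV 0 (x + 1) y) + ind (upV 0 x y) =
    ind (upH 1 x (y + 1)) + ind (upH 1 x y) + ind (upV 1 (x + 1) y) + ind (upV 1 x y) := by
  obtain ⟨x', mx, sx, -, sx'⟩ := exists_sim hx
  obtain ⟨y', my, sy, -, sy'⟩ := exists_sim hy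
  simp only [upH_congr _ sx sy, upH_congr _ sx sy', upV_congr _ sx sy, upV_congr _ sx' sy]
  have key : ∀ x ∈ Finset.Ico (0 : ℤ) 8, ∀ y ∈ Finset.Ico (0 : ℤ) 8,
    bit (upH 0 x (y + 1)) + bit (upH 0 x y) + bit (upV 0 (x + 1) y) + bit (upV 0 x y) =
    bit (upH 1 x (y + 1)) + bit (upH 1 x y) + bit (upV 1 (x + 1) y) + bit (upV 1 x y) := by
    decide +kernel
  exact key x' mx y' my

lemma diag_cell (hx : 0 ≤ x) (hy : 0 ≤ y) (hxy : (x + y) % 2 = 1) :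
    ind (lowH 0 x y) + ind (upH 0 y x) + ind (lowV 0 x y) + ind (upV 0 y x) =
    ind (lowH 1 x y) + ind (upH 1 y x) + ind (lowV 1 x y) + ind (upV 1 y x) := by
  obtain ⟨x', mx, sx, -⟩ := exists_sim hx
  obtain ⟨y', my, sy, -⟩ := exists_sim hy
  simp only [lowH_congr _ sx sy, upH_congr _ sy sx, lowV_congr _ sx sy, upV_congr _ sy sx]
  have key : ∀ x ∈ Finset.Ico (0 : ℤ) 8, ∀ y ∈ Finset.Ico (0 : ℤ) 8, (x + y) % 2 = 1 →
    bit (lowH 0 x y) + bit (upH 0 y x) + bit (lowV 0 x y) + bit (upV 0 y x) =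
    bit (lowH 1 x y) + bit (upH 1 y x) + bit (lowV 1 x y) + bit (upV 1 y x) := by
    decide +kernel
  exact key x' mx y' my (by have := sx.1; have := sy.1; omega)

end

/-- The horizontal edges of a loop on the odd grid with `2 * N + 1` vertices on a side. -/
def oddH (N c x y : ℤ) : Prop :=
  (x + y ≤ 2 * N - 1 ∧ lowH c x y) ∨ (2 * N ≤ x + y ∧ upH c (2 * N - 1 - x) (2 * N - y))

/-- The vertical edges of a loop on the odd grid. -/
def oddV (N c x y : ℤ) : Prop :=
  (x + y ≤ 2 * N - 1 ∧ lowV c x y) ∨ (2 * N ≤ x + y ∧ upV c (2 * N - x) (2 * N - 1 - y))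

/-- The edges of a loop on the odd grid. -/
def oddE (N c a b : ℤ) : Prop :=
  (a % 2 = 0 ∧ b % 2 = 1 ∧ oddH N c (a / 2 - 1) (b / 2)) ∨
    (a % 2 = 1 ∧ b % 2 = 0 ∧ oddV N c (a / 2) (b / 2 - 1))

section
variable {N c : ℤ}

lemma oddE_right {x y : ℤ} : oddE N c (2 * x + 2) (2 * y + 1) ↔ oddH N c x y := by
  unfold oddE
  rw [show (2 * x + 2) / 2 - 1 = x by omega, show (2 * y + 1) / 2 = y by omega]
  constructor
  · rintro (⟨-, -, h⟩ | ⟨h, -⟩)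
    · exact h
    · omega
  · exact fun h => Or.inl ⟨by omega, by omega, h⟩

lemma oddE_up {x y : ℤ} : oddE N c (2 * x + 1) (2 * y + 2) ↔ oddV N c x y := by
  unfold oddE
  rw [show (2 * y + 2) / 2 - 1 = y by omega, show (2 * x + 1) / 2 = x by omega]
  constructor
  · rintro (⟨h, -⟩ | ⟨-, -, h⟩)
    · omega
    · exact h
  · exact fun h => Or.inr ⟨by omega, by omega, h⟩

lemma oddE_supp : Supp (2 * N + 1) (2 * N + 1) (oddE N c) := by
  rintro a b (⟨h1, h2, ⟨h3, h4, h5, -⟩ | ⟨h3, h4, h5, -⟩⟩ | ⟨h1, h2, ⟨h3, h4, h5, -⟩ | ⟨h3, h4, h5, -⟩⟩) <;>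
    omega

lemma ind_oddH_low {x y : ℤ} (h : x + y ≤ 2 * N - 1) : ind (oddH N c x y) = ind (lowH c x y) :=
  ind_congr ⟨fun h' => h'.elim (fun h => h.2) (fun h => by omega), fun h' => Or.inl ⟨h, h'⟩⟩

lemma ind_oddV_low {x y : ℤ} (h : x + y ≤ 2 * N - 1) : ind (oddV N c x y) = ind (lowV c x y) :=
  ind_congr ⟨fun h' => h'.elim (fun h => h.2) (fun h => by omega), fun h' => Or.inl ⟨h, h'⟩⟩

lemma ind_oddH_up {x y X Y : ℤ} (h : 2 * N ≤ x + y) (hX : 2 * N - 1 - x = X) (hY : 2 * N - y = Y) :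
    ind (oddH N c x y) = ind (upH c X Y) := by
  subst hX hY
  exact ind_congr ⟨fun h' => h'.elim (fun h => by omega) (fun h => h.2), fun h' => Or.inr ⟨h, h'⟩⟩

lemma ind_oddV_up {x y X Y : ℤ} (h : 2 * N ≤ x + y) (hX : 2 * N - x = X) (hY : 2 * N - 1 - y = Y) :
    ind (oddV N c x y) = ind (upV c X Y) := by
  subst hX hY
  exact ind_congr ⟨fun h' => h'.elim (fun h => by omega) (fun h => h.2), fun h' => Or.inr ⟨h, h'⟩⟩

lemma oddE_deg (hc : c = 0 ∨ c = 1) (x y : ℤ) :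
    deg (oddE N c) (2 * x + 1) (2 * y + 1) = 0 ∨ deg (oddE N c) (2 * x + 1) (2 * y + 1) = 2 := by
  have hd : deg (oddE N c) (2 * x + 1) (2 * y + 1) = ind (oddH N c x y) + ind (oddH N c (x - 1) y) +
      ind (oddV N c x y) + ind (oddV N c x (y - 1)) := by
    simp only [deg, around]
    rw [show 2 * x + 1 + 1 = 2 * x + 2 by ring, show 2 * y + 1 + 1 = 2 * y + 2 by ring,
      show 2 * x + 1 - 1 = 2 * (x - 1) + 2 by ring, show 2 * y + 1 - 1 = 2 * (y - 1) + 2 by ring,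
      ind_congr oddE_right, ind_congr oddE_right, ind_congr oddE_up, ind_congr oddE_up]
  rw [hd]
  by_cases hbox : 0 ≤ x ∧ x ≤ 2 * N ∧ 0 ≤ y ∧ y ≤ 2 * N
  · rcases lt_trichotomy (x + y) (2 * N) with h | h | h
    · rw [ind_oddH_low (by omega), ind_oddH_low (by omega), ind_oddV_low (by omega),
        ind_oddV_low (by omega)]
      exact low_deg hc (by omega) (by omega)
    · rw [ind_oddH_up (by omega) (X := y - 1) (Y := x) (by omega) (by omega),
        ind_oddH_low (by omega), ind_oddV_up (by omega) (X := y) (Y := x - 1) (by omega) (by omega),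
        ind_oddV_low (by omega)]
      exact diag_deg hc (by omega) (by omega) (by omega)
    · rw [ind_oddH_up (by omega) (X := 2 * N - x - 1) (Y := 2 * N - y) (by omega) (by omega),
        ind_oddH_up (by omega) (X := 2 * N - x) (Y := 2 * N - y) (by omega) (by omega),
        ind_oddV_up (by omega) (X := 2 * N - x) (Y := 2 * N - y - 1) (by omega) (by omega),
        ind_oddV_up (by omega) (X := 2 * N - x) (Y := 2 * N - y) (by omega) (by omega)]
      exact up_deg hc (by omega) (by omega)
  · left
    have z1 : ∀ x' y', y' = y → x' = x ∨ x' = x - 1 → ind (oddH N c x' y') = 0 := by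
      intro x' y' h1 h2
      refine ind_false fun h => ?_
      have := oddE_supp _ _ (oddE_right.2 h)
      omega
    have z2 : ∀ x' y', x' = x → y' = y ∨ y' = y - 1 → ind (oddV N c x' y') = 0 := by
      intro x' y' h1 h2
      refine ind_false fun h => ?_
      have := oddE_supp _ _ (oddE_up.2 h)
      omega
    rw [z1 _ _ (by omega) (by omega), z1 _ _ (by omega) (by omega), z2 _ _ (by omega) (by omega),
      z2 _ _ (by omega) (by omega)]
    rfl

lemma oddE_cell {x y : ℤ} (hx : 0 < x) (hx' : x < 2 * N + 1) (hy : 0 < y) (hy' : y < 2 * N + 1) :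
    around (dif (oddE N 0) (oddE N 1)) (2 * x) (2 * y) = 0 := by
  obtain ⟨x, rfl⟩ : ∃ z, x = z + 1 := ⟨x - 1, by ring⟩
  obtain ⟨y, rfl⟩ : ∃ z, y = z + 1 := ⟨y - 1, by ring⟩
  have hd : ∀ c, deg (oddE N c) (2 * (x + 1)) (2 * (y + 1)) = ind (oddH N c x y) +
      ind (oddH N c x (y + 1)) + ind (oddV N c x y) + ind (oddV N c (x + 1) y) := by
    intro c
    simp only [deg, around]
    rw [show 2 * (x + 1) - 1 = 2 * x + 1 by ring, show 2 * (y + 1) - 1 = 2 * y + 1 by ring,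
      show (2 * (x + 1)) = 2 * x + 2 by ring, show (2 * (y + 1)) = 2 * y + 2 by ring,
      show 2 * x + 2 + 1 = 2 * (x + 1) + 1 by ring, show 2 * y + 2 + 1 = 2 * (y + 1) + 1 by ring,
      ind_congr oddE_right, ind_congr oddE_right, ind_congr oddE_up, ind_congr oddE_up]
    ring
  rw [around_dif, sub_eq_zero, hd, hd]
  rcases lt_trichotomy (x + y) (2 * N - 1) with h | h | h
  · simp only [ind_oddH_low (show x + y ≤ 2 * N - 1 by omega),
      ind_oddH_low (show x + (y + 1) ≤ 2 * N - 1 by omega),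
      ind_oddV_low (show x + y ≤ 2 * N - 1 by omega),
      ind_oddV_low (show x + 1 + y ≤ 2 * N - 1 by omega)]
    exact low_cell (by omega) (by omega)
  · simp only [ind_oddH_low (show x + y ≤ 2 * N - 1 by omega),
      ind_oddH_up (show 2 * N ≤ x + (y + 1) by omega) (X := y) (Y := x) (by omega) (by omega),
      ind_oddV_low (show x + y ≤ 2 * N - 1 by omega),
      ind_oddV_up (show 2 * N ≤ x + 1 + y by omega) (X := y) (Y := x) (by omega) (by omega)]
    exact diag_cell (by omega) (by omega) (by omega)
  · simp only [ind_oddH_up (show 2 * N ≤ x + y by omega) (X := 2 * N - 1 - x)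
        (Y := 2 * N - 1 - y + 1) (by omega) (by omega),
      ind_oddH_up (show 2 * N ≤ x + (y + 1) by omega) (X := 2 * N - 1 - x) (Y := 2 * N - 1 - y)
        (by omega) (by omega),
      ind_oddV_up (show 2 * N ≤ x + y by omega) (X := 2 * N - 1 - x + 1) (Y := 2 * N - 1 - y)
        (by omega) (by omega),
      ind_oddV_up (show 2 * N ≤ x + 1 + y by omega) (X := 2 * N - 1 - x) (Y := 2 * N - 1 - y)
        (by omega) (by omega)]
    exact up_cell (by omega) (by omega)

end

/-! ### Connectedness on the odd grid -/

/-- Two vertices are connected by edges of the loop on the odd grid. -/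
def Conn (N c x y x' y' : ℤ) : Prop := (gr (oddE N c)).Reachable (x, y) (x', y')

section
variable {N c : ℤ}

lemma Conn.symm {x y x' y' : ℤ} (h : Conn N c x y x' y') : Conn N c x' y' x y :=
  SimpleGraph.Reachable.symm h

lemma Conn.trans {x y x' y' x'' y'' : ℤ} (h : Conn N c x y x' y') (h' : Conn N c x' y' x'' y'') :
    Conn N c x y x'' y'' :=
  SimpleGraph.Reachable.trans h h'

lemma Conn.refl (x y : ℤ) : Conn N c x y x y := SimpleGraph.Reachable.refl _

lemma conn_lowH {x y x' : ℤ} (h : lowH c x y) (hs : x + y ≤ 2 * N - 1) (hx : x' = x + 1) :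
    Conn N c x y x' y := by
  subst hx
  exact (gr_right.2 (oddE_right.2 (Or.inl ⟨hs, h⟩))).reachable

lemma conn_lowV {x y y' : ℤ} (h : lowV c x y) (hs : x + y ≤ 2 * N - 1) (hy : y' = y + 1) :
    Conn N c x y x y' := by
  subst hy
  exact (gr_up.2 (oddE_up.2 (Or.inl ⟨hs, h⟩))).reachable

/-- The same after a rotation of the grid. -/
def Conn' (N c x y x' y' : ℤ) : Prop := Conn N c (2 * N - x) (2 * N - y) (2 * N - x') (2 * N - y')

lemma Conn'.symm {x y x' y' : ℤ} (h : Conn' N c x y x' y') : Conn' N c x' y' x y :=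
  SimpleGraph.Reachable.symm h

lemma Conn'.trans {x y x' y' x'' y'' : ℤ} (h : Conn' N c x y x' y')
    (h' : Conn' N c x' y' x'' y'') : Conn' N c x y x'' y'' :=
  SimpleGraph.Reachable.trans h h'

lemma conn_upH {x y x' : ℤ} (h : upH c x y) (hs : x + y ≤ 2 * N - 1) (hx : x' = x + 1) :
    Conn' N c x y x' y := by
  subst hx
  have : oddH N c (2 * N - (x + 1)) (2 * N - y) := Or.inr ⟨by omega, by
    rwa [show 2 * N - 1 - (2 * N - (x + 1)) = x by ring, show 2 * N - (2 * N - y) = y by ring]⟩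
  have h2 : Conn N c _ _ _ _ := (gr_right.2 (oddE_right.2 this)).reachable.symm
  rwa [show 2 * N - (x + 1) + 1 = 2 * N - x by ring] at h2

lemma conn_upV {x y y' : ℤ} (h : upV c x y) (hs : x + y ≤ 2 * N - 1) (hy : y' = y + 1) :
    Conn' N c x y x y' := by
  subst hy
  have : oddV N c (2 * N - x) (2 * N - (y + 1)) := Or.inr ⟨by omega, by
    rwa [show 2 * N - (2 * N - x) = x by ring, show 2 * N - 1 - (2 * N - (y + 1)) = y by ring]⟩
  have h2 : Conn N c _ _ _ _ := (gr_up.2 (oddE_up.2 this)).reachable.symm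
  rwa [show 2 * N - (y + 1) + 1 = 2 * N - y by ring] at h2

/-- The opposite corners of a square that are connected in both loops. -/
lemma conn_square (hc : c = 0 ∨ c = 1) {X Y : ℤ} (hX : 0 ≤ X) (hY : 0 ≤ Y) (hXY : X + Y ≤ N - 1) :
    Conn N c (2 * X + 1 - (X + Y) % 2) (2 * Y) (2 * X + (X + Y) % 2) (2 * Y + 1) := by
  have h1 : ∀ y, (X + y) % 2 = c → y = 2 * Y ∨ y = 2 * Y + 1 →
      Conn N c (2 * X) y (2 * X + 1) y := fun y h hy =>
    conn_lowH ⟨by omega, by omega, Or.inl ⟨by omega, by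
      rw [show 2 * X / 2 = X by omega]; exact h⟩⟩ (by omega) rfl
  have h2 : ∀ x, (Y + x) % 2 = c → x = 2 * X ∨ x = 2 * X + 1 →
      Conn N c x (2 * Y) x (2 * Y + 1) := fun x h hx =>
    conn_lowV ⟨by omega, by omega, Or.inl ⟨by omega, by
      rw [show 2 * Y / 2 = Y by omega]; exact h⟩⟩ (by omega) rfl
  -- The parity of `X + Y` decides which diagonal of the block is joined; comparing `X` with `c`
  -- decides which of the two remaining corners the path visits.
  rcases Int.emod_two_eq_zero_or_one (X + Y) with hp | hp <;> rw [hp]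
  · rw [sub_zero, add_zero]
    by_cases h : X % 2 = c
    · exact (h1 _ (by omega) (Or.inl rfl)).symm.trans (h2 _ (by omega) (Or.inl rfl))
    · exact (h2 _ (by omega) (Or.inr rfl)).trans (h1 _ (by omega) (Or.inr rfl)).symm
  · rw [add_sub_cancel_right]
    by_cases h : X % 2 = c
    · exact (h1 _ (by omega) (Or.inl rfl)).trans (h2 _ (by omega) (Or.inr rfl))
    · exact (h2 _ (by omega) (Or.inl rfl)).trans (h1 _ (by omega) (Or.inr rfl))

lemma conn_square' (hc : c = 0 ∨ c = 1) {X Y : ℤ} (hX : 0 ≤ X) (hY : 0 ≤ Y) (hXY : X + Y ≤ N - 1) :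
    Conn' N c (2 * X + 1 - (X + Y) % 2) (2 * Y) (2 * X + (X + Y) % 2) (2 * Y + 1) := by
  have h1 : ∀ y, (X + y) % 2 = 1 - c → y = 2 * Y ∨ y = 2 * Y + 1 →
      Conn' N c (2 * X) y (2 * X + 1) y := fun y h hy =>
    conn_upH ⟨by omega, by omega, Or.inl ⟨by omega, by
      rw [show 2 * X / 2 = X by omega]; exact h⟩⟩ (by omega) rfl
  have h2 : ∀ x, (Y + x) % 2 = 1 - c → x = 2 * X ∨ x = 2 * X + 1 →
      Conn' N c x (2 * Y) x (2 * Y + 1) := fun x h hx =>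
    conn_upV ⟨by omega, by omega, Or.inl ⟨by omega, by
      rw [show 2 * Y / 2 = Y by omega]; exact h⟩⟩ (by omega) rfl
  rcases Int.emod_two_eq_zero_or_one (X + Y) with hp | hp <;> rw [hp]
  · rw [sub_zero, add_zero]
    by_cases h : X % 2 = 1 - c
    · exact (h1 _ (by omega) (Or.inl rfl)).symm.trans (h2 _ (by omega) (Or.inl rfl))
    · exact (h2 _ (by omega) (Or.inr rfl)).trans (h1 _ (by omega) (Or.inr rfl)).symm
  · rw [add_sub_cancel_right]
    by_cases h : X % 2 = 1 - c
    · exact (h1 _ (by omega) (Or.inl rfl)).trans (h2 _ (by omega) (Or.inr rfl))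
    · exact (h2 _ (by omega) (Or.inl rfl)).trans (h1 _ (by omega) (Or.inr rfl))

/-- The step from a square to the one above it. -/
lemma conn_above {X Y : ℤ} (hX : 0 ≤ X) (hY : 0 ≤ Y) (hXY : X + Y + 1 ≤ N - 1)
    (h : 1 ≤ Y ∨ X = 0) : Conn N c (2 * X + (X + Y) % 2) (2 * Y + 1)
      (2 * X + 1 - (X + (Y + 1)) % 2) (2 * (Y + 1)) := by
  rw [show 2 * X + 1 - (X + (Y + 1)) % 2 = 2 * X + (X + Y) % 2 by omega]
  exact conn_lowV ⟨by omega, by omega, Or.inr ⟨by omega, by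
    rw [show (2 * X + (X + Y) % 2) / 2 = X by omega, show (2 * Y + 1) / 2 = Y by omega]
    omega, by omega⟩⟩ (by omega) (by ring)

lemma conn_above' {X Y : ℤ} (hX : 0 ≤ X) (hY : 0 ≤ Y) (hXY : X + Y + 1 ≤ N - 1) :
    Conn' N c (2 * X + (X + Y) % 2) (2 * Y + 1)
      (2 * X + 1 - (X + (Y + 1)) % 2) (2 * (Y + 1)) := by
  rw [show 2 * X + 1 - (X + (Y + 1)) % 2 = 2 * X + (X + Y) % 2 by omega]
  exact conn_upV ⟨by omega, by omega, Or.inr ⟨by omega, by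
    rw [show (2 * X + (X + Y) % 2) / 2 = X by omega, show (2 * Y + 1) / 2 = Y by omega]
    omega⟩⟩ (by omega) (by ring)

/-- A column of the lower part, above the bottom row. -/
lemma conn_column (hc : c = 0 ∨ c = 1) {X : ℤ} (hX : 0 ≤ X) (k : ℕ) (hk : X + k + 1 ≤ N - 1) :
    Conn N c (2 * X + 1 - (X + 1) % 2) 2 (2 * X + (X + (k + 1)) % 2) (2 * (k + 1) + 1) := by
  induction k with
  | zero => exact conn_square hc (Y := 1) hX (by norm_num) (by push_cast at hk; omega)
  | succ k ih =>
    push_cast at hk ⊢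
    exact ((ih (by omega)).trans (conn_above hX (by omega) (by omega) (Or.inl (by omega)))).trans
      (conn_square hc hX (by omega) (by omega))

/-- A column of the upper part. -/
lemma conn_column' (hc : c = 0 ∨ c = 1) {X : ℤ} (hX : 0 ≤ X) (k : ℕ) (hk : X + k ≤ N - 1) :
    Conn' N c (2 * X + 1 - X % 2) 0 (2 * X + (X + k) % 2) (2 * k + 1) := by
  induction k with
  | zero =>
    have := conn_square' hc (N := N) (X := X) (Y := 0) hX le_rfl (by push_cast at hk; omega)
    simpa using this
  | succ k ih =>
    push_cast at hk ⊢
    exact ((ih (by omega)).trans (conn_above' hX (by omega) (by omega))).trans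
      (conn_square' hc hX (by omega) (by omega))

/-- The bottom row. -/
lemma conn_row (hc : c = 0 ∨ c = 1) (k : ℕ) (hk : k ≤ N - 1) :
    Conn N c 1 0 (2 * k + 1 - k % 2) 0 := by
  induction k with
  | zero => exact Conn.refl _ _
  | succ k ih =>
    push_cast at hk ⊢
    have h1 := ih (by omega)
    have s1 := conn_square hc (N := N) (X := k) (Y := 0) (by omega) le_rfl (by omega)
    have s2 := conn_square hc (N := N) (X := k + 1) (Y := 0) (by omega) le_rfl (by omega)
    simp only [add_zero, mul_zero, zero_add] at s1 s2
    -- Consecutive blocks of the bottom row are joined at height 0 for even `k` and at height 1 for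
    -- odd `k`; in the latter case both blocks must be crossed.
    rcases Int.emod_two_eq_zero_or_one (k : ℤ) with hp | hp
    · refine h1.trans (conn_lowH ⟨by omega, le_rfl, Or.inr (Or.inl ⟨rfl, by omega⟩)⟩ ?_ ?_) <;>
        omega
    · refine (h1.trans s1).trans (Conn.trans (conn_lowH ⟨by omega, by norm_num,
        Or.inr (Or.inr ⟨by norm_num, by omega⟩)⟩ ?_ ?_) s2.symm) <;> omega

/-- The ends of neighbouring columns of the upper part. -/
lemma conn_neighbours' {X : ℤ} (hX : 0 ≤ X) (h2 : X % 2 = 0) (hXN : X + 1 ≤ N - 1) :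
    Conn' N c (2 * X + 1 - X % 2) 0 (2 * (X + 1) + 1 - (X + 1) % 2) 0 := by
  rw [show 2 * X + 1 - X % 2 = 2 * X + 1 by omega,
    show 2 * (X + 1) + 1 - (X + 1) % 2 = 2 * X + 2 by omega]
  exact conn_upH ⟨by omega, le_rfl, Or.inr ⟨rfl, by omega⟩⟩ (by omega) (by ring)

/-- The ends of neighbouring columns of the lower part. -/
lemma conn_neighbours {X : ℤ} (hX : 0 ≤ X) (h2 : X % 2 = 1) (hXN : X + 1 ≤ N - 1) :
    Conn N c (2 * X + 1 - (X + 1) % 2) 2 (2 * (X + 1) + 1 - (X + 1 + 1) % 2) 2 := by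
  rw [show 2 * X + 1 - (X + 1) % 2 = 2 * X + 1 by omega,
    show 2 * (X + 1) + 1 - (X + 1 + 1) % 2 = 2 * X + 2 by omega]
  exact conn_lowH ⟨by omega, by norm_num, Or.inr (Or.inr ⟨by norm_num, by omega⟩)⟩ (by omega)
    (by ring)

/-- The beginning of the first column. -/
lemma conn_first (hc : c = 0 ∨ c = 1) (hN : 2 ≤ N) : Conn N c 1 0 0 2 := by
  have h1 := conn_square hc (N := N) (X := 0) (Y := 0) le_rfl le_rfl (by omega)
  have h2 := conn_above (c := c) (N := N) (X := 0) (Y := 0) le_rfl le_rfl (by omega) (Or.inr rfl)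
  norm_num at h1 h2
  exact h1.trans h2

/-- The end of a column of the lower part, when `N` is even. -/
lemma conn_cross_even (hc : c = 0 ∨ c = 1) (h2 : N % 2 = 0) {X : ℤ} (hX : 0 ≤ X)
    (hXN : X ≤ N - 2) :
    Conn N c (2 * X + 1 - (X + 1) % 2) 2
      (2 * N - (2 * (N - 1 - X) + 1 - (N - 1 - X) % 2)) (2 * N) := by
  have h := conn_column hc (N := N) hX (N - 2 - X).toNat (by omega)
  have h' := conn_column' hc (N := N) (X := N - 1 - X) (by omega) X.toNat (by omega)
  have e : (X.toNat : ℤ) = X := by omega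
  have e' : ((N - 2 - X).toNat : ℤ) = N - 2 - X := by omega
  rw [e] at h'
  rw [e'] at h
  -- The lower and the upper column end at the same vertex of the antidiagonal.
  refine h.trans ?_
  have h'' := Conn.symm h'
  convert h'' using 1 <;> omega

/-- The end of a column of the lower part, when `N` is odd. -/
lemma conn_cross_odd (hc : c = 0 ∨ c = 1) (h2 : N % 2 = 1) {X : ℤ} (hX : 0 ≤ X)
    (hXN : X ≤ N - 2) :
    Conn N c (2 * X + 1 - (X + 1) % 2) 2 (2 * X) (2 * (N - X)) := by
  have h := conn_column hc (N := N) hX (N - 2 - X).toNat (by omega)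
  have e' : ((N - 2 - X).toNat : ℤ) = N - 2 - X := by omega
  rw [e'] at h
  refine h.trans ?_
  rw [show 2 * X + (X + (N - 2 - X + 1)) % 2 = 2 * X by omega]
  exact conn_lowV ⟨by omega, by omega, Or.inr ⟨by omega, by omega, by omega⟩⟩ (by omega) (by ring)

/-- The end of a column of the upper part, when `N` is odd. -/
lemma conn_cross_odd' (hc : c = 0 ∨ c = 1) (h2 : N % 2 = 1) {X : ℤ} (hX : 0 ≤ X) (hXN : X ≤ N - 1) :
    Conn' N c (2 * X + 1 - X % 2) 0 (2 * X) (2 * (N - X)) := by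
  have h := conn_column' hc (N := N) hX (N - 1 - X).toNat (by omega)
  have e' : ((N - 1 - X).toNat : ℤ) = N - 1 - X := by omega
  rw [e'] at h
  refine h.trans ?_
  rw [show 2 * X + (X + (N - 1 - X)) % 2 = 2 * X by omega]
  exact conn_upV ⟨by omega, by omega, Or.inr ⟨by omega, by omega⟩⟩ (by omega) (by ring)

/-- The top left corner, when `N` is odd. -/
lemma conn_corner (h2 : N % 2 = 1) (hN : 1 ≤ N) :
    Conn' N c (2 * (N - 1) + 1 - (N - 1) % 2) 0 (2 * N) 0 := by
  rw [show 2 * (N - 1) + 1 - (N - 1) % 2 = 2 * N - 1 by omega]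
  exact conn_upH ⟨by omega, by omega, Or.inr ⟨rfl, by omega⟩⟩ (by omega) (by ring)

/-- All columns of the lower part are connected to the bottom row. -/
lemma conn_lower (hc : c = 0 ∨ c = 1) (k : ℕ) (hk : k ≤ N - 2) :
    Conn N c 1 0 (2 * k + 1 - (k + 1) % 2) 2 := by
  induction k with
  | zero => exact conn_first hc (by push_cast at hk; omega)
  | succ k ih =>
    push_cast at hk ⊢
    have h1 := ih (by omega)
    -- For odd `k` the next column is joined directly at height 2. For even `k` the path runs up the
    -- lower column, through the upper part, and down the next lower column.
    rcases Int.emod_two_eq_zero_or_one (k : ℤ) with hp | hp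
    · refine h1.trans ?_
      rcases Int.emod_two_eq_zero_or_one N with h2 | h2
      · have a1 := conn_cross_even hc h2 (X := k) (by omega) (by omega)
        have a2 := conn_cross_even hc h2 (X := k + 1) (by omega) (by omega)
        have a3 := conn_neighbours' (N := N) (c := c) (X := N - 1 - (k + 1)) (by omega) (by omega)
          (by omega)
        refine a1.trans (Conn.trans ?_ a2.symm)
        have a4 := Conn.symm a3
        rw [show N - 1 - ((k : ℤ) + 1) + 1 = N - 1 - k by ring, sub_zero] at a4
        exact a4
      · have a1 := conn_cross_odd hc h2 (X := k) (by omega) (by omega)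
        have a2 := conn_cross_odd hc h2 (X := k + 1) (by omega) (by omega)
        have a3 := conn_cross_odd' hc h2 (X := N - (k + 1)) (by omega) (by omega)
        refine a1.trans (Conn.trans ?_ a2.symm)
        have a4 : Conn N c _ _ _ _ := a3
        rw [show 2 * N - 2 * (N - ((k : ℤ) + 1)) = 2 * (k + 1) by ring,
          show 2 * N - 2 * (N - (N - ((k : ℤ) + 1))) = 2 * (N - (k + 1)) by ring] at a4
        refine Conn.trans ?_ a4
        -- For `k = 0` there is no upper column `N - k`; the top left corner takes its place.
        rcases Nat.eq_zero_or_pos k with rfl | hk0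
        · have a5 := Conn.symm (conn_corner (c := c) h2 (by omega))
          push_cast
          convert a5 using 1 <;> ring
        · have a5 : Conn N c _ _ _ _ := conn_neighbours' (N := N) (c := c) (X := N - (k + 1))
            (by omega) (by omega) (by omega)
          have a6 : Conn N c _ _ _ _ := conn_cross_odd' hc h2 (X := N - k) (by omega) (by omega)
          rw [show N - ((k : ℤ) + 1) + 1 = N - k by ring] at a5
          have a7 := (a5.trans a6).symm
          convert a7 using 1 <;> ring
    · exact h1.trans (conn_neighbours (by omega) hp (by omega))

/-- All columns of the upper part are connected to the bottom row. -/
lemma conn_upper (hc : c = 0 ∨ c = 1) {X : ℤ} (hX : 0 ≤ X) (hXN : X ≤ N - 1) :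
    Conn N c 1 0 (2 * N - (2 * X + 1 - X % 2)) (2 * N) := by
  rcases Int.emod_two_eq_zero_or_one N with h2 | h2
  · by_cases hX0 : X = 0
    · subst hX0
      have h1 := conn_row hc (N := N) (N - 1).toNat (by omega)
      have h2 := conn_square hc (N := N) (X := N - 1) (Y := 0) (by omega) le_rfl (by omega)
      have h3 := conn_column' hc (N := N) (X := 0) le_rfl (N - 1).toNat (by omega)
      have e : ((N - 1).toNat : ℤ) = N - 1 := by omega
      rw [e] at h1 h3
      have h4 := Conn.symm h3
      simp only [add_zero, mul_zero, zero_add, sub_zero] at h2 h4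
      refine (h1.trans h2).trans ?_
      convert h4 using 1 <;> omega
    · have h1 := conn_lower hc (N := N) (N - 1 - X).toNat (by omega)
      have e : ((N - 1 - X).toNat : ℤ) = N - 1 - X := by omega
      rw [e] at h1
      have h2 := conn_cross_even hc h2 (X := N - 1 - X) (by omega) (by omega)
      rw [show N - 1 - (N - 1 - X) = X by ring] at h2
      exact h1.trans h2
  · have hbr : Conn N c 1 0 (2 * N - (2 * 0 + 1 - 0 % 2)) (2 * N) := by
      have h1 := conn_row hc (N := N) (N - 1).toNat (by omega)
      have e : ((N - 1).toNat : ℤ) = N - 1 := by omega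
      rw [e] at h1
      have h3 := Conn.symm (conn_cross_odd' hc h2 (X := 0) le_rfl (by omega))
      simp only [mul_zero, sub_zero, sub_self] at h3
      refine h1.trans (Conn.trans (conn_lowH ⟨by omega, le_rfl, Or.inr (Or.inl ⟨rfl, by omega⟩)⟩
        (by omega) (x' := 2 * N) (by omega)) ?_)
      convert h3 using 1
      norm_num
    by_cases hX0 : X = 0
    · subst hX0; exact hbr
    by_cases hX1 : X = 1
    · subst hX1
      have := conn_neighbours' (N := N) (c := c) (X := 0) le_rfl rfl (by omega)
      refine hbr.trans ?_
      have h4 : Conn N c _ _ _ _ := this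
      convert h4 using 1 <;> norm_num
    · have h1 := conn_lower hc (N := N) (N - X).toNat (by omega)
      have e : ((N - X).toNat : ℤ) = N - X := by omega
      rw [e] at h1
      have h3 := conn_cross_odd hc h2 (X := N - X) (by omega) (by omega)
      have h4 : Conn N c _ _ _ _ := conn_cross_odd' hc h2 (X := X) (by omega) (by omega)
      refine (h1.trans h3).trans ?_
      have h5 := h4.symm
      convert h5 using 1 <;> ring

end

section
variable {N c : ℤ}

/-- `hodd` singles out the two corners of each block that its path joins. An edge of the loop inside
a block has one such end, an edge between blocks has two, so every edge is reached. -/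
lemma conn_of_low (hc : c = 0 ∨ c = 1) {x y : ℤ} (hx : 0 ≤ x) (hy : 0 ≤ y)
    (hxy : x / 2 + y / 2 ≤ N - 1) (hodd : (x + y + x / 2 + y / 2) % 2 = 1) : Conn N c 1 0 x y := by
  have hs := conn_square hc (N := N) (X := x / 2) (Y := y / 2) (by omega) (by omega) hxy
  have ht : Conn N c 1 0 (2 * (x / 2) + (x / 2 + y / 2) % 2) (2 * (y / 2) + 1) := by
    by_cases hy0 : y / 2 = 0
    · rw [hy0] at hs ⊢
      have h1 := conn_row hc (N := N) (x / 2).toNat (by omega)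
      have e : ((x / 2).toNat : ℤ) = x / 2 := by omega
      rw [e] at h1
      rw [add_zero, mul_zero] at hs ⊢
      exact h1.trans hs
    · have h1 := conn_lower hc (N := N) (x / 2).toNat (by omega)
      have h2 := conn_column hc (N := N) (X := x / 2) (by omega) (y / 2 - 1).toNat (by omega)
      have e : ((x / 2).toNat : ℤ) = x / 2 := by omega
      have e' : ((y / 2 - 1).toNat : ℤ) = y / 2 - 1 := by omega
      rw [e] at h1
      rw [e', sub_add_cancel] at h2
      exact h1.trans h2
  rcases Int.emod_two_eq_zero_or_one y with h0 | h0
  · have := ht.trans hs.symm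
    convert this using 1 <;> omega
  · convert ht using 1 <;> omega

lemma conn_of_up (hc : c = 0 ∨ c = 1) {x y : ℤ} (hx : 0 ≤ x) (hy : 0 ≤ y)
    (hxy : x / 2 + y / 2 ≤ N - 1) (hodd : (x + y + x / 2 + y / 2) % 2 = 1) :
    Conn N c 1 0 (2 * N - x) (2 * N - y) := by
  have hs : Conn N c _ _ _ _ :=
    conn_square' hc (N := N) (X := x / 2) (Y := y / 2) (by omega) (by omega) hxy
  have ht : Conn N c 1 0 (2 * N - (2 * (x / 2) + (x / 2 + y / 2) % 2))
      (2 * N - (2 * (y / 2) + 1)) := by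
    have h1 := conn_upper hc (N := N) (X := x / 2) (by omega) (by omega)
    have h2 : Conn N c _ _ _ _ :=
      conn_column' hc (N := N) (X := x / 2) (by omega) (y / 2).toNat (by omega)
    have e' : ((y / 2).toNat : ℤ) = y / 2 := by omega
    rw [e', sub_zero] at h2
    exact h1.trans h2
  rcases Int.emod_two_eq_zero_or_one y with h0 | h0
  · have := ht.trans hs.symm
    convert this using 1 <;> omega
  · convert ht using 1 <;> omega

lemma conn_of_oddH (hc : c = 0 ∨ c = 1) {x y : ℤ} (h : oddH N c x y) :
    Conn N c 1 0 x y ∧ Conn N c 1 0 (x + 1) y := by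
  have hstep : Conn N c x y (x + 1) y := (gr_right.2 (oddE_right.2 h)).reachable
  rcases h with ⟨hs, hx, hy, h⟩ | ⟨hs, hx, hy, h⟩
  · by_cases hg : (x + y + x / 2 + y / 2) % 2 = 1
    · have := conn_of_low (N := N) hc hx hy (by omega) hg
      exact ⟨this, this.trans hstep⟩
    · have := conn_of_low (N := N) (x := x + 1) hc (by omega) hy (by omega) (by omega)
      exact ⟨this.trans hstep.symm, this⟩
  · by_cases hg : (2 * N - 1 - x + (2 * N - y) + (2 * N - 1 - x) / 2 + (2 * N - y) / 2) % 2 = 1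
    · have := conn_of_up (N := N) hc hx hy (by omega) hg
      rw [show 2 * N - (2 * N - 1 - x) = x + 1 by ring, show 2 * N - (2 * N - y) = y by ring] at this
      exact ⟨this.trans hstep.symm, this⟩
    · have := conn_of_up (N := N) (x := 2 * N - x) (y := 2 * N - y) hc (by omega) hy (by omega)
        (by omega)
      rw [show 2 * N - (2 * N - x) = x by ring, show 2 * N - (2 * N - y) = y by ring] at this
      exact ⟨this, this.trans hstep⟩

lemma conn_of_oddV (hc : c = 0 ∨ c = 1) {x y : ℤ} (h : oddV N c x y) :
    Conn N c 1 0 x y ∧ Conn N c 1 0 x (y + 1) := by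
  have hstep : Conn N c x y x (y + 1) := (gr_up.2 (oddE_up.2 h)).reachable
  rcases h with ⟨hs, hx, hy, h⟩ | ⟨hs, hx, hy, h⟩
  · by_cases hg : (x + y + x / 2 + y / 2) % 2 = 1
    · have := conn_of_low (N := N) hc hx hy (by omega) hg
      exact ⟨this, this.trans hstep⟩
    · have := conn_of_low (N := N) (y := y + 1) hc hx (by omega) (by omega) (by omega)
      exact ⟨this.trans hstep.symm, this⟩
  · by_cases hg : (2 * N - x + (2 * N - 1 - y) + (2 * N - x) / 2 + (2 * N - 1 - y) / 2) % 2 = 1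
    · have := conn_of_up (N := N) hc hx hy (by omega) hg
      rw [show 2 * N - (2 * N - 1 - y) = y + 1 by ring, show 2 * N - (2 * N - x) = x by ring] at this
      exact ⟨this.trans hstep.symm, this⟩
    · have := conn_of_up (N := N) (x := 2 * N - x) (y := 2 * N - y) hc hx (by omega) (by omega)
        (by omega)
      rw [show 2 * N - (2 * N - x) = x by ring, show 2 * N - (2 * N - y) = y by ring] at this
      exact ⟨this, this.trans hstep⟩

lemma conn_of_adj (hc : c = 0 ∨ c = 1) {u w : ℤ × ℤ} (h : (gr (oddE N c)).Adj u w) :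
    Conn N c 1 0 u.1 u.2 := by
  obtain ⟨x, y⟩ := u
  rcases nbr_cases h.1 with rfl | rfl | rfl | rfl
  · rw [gr_right, oddE_right] at h
    exact (conn_of_oddH hc h).1
  · rw [gr_left, show 2 * x = 2 * (x - 1) + 2 by ring, oddE_right] at h
    have := (conn_of_oddH hc h).2
    rwa [sub_add_cancel] at this
  · rw [gr_up, oddE_up] at h
    exact (conn_of_oddV hc h).1
  · rw [gr_down, show 2 * y = 2 * (y - 1) + 2 by ring, oddE_up] at h
    have := (conn_of_oddV hc h).2
    rwa [sub_add_cancel] at this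

lemma oddE_bottom (hN : 1 ≤ N) : oddE N c 4 1 :=
  (oddE_right (x := 1) (y := 0)).2
    (Or.inl ⟨by omega, by norm_num, le_rfl, Or.inr (Or.inl ⟨rfl, rfl⟩)⟩)

lemma oddE_left (hN : 1 ≤ N) : oddE N c 1 4 :=
  (oddE_up (x := 0) (y := 1)).2
    (Or.inl ⟨by omega, by norm_num, by norm_num, Or.inr ⟨rfl, rfl, Or.inr rfl⟩⟩)

lemma oddE_top (hN : 1 ≤ N) : oddE N c (4 * N - 2) (2 * (2 * N + 1) - 1) := by
  have := oddE_right (N := N) (c := c) (x := 2 * N - 2) (y := 2 * N)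
  rw [show 2 * (2 * N - 2) + 2 = 4 * N - 2 by ring,
    show 2 * (2 * N) + 1 = 2 * (2 * N + 1) - 1 by ring] at this
  exact this.2 (Or.inr ⟨by omega, by omega, by omega, Or.inr ⟨by omega, by omega⟩⟩)

lemma oddE_right_side (hN : 1 ≤ N) : oddE N c (2 * (2 * N + 1) - 1) (4 * N - 2) := by
  have := oddE_up (N := N) (c := c) (x := 2 * N) (y := 2 * N - 2)
  rw [show 2 * (2 * N - 2) + 2 = 4 * N - 2 by ring,
    show 2 * (2 * N) + 1 = 2 * (2 * N + 1) - 1 by ring] at this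
  exact this.2 (Or.inr ⟨by omega, by omega, by omega, Or.inr ⟨by omega, by
    rw [sub_self, show 2 * N - 1 - (2 * N - 2) = 1 by ring]; rfl⟩⟩)

lemma isLoop_oddE (hN : 1 ≤ N) (hc : c = 0 ∨ c = 1) : IsLoop (2 * N + 1) (2 * N + 1) (oddE N c) where
  supp := oddE_supp
  deg := oddE_deg hc
  conn := by
    rintro u v ⟨u', hu⟩ ⟨v', hv⟩
    exact (conn_of_adj hc hu).symm.trans (conn_of_adj hc hv)
  nonempty := ⟨_, _, (gr_right (x := 1) (y := 0)).2 (oddE_bottom hN)⟩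

lemma pair_odd (hN : 1 ≤ N) : Pair (2 * N + 1) (2 * N + 1) (dif (oddE N 0) (oddE N 1))
    (fun a b => oddE N 0 a b ∧ oddE N 1 a b) :=
  ⟨_, _, isLoop_oddE hN (Or.inl rfl), isLoop_oddE hN (Or.inr rfl), rfl,
    fun _ _ hx hx' hy hy' => oddE_cell hx hx' hy hy', fun _ _ h => h⟩

/-- The diagonal points alternate between horizontal and vertical edges of the lower part; the edge
lies inside a block, hence in the difference, for the residues 1 and 2. -/
lemma dif_oddE_diag {i : ℤ} (hi : 0 ≤ i) (hiN : i ≤ 2 * N) :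
    dif (oddE N 0) (oddE N 1) (i + 1) i ≠ 0 ↔ i % 4 = 1 ∨ i % 4 = 2 := by
  rw [dif_ne_zero]
  rcases Int.emod_two_eq_zero_or_one i with h | h
  · obtain ⟨y, rfl⟩ : ∃ y, i = 2 * (y + 1) := ⟨i / 2 - 1, by omega⟩
    rw [show 2 * (y + 1) + 1 = 2 * (y + 1) + 1 by ring, show 2 * (y + 1) = 2 * y + 2 by ring,
      show 2 * y + 2 + 1 = 2 * (y + 1) + 1 by ring, oddE_up, oddE_up]
    have : ∀ c, oddV N c (y + 1) y ↔ lowV c (y + 1) y := fun c =>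
      ⟨fun h' => h'.elim (fun h => h.2) (fun h => by omega), fun h' => Or.inl ⟨by omega, h'⟩⟩
    rw [this, this]
    unfold lowV
    rcases Int.emod_two_eq_zero_or_one y with h0 | h0 <;>
    rcases Int.emod_two_eq_zero_or_one (y / 2 + (y + 1)) with h1 | h1 <;> rw [h0, h1] <;>
      norm_num <;> omega
  · obtain ⟨y, rfl⟩ : ∃ y, i = 2 * y + 1 := ⟨i / 2, by omega⟩
    rw [show 2 * y + 1 + 1 = 2 * y + 2 by ring, oddE_right, oddE_right]
    have : ∀ c, oddH N c y y ↔ lowH c y y := fun c =>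
      ⟨fun h' => h'.elim (fun h => h.2) (fun h => by omega), fun h' => Or.inl ⟨by omega, h'⟩⟩
    rw [this, this]
    unfold lowH
    rcases Int.emod_two_eq_zero_or_one y with h0 | h0 <;>
    rcases Int.emod_two_eq_zero_or_one (y / 2 + y) with h1 | h1 <;> rw [h0, h1] <;>
      norm_num <;> omega

end

/-! ### The lower bound in all cases. -/

/-- With `q = 2N + 1` and this number `k` of ones, `q - 2k` is 1 or -1, the best possible for odd
`q`. -/
lemma sum_mod_four (N : ℕ) :
    ∑ i ∈ Finset.range (2 * N + 1), (if (i : ℤ) % 4 = 1 ∨ (i : ℤ) % 4 = 2 then (1 : ℤ) else 0) =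
      N + N % 2 := by
  induction N with
  | zero => simp
  | succ N ih =>
    rw [show 2 * (N + 1) + 1 = 2 * N + 1 + 1 + 1 by ring, Finset.sum_range_succ,
      Finset.sum_range_succ, ih]
    push_cast
    split_ifs <;> omega

lemma attained_odd {N m' n' : ℕ} (hN : 1 ≤ N) (hm : 0 < m') (hn : 0 < n') :
    Attained ((2 * N + 1) * m') ((2 * N + 1) * n')
      (((2 * N + 1) * m' : ℕ) * ((2 * N + 1) * n' : ℕ) - m' * n') := by
  obtain ⟨k, rfl⟩ : ∃ k, m' = k + 1 := ⟨m' - 1, by omega⟩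
  obtain ⟨l, rfl⟩ : ∃ l, n' = l + 1 := ⟨n' - 1, by omega⟩
  have hN' : (1 : ℤ) ≤ N := by exact_mod_cast hN
  obtain ⟨f, K, h1, h2, h3⟩ := (pair_odd hN').array (by omega) (by omega) k l
    ⟨oddE_left hN', oddE_left hN'⟩ ⟨oddE_right_side hN', oddE_right_side hN'⟩
    ⟨oddE_bottom hN', oddE_bottom hN'⟩ ⟨oddE_top hN', oddE_top hN'⟩
  have h1' : Pair ((2 * N + 1) * (k + 1) : ℕ) ((2 * N + 1) * (l + 1) : ℕ) f K := by
    push_cast at h1 ⊢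
    rw [mul_comm, mul_comm _ ((l : ℤ) + 1)]
    exact h1
  refine ⟨f, K, h1', ?_⟩
  rw [h1'.dcard_eq rfl rfl (by positivity) (by positivity) (k := N + N % 2)]
  · push_cast
    rcases Nat.mod_two_eq_zero_or_one N with h | h
    · rw [show ((N : ℤ) % 2) = 0 by omega]; ring
    · rw [show ((N : ℤ) % 2) = 1 by omega]; ring
  · intro b
    push_cast
    exact h3 _ le_rfl (fun b => (pair_odd hN').eq_zero (by omega)) b
  · rw [← sum_mod_four]
    apply Finset.sum_congr rfl
    intro i hi
    rw [Finset.mem_range] at hi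
    rw [h2 _ _ (by omega) (by omega)]
    exact if_congr (dif_oddE_diag (by omega) (by omega)) rfl rfl

/-- This serves blocks of side `q = 1`, for which the formula gives zero. -/
lemma attained_zero {m n : ℕ} (hm : 2 ≤ m) (hn : 2 ≤ n) : Attained m n 0 := by
  have h : IsLoop m n (polygon square) := isLoop_square.mono (by omega) (by omega)
  have hz : dif (polygon square) (polygon square) = fun _ _ => 0 := by
    funext a b; simp [dif]
  refine ⟨_, fun _ _ => False, ⟨_, _, h, h, hz, fun _ _ _ _ _ _ => rfl, fun _ _ h => h.elim⟩, ?_⟩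
  simp [dcard]

lemma attained_of_odd {q m' n' : ℕ} (hq : Odd q) (hm : 2 ≤ q * m') (hn : 2 ≤ q * n') :
    Attained (q * m') (q * n') ((q * m' : ℕ) * (q * n' : ℕ) - m' * n') := by
  obtain ⟨N, rfl⟩ := hq
  rcases Nat.eq_zero_or_pos N with rfl | hN
  · have := attained_zero hm hn
    convert this using 1
    push_cast
    ring
  · exact attained_odd hN (Nat.pos_of_ne_zero (by rintro rfl; omega))
      (Nat.pos_of_ne_zero (by rintro rfl; omega))

lemma attained_delta {m n d m' n' : ℕ} (hm : 2 ≤ m) (hn : 2 ≤ n) (hd : d = Nat.gcd m n)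
    (hm' : m = d * m') (hn' : n = d * n') :
    Attained m n ((m : ℤ) * n - (delta m n : ℤ) * m' * n') := by
  have hd0 : 0 < d := by rw [hd]; exact Nat.gcd_pos_of_pos_left _ (by omega)
  have hdm : d ∣ m := ⟨m', hm'⟩
  have hdn : d ∣ n := ⟨n', hn'⟩
  unfold delta
  rw [← hd]
  split_ifs with c1 c2 c3
  · have := attained_of_odd (m' := m') (n' := n') c1 (by omega) (by omega)
    rw [← hm', ← hn'] at this
    simpa using this
  · have h4 : 4 ∣ d := Nat.dvd_of_mod_eq_zero c2
    have := attained_of_four_dvd (h4.trans hdm) (h4.trans hdn) (by omega) (by omega)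
    simpa using this
  · obtain ⟨c3, hm4, hn4, hev⟩ := c3
    rw [show m * n = m' * n' * d ^ 2 by rw [hm', hn']; ring,
      Nat.mul_div_cancel _ (by positivity), Nat.even_mul] at hev
    -- The quotients by the gcd cannot both be even, so exactly one side is divisible by 4 and the
    -- other is 2 modulo 4.
    have hcop : ¬(Even m' ∧ Even n') := by
      rintro ⟨⟨a, ha⟩, ⟨b, hb⟩⟩
      have : 2 * d ∣ d := by
        conv_rhs => rw [hd]
        exact Nat.dvd_gcd ⟨a, by rw [hm', ha]; ring⟩ ⟨b, by rw [hn', hb]; ring⟩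
      have := Nat.le_of_dvd hd0 this
      omega
    have key : ∀ r : ℕ, Even r → 4 ∣ d * r := by
      rintro r ⟨a, rfl⟩
      exact ⟨(d / 2) * a, by
        conv_lhs => rw [show d = 2 * (d / 2) by omega]
        ring⟩
    have key' : ∀ r : ℕ, ¬Even r → d * r % 4 = 2 := by
      intro r hr
      rw [Nat.mul_mod, c3]
      have := Nat.odd_iff.1 (Nat.not_even_iff_odd.1 hr)
      omega
    simp only [Nat.cast_zero, zero_mul, sub_zero]
    rcases hev with hev | hev
    · have h1 : 4 ∣ m := by rw [hm']; exact key _ hev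
      have h2 : n % 4 = 2 := by rw [hn']; exact key' _ (fun h => hcop ⟨hev, h⟩)
      have := (attained_of_mod_four_eq_two h2 h1 hn4 (by omega)).transpose
      rwa [mul_comm] at this
    · have h1 : 4 ∣ n := by rw [hn']; exact key _ hev
      have h2 : m % 4 = 2 := by rw [hm']; exact key' _ (fun h => hcop ⟨h, hev⟩)
      exact attained_of_mod_four_eq_two h2 h1 hm4 (by omega)
  · have hev : d % 2 = 0 := Nat.even_iff.1 (Nat.not_odd_iff_even.1 c1)
    -- The grid splits into `2m'` by `2n'` squares of odd side `d / 2`, which costs `4m'n'` in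
    -- total.
    have hq : Odd (d / 2) := Nat.odd_iff.2 (by omega)
    have e1 : d / 2 * (2 * m') = m := by
      rw [hm', ← mul_assoc, Nat.div_mul_cancel (Nat.dvd_of_mod_eq_zero hev)]
    have e2 : d / 2 * (2 * n') = n := by
      rw [hn', ← mul_assoc, Nat.div_mul_cancel (Nat.dvd_of_mod_eq_zero hev)]
    have := attained_of_odd (m' := 2 * m') (n' := 2 * n') hq (by omega) (by omega)
    rw [e1, e2] at this
    convert this using 1
    push_cast
    ring

end Slitherlink

theorem mainTheorem2 (m n d m' n' : ℕ) (hm : 2 ≤ m) (hn : 2 ≤ n) (hd : d = Nat.gcd m n)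
    (hm' : m = d * m') (hn' : n = d * n') :
    IsGreatest
      {s : ℤ | ∃ C₁ C₂ : Finset (Sym2 (Fin m × Fin n)),
        Slitherlink.IsCycle C₁ ∧ Slitherlink.IsCycle C₂ ∧
        Slitherlink.signature C₁ = Slitherlink.signature C₂ ∧
        s = ((symmDiff C₁ C₂).card : ℤ)}
      ((m : ℤ) * (n : ℤ) - (Slitherlink.delta m n : ℤ) * (m' : ℤ) * (n' : ℤ)) := by
  constructor
  · obtain ⟨f, K, ⟨e₁, e₂, h₁, h₂, rfl, hc, -⟩, hcard⟩ :=
      Slitherlink.attained_delta hm hn hd hm' hn'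
    obtain ⟨C₁, C₂, hC₁, hC₂, hs, hC⟩ := Slitherlink.exists_cycles h₁ h₂ hc
    exact ⟨C₁, C₂, hC₁, hC₂, hs, by rw [hC, hcard]⟩
  · rintro s ⟨C₁, C₂, h₁, h₂, hs, rfl⟩
    exact h₁.card_symmDiff_le hm hn hd hm' hn' h₂ hs
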